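/- Let $d,b\ge 1$ and let $\mathcal T$ be a conforming, shape-regular simplicial mesh of a domain $\Omega\subseteq\mathbb R^d$ (a periodic mesh being viewed as a mesh of $\mathbb R^d$). Consider the symmetric linear hyperbolic system $\partial_t g(u)+\mathrm{div}_x f(u)=0$ with $g(u)=\mathcal G u$ and $f(u)_{lj}=(\mathcal L^{(j)}u)_l$, where $\mathcal G,\mathcal L^{(1)},\dots,\mathcal L^{(d)}:\Omega\to\mathbb R^{b\times b}$ are symmetric, bounded by $\Lambda$ and constant on each mesh element, $\mathcal G\ge g_0 I$ with $g_0>0$, and $\sum_j\partial_j\mathcal L^{(j)}=0$ in the sense of distributions on $\Omega$. Let the wave speeds (the $|\mu|$ with $\sum_j\nu_j\mathcal L^{(j)}w=\mu\,\mathcal G w$ for some unit vector $\nu$ and some $w\neq0$) be at most $c_w<c_{\max}$. Let $\mathrm v$ be a mesh vertex in the interior of $\Omega$ and $\Omega^{\mathrm v}$ its vertex patch. Let $\varphi_{\rm bot},\varphi_{\rm top}$ be continuous functions on $\Omega$, affine on every element, which agree at all vertices except $\mathrm v$, with $\varphi_{\rm bot}(\mathrm v)\le\varphi_{\rm top}(\mathrm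 v)$, and which satisfy the causality condition $\|\mathrm{grad}_x\varphi\|_2<1/c_{\max}$ on each element. Put $\delta=\varphi_{\rm top}-\varphi_{\rm bot}$. Let $V_h$ be the space of functions on $\Omega^{\mathrm v}$ whose restriction to each element is an $\mathbb R^b$-valued polynomial of degree at most $p$, let $(\cdot,\cdot)$ be the $L^2$ inner product, and let $S\in\mathbb R^{b\times b}$ be a constant symmetric positive definite matrix. Define operators $M_0,M_1,A:V_h\to V_h$ by requiring, for all $w,v\in V_h$, $$(M_0w,v)=(g(w)-f(w)\,\mathrm{grad}_x\varphi_{\rm bot},v),\qquad (M_1w,v)=(f(w)\,\mathrm{grad}_x\delta,v),$$ $$(Aw,v)=\sum_{K\subseteq\Omega^{\mathrm v}}\int_K\delta f(w):\mathrm{grad}_xv\,dx+\int_{\mathcal F^{\mathrm v}}\delta\,(\mathcal D\{w\}-S[\![w]\!])\cdot[\![v]\!]\,dS,$$ where $\mathcal F^{\mathrm v}$ is the set of facets of the patch, $\nu$ is a unit normal on each facet, $\mathcal D=\sum_j\nu_j\mathcal L^{(j)}$, $[\![w]\!](x)=\lim_{\varepsilon\to0^+}\big(w(x+\varepsilon\nu)-w(x-\varepsilon\nu)\big)$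 and $\{w\}(x)=\lim_{\varepsilon\to0^+}\tfrac12\big(w(x+\varepsilon\nu)+w(x-\varepsilon\nu)\big)$; since $\delta$ vanishes on $\partial\Omega^{\mathrm v}$, only interior facets contribute. For $\tau>0$ put $M=M_0-\tau M_1$, $X_0=I$, $X_i=\tau M_0^{-1}(A+iM_1)X_{i-1}$ for $i\ge1$, and $$R_sv=\sum_{i=0}^{s-1}\frac1{i!}X_iv+M^{-1}M_0\,\frac1{s!}X_sv .$$ For a selfadjoint positive definite operator $B$ write $\|v\|_B=(Bv,v)^{1/2}$. **Theorem.** Suppose $0<p\le(s-1)/2$ (with $p,s$ integers). Then there are constants $\tau_0>0$ and $C>0$, depending only on $d$, $b$, $s$, $p$, $S$, $g_0$, $\Lambda$, $c_w$, $c_{\max}$ and the shape-regularity constant (in particular not on the mesh size $h$ or on $\tau$), such that for all $0<\tau\le\tau_0$ the operators $M_0$ and $M$ are selfadjoint and positive definite and $$\|R_sv\|_M\le\left(1+C\tau^{2s-2p+1}\right)\|v\|_{M_0}\qquad\text{for all }v\in V_h .$$ -/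

import Mathlib

open MeasureTheory MvPolynomial
open scoped ContDiff

noncomputable section

namespace TentSAT

/-! ### Spatial meshes and tents -/

/-- The spatial domain lives in `ℝ^d` with the Euclidean norm. -/
abbrev Space (d : ℕ) := EuclideanSpace ℝ (Fin d)

/-- The closed simplex with the given vertices. -/
def body {d : ℕ} (K : Finset (Space d)) : Set (Space d) :=
  convexHull ℝ (K : Set (Space d))

/-- The barycenter of a simplex. -/
def barycenter {d : ℕ} (K : Finset (Space d)) : Space d :=
  K.centroid ℝ id

/-- A conforming simplicial mesh of a domain in `ℝ^d`: a geometric simplicial complex, every face of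
which is a face of a `d`-simplex. Finite meshes satisfy the local finiteness; infinite
meshes are admitted so that a periodic mesh can be viewed as a mesh of `ℝ^d`. -/
structure Mesh (d : ℕ) extends Geometry.SimplicialComplex ℝ (Space d) where
  pure : ∀ F ∈ faces, ∃ K ∈ faces, F ⊆ K ∧ K.card = d + 1
  locallyFinite : LocallyFinite fun F : faces => body (F : Finset (Space d))

/-- The mesh elements are the `d`-dimensional simplices. -/
def Mesh.IsElement {d : ℕ} (T : Mesh d) (K : Finset (Space d)) : Prop :=
  K ∈ T.faces ∧ K.card = d + 1

/-- The (closed) spatial domain covered by the mesh. -/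
def Mesh.domain {d : ℕ} (T : Mesh d) : Set (Space d) :=
  ⋃ K ∈ {K | T.IsElement K}, body K

/-- The elements of the vertex patch of `v`. -/
def Mesh.patch {d : ℕ} (T : Mesh d) (v : Space d) : Set (Finset (Space d)) :=
  {K | T.IsElement K ∧ v ∈ K}

/-- Shape regularity with constant `κ`: every element `K` contains a ball of radius
`diam K / κ`. -/
def Mesh.ShapeRegular {d : ℕ} (T : Mesh d) (κ : ℝ) : Prop :=
  ∀ K, T.IsElement K → ∃ x, Metric.closedBall x (Metric.diam (body K) / κ) ⊆ body K

/-- Lowest-order Lagrange finite element functions: continuous and affine on every element. -/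
structure LagrangeP1 {d : ℕ} (T : Mesh d) where
  toFun : Space d → ℝ
  continuousOn : ContinuousOn toFun T.domain
  affine : ∀ K, T.IsElement K → ∃ g : Space d →ᵃ[ℝ] ℝ, Set.EqOn toFun g (body K)

/-- The (constant) gradient of a piecewise affine function on the element `K`. -/
def LagrangeP1.grad {d : ℕ} {T : Mesh d} (φ : LagrangeP1 T) (K : Finset (Space d)) : Space d :=
  gradient φ.toFun (barycenter K)

/-- The causality condition `‖grad φ‖₂ < 1 / c_max`. -/
def LagrangeP1.Causal {d : ℕ} {T : Mesh d} (φ : LagrangeP1 T) (cmax : ℝ) : Prop :=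
  ∀ K, T.IsElement K → ‖φ.grad K‖ < 1 / cmax

/-- A tent erected over the vertex patch of `v`: it is bounded by two fronts, which
differ only by the height of the tent pole at `v`. -/
structure Tent {d : ℕ} (T : Mesh d) (v : Space d) where
  bot : LagrangeP1 T
  top : LagrangeP1 T
  pole : bot.toFun v ≤ top.toFun v
  eq_of_ne : ∀ a, {a} ∈ T.faces → a ≠ v → top.toFun a = bot.toFun a

/-- `δ = φ_top - φ_bot`. -/
def Tent.delta {d : ℕ} {T : Mesh d} {v : Space d} (t : Tent T v) : LagrangeP1 T where
  toFun x := t.top.toFun x - t.bot.toFun x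
  continuousOn := t.top.continuousOn.sub t.bot.continuousOn
  affine K hK := by
    obtain ⟨g, hg⟩ := t.top.affine K hK
    obtain ⟨g', hg'⟩ := t.bot.affine K hK
    exact ⟨g - g', fun x hx => by simp [hg hx, hg' hx]⟩

/-! ### The hyperbolic system -/

/-- Coefficients that are constant on each mesh element: `G K` and `L j K` are the
values on the element `K` of `𝒢` and of `𝓛^(j)`. -/
structure Coefficients (d b : ℕ) where
  G : Finset (Space d) → Matrix (Fin b) (Fin b) ℝ
  L : Fin d → Finset (Space d) → Matrix (Fin b) (Fin b) ℝ

/-- `∑_j ξ_j 𝓛^(j)` on the element `K`. -/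
def Coefficients.flux {d b : ℕ} (c : Coefficients d b) (K : Finset (Space d)) (ξ : Space d) :
    Matrix (Fin b) (Fin b) ℝ :=
  ∑ j, ξ j • c.L j K

/-- The standing assumptions on the system `∂_t g(u) + div_x f(u) = 0`:
symmetry, boundedness by `Λ`, uniform positive definiteness of `𝒢` with constant `g₀`,
`∑_j ∂_j 𝓛^(j) = 0` in the sense of distributions, and wave speeds at most `cw`. -/
structure Coefficients.Admissible {d b : ℕ} (c : Coefficients d b) (T : Mesh d)
    (g₀ Λ cw : ℝ) : Prop where
  symm_G : ∀ K, T.IsElement K → (c.G K).IsSymm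
  symm_L : ∀ j K, T.IsElement K → (c.L j K).IsSymm
  bound_G : ∀ K, T.IsElement K → ∀ i k, |c.G K i k| ≤ Λ
  bound_L : ∀ j K, T.IsElement K → ∀ i k, |c.L j K i k| ≤ Λ
  posDef_G : ∀ K, T.IsElement K → ∀ w : Fin b → ℝ, g₀ * (w ⬝ᵥ w) ≤ w ⬝ᵥ (c.G K).mulVec w
  divFree : ∀ ψ : Space d → ℝ, ContDiff ℝ ∞ ψ → HasCompactSupport ψ →
    tsupport ψ ⊆ interior T.domain → ∀ i k,
      (∑ᶠ K ∈ {K | T.IsElement K}, ∑ j, c.L j K i k *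
        (∫ x in body K, fderiv ℝ ψ x (EuclideanSpace.single j 1))) = 0
  waveSpeed : ∀ K, T.IsElement K → ∀ ν : Space d, ‖ν‖ = 1 → ∀ (w : Fin b → ℝ) (μ : ℝ),
    w ≠ 0 → (c.flux K ν).mulVec w = μ • (c.G K).mulVec w → |μ| ≤ cw

/-! ### Integrals of polynomials over elements and facets -/

/-- `∫_K q P dx`. -/
def elemInt {d : ℕ} (K : Finset (Space d)) (q : Space d → ℝ) (P : MvPolynomial (Fin d) ℝ) : ℝ :=
  ∫ x in body K, q x * eval x.ofLp P

/-- `∫_F q P dS`, with respect to the `(d-1)`-dimensional surface measure. -/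
def facetInt {d : ℕ} (F : Finset (Space d)) (q : Space d → ℝ) (P : MvPolynomial (Fin d) ℝ) : ℝ :=
  ∫ x in body F, q x * eval x.ofLp P ∂μHE[d - 1]

lemma isCompact_body {d : ℕ} (K : Finset (Space d)) : IsCompact (body K) :=
  K.finite_toSet.isCompact_convexHull ℝ

lemma continuous_evalPoly {d : ℕ} (P : MvPolynomial (Fin d) ℝ) :
    Continuous fun x : Space d => eval x.ofLp P :=
  (MvPolynomial.continuous_eval P).comp (PiLp.continuous_ofLp 2 _)

lemma integrableOn_body {d : ℕ} (μ : Measure (Space d)) (K : Finset (Space d))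
    (hμ : μ (body K) < ⊤) {q : Space d → ℝ} (hq : ContinuousOn q (body K))
    (P : MvPolynomial (Fin d) ℝ) :
    IntegrableOn (fun x => q x * eval x.ofLp P) (body K) μ := by
  have hc : ContinuousOn (fun x : Space d => q x * eval x.ofLp P) (body K) :=
    hq.mul (continuous_evalPoly P).continuousOn
  obtain ⟨B, hB⟩ := (isCompact_body K).exists_bound_of_continuousOn hc
  have : IsFiniteMeasure (μ.restrict (body K)) := isFiniteMeasure_restrict.mpr hμ.ne
  exact Integrable.of_bound
    (hc.aestronglyMeasurable (isCompact_body K).isClosed.measurableSet) B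
    (by filter_upwards [ae_restrict_mem (isCompact_body K).isClosed.measurableSet] with x hx
        using hB x hx)

lemma facet_measure_lt_top {d : ℕ} (F : Finset (Space d)) (hF : F.card = d) :
    (μHE[d - 1] : Measure (Space d)) (body F) < ⊤ := by
  cases d with
  | zero =>
    have : F = ∅ := Finset.card_eq_zero.mp hF
    simp [body, this]
  | succ n =>
    have e : F ≃ Fin (n + 1) := F.equivFinOfCardEq hF
    let a : Fin (n + 1) → Space (n + 1) := fun i => (e.symm i : Space (n + 1))
    let f : EuclideanSpace ℝ (Fin n) →ₗ[ℝ] Space (n + 1) :=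
      { toFun := fun y => ∑ i, y i • (a i.succ - a 0)
        map_add' := fun x y => by simp [add_smul, Finset.sum_add_distrib]
        map_smul' := fun c x => by simp [mul_smul, Finset.smul_sum] }
    let s : Set (EuclideanSpace ℝ (Fin n)) :=
      convexHull ℝ (insert 0 (Set.range fun i => EuclideanSpace.single i (1 : ℝ)))
    have hs : IsCompact s := ((Set.finite_range _).insert _).isCompact_convexHull ℝ
    have hconv : Convex ℝ ((fun z => a 0 +ᵥ z) '' (f '' s)) := by
      have := ((convex_convexHull ℝ _ : Convex ℝ s).linear_image f).vadd (a 0)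
      exact this
    have hsub : body F ⊆ (fun z => a 0 +ᵥ z) '' (f '' s) := by
      refine convexHull_min ?_ hconv
      intro x hx
      obtain ⟨i, hi⟩ := e.symm.surjective ⟨x, hx⟩
      have hxi : a i = x := by simp [a, hi]
      rw [← hxi]
      refine Fin.cases ?_ (fun j => ?_) i
      · exact ⟨0, ⟨0, subset_convexHull ℝ _ (Set.mem_insert _ _), map_zero f⟩, by simp⟩
      · refine ⟨a j.succ - a 0, ⟨EuclideanSpace.single j 1, subset_convexHull ℝ _
          (Set.mem_insert_of_mem _ ⟨j, rfl⟩), ?_⟩, by simp⟩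
        change ∑ i, (EuclideanSpace.single j (1 : ℝ)) i • (a i.succ - a 0) = _
        rw [Finset.sum_eq_single j] <;> simp +contextual
    have hfin : (μHE[n] : Measure (Space (n + 1))) (f '' s) < ⊤ := by
      have h := f.euclideanHausdorffMeasure_image_eq_normDet_mul_volume s
      rw [finrank_euclideanSpace, Fintype.card_fin] at h
      rw [h]
      exact ENNReal.mul_lt_top ENNReal.ofReal_lt_top hs.measure_lt_top
    refine (measure_mono hsub).trans_lt ?_
    have hiso : Isometry fun z : Space (n + 1) => a 0 +ᵥ z := isometry_vadd _ _
    simpa [hiso.euclideanHausdorffMeasure_image] using hfin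

section IntegralLemmas

variable {d : ℕ} {K : Finset (Space d)} {q : Space d → ℝ}

lemma elemInt_add (hq : ContinuousOn q (body K)) (P Q : MvPolynomial (Fin d) ℝ) :
    elemInt K q (P + Q) = elemInt K q P + elemInt K q Q := by
  have h := (isCompact_body K).measure_lt_top (μ := volume)
  simp only [elemInt, map_add, mul_add]
  exact integral_add (integrableOn_body _ K h hq P) (integrableOn_body _ K h hq Q)

lemma elemInt_smul (c : ℝ) (P : MvPolynomial (Fin d) ℝ) :
    elemInt K q (c • P) = c * elemInt K q P := by
  simp only [elemInt, smul_eval, ← integral_const_mul]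
  exact integral_congr_ae (.of_forall fun x => by ring)

lemma facetInt_add (hK : K.card = d) (hq : ContinuousOn q (body K))
    (P Q : MvPolynomial (Fin d) ℝ) :
    facetInt K q (P + Q) = facetInt K q P + facetInt K q Q := by
  have h := facet_measure_lt_top K hK
  simp only [facetInt, map_add, mul_add]
  exact integral_add (integrableOn_body _ K h hq P) (integrableOn_body _ K h hq Q)

lemma facetInt_smul (c : ℝ) (P : MvPolynomial (Fin d) ℝ) :
    facetInt K q (c • P) = c * facetInt K q P := by
  simp only [facetInt, smul_eval, ← integral_const_mul]
  exact integral_congr_ae (.of_forall fun x => by ring)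

end IntegralLemmas

/-! ### The discontinuous Galerkin space -/

/-- The space `V_h` on the patch of `v`: on every element an `ℝ^b`-valued polynomial of
total degree at most `p`. The polynomial on `K` also gives the trace from `K` on the facets. -/
abbrev DG {d : ℕ} (T : Mesh d) (v : Space d) (b p : ℕ) :=
  T.patch v → Fin b → restrictTotalDegree (Fin d) ℝ p

instance {d : ℕ} (T : Mesh d) (v : Space d) : Finite (T.patch v) := by
  have h := (T.locallyFinite.point_finite v).image Subtype.val
  refine (h.subset ?_).to_subtype
  rintro K ⟨⟨hK, -⟩, hv⟩
  exact ⟨⟨K, hK⟩, subset_convexHull ℝ _ hv, rfl⟩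

instance {d : ℕ} (T : Mesh d) (v : Space d) : Fintype (T.patch v) := Fintype.ofFinite _

section Forms

variable {d : ℕ} {T : Mesh d} {v : Space d} {b p : ℕ}

/-- The polynomial vector `w|_K`. -/
def on (w : DG T v b p) (K : T.patch v) : Fin b → MvPolynomial (Fin d) ℝ :=
  fun i => (w K i : MvPolynomial (Fin d) ℝ)

/-- A constant matrix applied to a polynomial vector. -/
def act (B : Matrix (Fin b) (Fin b) ℝ) (w : Fin b → MvPolynomial (Fin d) ℝ) :
    Fin b → MvPolynomial (Fin d) ℝ :=
  fun i => ∑ k, B i k • w k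

/-- The `j`-th partial derivative of a polynomial vector. -/
def partialD (j : Fin d) (w : Fin b → MvPolynomial (Fin d) ℝ) : Fin b → MvPolynomial (Fin d) ℝ :=
  fun i => pderiv j (w i)

/-- The pointwise dot product of polynomial vectors. -/
def dot (w z : Fin b → MvPolynomial (Fin d) ℝ) : MvPolynomial (Fin d) ℝ :=
  ∑ i, w i * z i

lemma on_add (w z : DG T v b p) (K : T.patch v) : on (w + z) K = on w K + on z K := rfl
lemma on_smul (r : ℝ) (w : DG T v b p) (K : T.patch v) : on (r • w) K = r • on w K := rfl

lemma act_add (B : Matrix (Fin b) (Fin b) ℝ) (w z : Fin b → MvPolynomial (Fin d) ℝ) :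
    act B (w + z) = act B w + act B z := by
  ext1 i; simp [act, Finset.sum_add_distrib]

lemma act_smul (B : Matrix (Fin b) (Fin b) ℝ) (r : ℝ) (w : Fin b → MvPolynomial (Fin d) ℝ) :
    act B (r • w) = r • act B w := by
  ext1 i
  simp only [act, Pi.smul_apply, Finset.smul_sum]
  exact Finset.sum_congr rfl fun k _ => smul_comm _ _ _

lemma partialD_add (j : Fin d) (w z : Fin b → MvPolynomial (Fin d) ℝ) :
    partialD j (w + z) = partialD j w + partialD j z := by
  ext1 i; simp [partialD]

lemma partialD_smul (j : Fin d) (r : ℝ) (w : Fin b → MvPolynomial (Fin d) ℝ) :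
    partialD j (r • w) = r • partialD j w := by
  ext1 i; simp [partialD]

lemma dot_add_left (w w' z : Fin b → MvPolynomial (Fin d) ℝ) :
    dot (w + w') z = dot w z + dot w' z := by
  simp [dot, add_mul, Finset.sum_add_distrib]

lemma dot_add_right (w z z' : Fin b → MvPolynomial (Fin d) ℝ) :
    dot w (z + z') = dot w z + dot w z' := by
  simp [dot, mul_add, Finset.sum_add_distrib]

lemma dot_smul_left (r : ℝ) (w z : Fin b → MvPolynomial (Fin d) ℝ) :
    dot (r • w) z = r • dot w z := by
  simp [dot, Finset.smul_sum]

lemma dot_smul_right (r : ℝ) (w z : Fin b → MvPolynomial (Fin d) ℝ) :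
    dot w (r • z) = r • dot w z := by
  simp [dot, Finset.smul_sum]

/-- The form `∑_K ∫_K (B_K w) · z dx` for an elementwise constant matrix field `B`. -/
def massForm (B : Finset (Space d) → Matrix (Fin b) (Fin b) ℝ) :
    LinearMap.BilinForm ℝ (DG T v b p) :=
  LinearMap.mk₂ ℝ (fun w z => ∑ K : T.patch v,
      elemInt (K : Finset (Space d)) 1 (dot (act (B K) (on w K)) (on z K)))
    (fun w w' z => by
      simp only [on_add, act_add, dot_add_left, elemInt_add continuousOn_const,
        Finset.sum_add_distrib, Pi.one_def])
    (fun r w z => by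
      simp only [on_smul, act_smul, dot_smul_left, elemInt_smul, Finset.mul_sum, smul_eq_mul])
    (fun w z z' => by
      simp only [on_add, dot_add_right, elemInt_add continuousOn_const,
        Finset.sum_add_distrib, Pi.one_def])
    (fun r w z => by
      simp only [on_smul, dot_smul_right, elemInt_smul, Finset.mul_sum, smul_eq_mul])

/-- The `L²` inner product `(w, z)` on `V_h`. -/
def ip : LinearMap.BilinForm ℝ (DG T v b p) := massForm fun _ => 1

lemma act_one (w : Fin b → MvPolynomial (Fin d) ℝ) : act 1 w = w := by
  ext1 i; simp [act, Matrix.one_apply]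

lemma ip_apply (w z : DG T v b p) :
    ip w z = ∑ K : T.patch v, elemInt (K : Finset (Space d)) 1 (dot (on w K) (on z K)) := by
  simp [ip, massForm, act_one]

lemma body_interior_nonempty (K : T.patch v) :
    (interior (body (K : Finset (Space d)))).Nonempty := by
  obtain ⟨K, ⟨hK, hc⟩, -⟩ := K
  refine interior_convexHull_nonempty_iff_affineSpan_eq_top.mpr ?_
  have h := (T.indep hK).affineSpan_eq_top_iff_card_eq_finrank_add_one.mpr
    (by simp [hc])
  simpa using h

lemma eq_zero_of_elemInt_dot_self (K : T.patch v) (w : Fin b → MvPolynomial (Fin d) ℝ)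
    (h : elemInt (K : Finset (Space d)) 1 (dot w w) ≤ 0) : w = 0 := by
  have hc : Continuous fun x : Space d => eval x.ofLp (dot w w) := continuous_evalPoly _
  have hev : ∀ x : Space d, eval x.ofLp (dot w w) = ∑ i, eval x.ofLp (w i) ^ 2 := by
    intro x; simp [dot, sq]
  have hnn : ∀ x : Space d, 0 ≤ eval x.ofLp (dot w w) := fun x => by
    rw [hev]; positivity
  have hzero : ∀ x ∈ interior (body (K : Finset (Space d))), eval x.ofLp (dot w w) = 0 := by
    by_contra! hne
    obtain ⟨x, hx, hne⟩ := hne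
    have hopen : IsOpen (interior (body (K : Finset (Space d))) ∩
        {y : Space d | eval y.ofLp (dot w w) ≠ 0}) :=
      isOpen_interior.inter (hc.isOpen_preimage _ isOpen_ne)
    have hpos := hopen.measure_pos volume ⟨x, hx, hne⟩
    have hint := integrableOn_body volume (K : Finset (Space d))
      (isCompact_body _).measure_lt_top (q := 1) continuousOn_const (dot w w)
    have := (setIntegral_pos_iff_support_of_nonneg_ae (.of_forall fun x => by
      simpa using hnn x) hint).mpr (hpos.trans_le (measure_mono fun y hy =>
        ⟨by simpa using hy.2, interior_subset hy.1⟩))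
    exact absurd h (not_le.mpr this)
  ext1 i
  obtain ⟨x₀, hx₀⟩ := body_interior_nonempty K
  have hop : IsOpen ((WithLp.toLp 2 : (Fin d → ℝ) → Space d) ⁻¹'
      interior (body (K : Finset (Space d)))) :=
    isOpen_interior.preimage (PiLp.continuous_toLp 2 _)
  obtain ⟨ε, hε, hball⟩ := Metric.isOpen_iff.mp hop x₀.ofLp (by simpa using hx₀)
  refine MvPolynomial.funext_set (fun j => Metric.ball (x₀ j) ε) (fun j => ?_) fun y hy => ?_
  · rw [Real.ball_eq_Ioo]; exact Set.Ioo_infinite (by linarith)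
  · have hy' : y ∈ Metric.ball x₀.ofLp ε := by
      rw [ball_pi _ hε]; exact hy
    have h0 := hzero (WithLp.toLp 2 y) (hball hy')
    rw [hev, Finset.sum_eq_zero_iff_of_nonneg fun _ _ => sq_nonneg _] at h0
    simpa using h0 i (Finset.mem_univ i)

lemma elemInt_dot_self_nonneg (K : Finset (Space d)) (w : Fin b → MvPolynomial (Fin d) ℝ) :
    0 ≤ elemInt K 1 (dot w w) := by
  refine integral_nonneg fun x => ?_
  simp only [Pi.one_apply, one_mul, dot, map_sum, map_mul, Pi.zero_apply]
  exact Finset.sum_nonneg fun i _ => mul_self_nonneg _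

lemma ip_self_pos {w : DG T v b p} (hw : w ≠ 0) : 0 < ip w w := by
  rw [ip_apply]
  refine lt_of_le_of_ne (Finset.sum_nonneg fun K _ => elemInt_dot_self_nonneg _ _) fun h => hw ?_
  have h0 := (Finset.sum_eq_zero_iff_of_nonneg fun (K : T.patch v) _ =>
    elemInt_dot_self_nonneg (K : Finset (Space d)) (on w K)).mp h.symm
  funext K i
  have := eq_zero_of_elemInt_dot_self K (on w K) (h0 K (Finset.mem_univ K)).le
  exact Subtype.ext (congrFun this i)

lemma ip_nondegenerate : (ip : LinearMap.BilinForm ℝ (DG T v b p)).Nondegenerate :=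
  ⟨fun w h => by_contra fun hw => (ip_self_pos hw).ne' (h w),
    fun w h => by_contra fun hw => (ip_self_pos hw).ne' (h w)⟩

/-- The operator `B : V_h → V_h` with `(B w, z) = β(w, z)` for all `w, z ∈ V_h`. -/
def opOf (β : LinearMap.BilinForm ℝ (DG T v b p)) : Module.End ℝ (DG T v b p) :=
  (ip.toDual ip_nondegenerate).symm.toLinearMap ∘ₗ β

lemma ip_opOf (β : LinearMap.BilinForm ℝ (DG T v b p)) (w z : DG T v b p) :
    ip (opOf β w) z = β w z := by
  simp [opOf]

/-- The unit normal to the common facet of `K` and `K'`, directed from `K` to `K'`: the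
normalized component of `barycenter K' - barycenter K` orthogonal to the facet. -/
def normal (K K' : Finset (Space d)) : Space d :=
  open Classical in
  let u := (vectorSpan ℝ ((K ∩ K' : Finset (Space d)) : Set (Space d)))ᗮ.starProjection
    (barycenter K' - barycenter K)
  ‖u‖⁻¹ • u

/-- The numerical flux `𝒟{w} - S⟦w⟧` on the common facet of `K` and `K'`, with respect to the
normal directed from `K` to `K'`. -/
def numFlux (c : Coefficients d b) (S : Matrix (Fin b) (Fin b) ℝ) (w : DG T v b p)
    (K K' : T.patch v) : Fin b → MvPolynomial (Fin d) ℝ :=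
  act (c.flux K (normal (K : Finset (Space d)) K')) ((1 / 2 : ℝ) • (on w K + on w K'))
    - act S (on w K' - on w K)

lemma numFlux_add (c : Coefficients d b) (S : Matrix (Fin b) (Fin b) ℝ) (w w' : DG T v b p)
    (K K' : T.patch v) :
    numFlux c S (w + w') K K' = numFlux c S w K K' + numFlux c S w' K K' := by
  simp only [numFlux, on_add]
  rw [add_sub_add_comm (on w K'), add_add_add_comm, smul_add, act_add, act_add, add_sub_add_comm]

lemma numFlux_smul (c : Coefficients d b) (S : Matrix (Fin b) (Fin b) ℝ) (r : ℝ)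
    (w : DG T v b p) (K K' : T.patch v) :
    numFlux c S (r • w) K K' = r • numFlux c S w K K' := by
  simp only [numFlux, on_smul, ← smul_add, ← smul_sub, act_smul, smul_comm (1 / 2 : ℝ) r]

/-- The volume term `(δ f(w), grad z)`. -/
def volForm (c : Coefficients d b) (δ : LagrangeP1 T) : LinearMap.BilinForm ℝ (DG T v b p) :=
  have hδ (K : T.patch v) : ContinuousOn δ.toFun (body (K : Finset (Space d))) :=
    δ.continuousOn.mono (Set.subset_biUnion_of_mem (u := body) K.2.1)
  LinearMap.mk₂ ℝ (fun w z => ∑ K : T.patch v, ∑ j,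
      elemInt (K : Finset (Space d)) δ.toFun (dot (act (c.L j K) (on w K)) (partialD j (on z K))))
    (fun w w' z => by
      simp only [on_add, act_add, dot_add_left, elemInt_add (hδ _), Finset.sum_add_distrib])
    (fun r w z => by
      simp only [on_smul, act_smul, dot_smul_left, elemInt_smul, Finset.mul_sum, smul_eq_mul])
    (fun w z z' => by
      simp only [on_add, partialD_add, dot_add_right, elemInt_add (hδ _),
        Finset.sum_add_distrib])
    (fun r w z => by
      simp only [on_smul, partialD_smul, dot_smul_right, elemInt_smul, Finset.mul_sum,
        smul_eq_mul])

open Classical in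
/-- The facet term `(δ (𝒟{w} - S⟦w⟧), ⟦z⟧)` over the interior facets of the patch. Each interior
facet is met twice, as `K ∩ K'` and as `K' ∩ K`, which accounts for the factor `1/2`; the integrand
does not depend on the direction of the normal. On the facets in the boundary of
the patch `δ` vanishes (for an interior vertex), so that they contribute nothing. -/
def facetForm (c : Coefficients d b) (S : Matrix (Fin b) (Fin b) ℝ) (δ : LagrangeP1 T) :
    LinearMap.BilinForm ℝ (DG T v b p) :=
  have hδ (K K' : T.patch v) : ContinuousOn δ.toFun
      (body ((K : Finset (Space d)) ∩ (K' : Finset (Space d)))) :=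
    δ.continuousOn.mono ((convexHull_mono (by simp)).trans
      (Set.subset_biUnion_of_mem (u := body) K.2.1))
  LinearMap.mk₂ ℝ (fun w z => (1 / 2 : ℝ) * ∑ K : T.patch v, ∑ K' : T.patch v,
      if ((K : Finset (Space d)) ∩ (K' : Finset (Space d))).card = d then
        facetInt ((K : Finset (Space d)) ∩ (K' : Finset (Space d))) δ.toFun
          (dot (numFlux c S w K K') (on z K' - on z K))
      else 0)
    (fun w w' z => by
      rw [← mul_add, ← Finset.sum_add_distrib]
      congr 1; refine Finset.sum_congr rfl fun K _ => ?_
      rw [← Finset.sum_add_distrib]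
      refine Finset.sum_congr rfl fun K' _ => ?_
      split_ifs with h
      · rw [numFlux_add, dot_add_left, facetInt_add h (hδ K K')]
      · simp)
    (fun r w z => by
      simp only [numFlux_smul, dot_smul_left, facetInt_smul, Finset.mul_sum, smul_eq_mul,
        mul_ite, mul_zero, mul_left_comm])
    (fun w z z' => by
      rw [← mul_add, ← Finset.sum_add_distrib]
      congr 1; refine Finset.sum_congr rfl fun K _ => ?_
      rw [← Finset.sum_add_distrib]
      refine Finset.sum_congr rfl fun K' _ => ?_
      split_ifs with h
      · rw [on_add, on_add, add_sub_add_comm, dot_add_right, facetInt_add h (hδ K K')]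
      · simp)
    (fun r w z => by
      simp only [on_smul, ← smul_sub, dot_smul_right, facetInt_smul, Finset.mul_sum, smul_eq_mul,
        mul_ite, mul_zero, mul_left_comm])

/-! ### The operators and the structure-aware Taylor step -/

variable (c : Coefficients d b) (S : Matrix (Fin b) (Fin b) ℝ) (t : Tent T v) (p)

/-- `(M₀ w, z) = (g(w) - f(w) grad φ_bot, z)`. -/
def opM0 : Module.End ℝ (DG T v b p) :=
  opOf (massForm fun K => c.G K - c.flux K (t.bot.grad K))

/-- `(M₁ w, z) = (f(w) grad δ, z)`. -/
def opM1 : Module.End ℝ (DG T v b p) :=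
  opOf (massForm fun K => c.flux K (t.delta.grad K))

/-- `(A w, z) = (δ f(w), grad z) + (δ (𝒟{w} - S⟦w⟧), ⟦z⟧)`, the last product being over facets. -/
def opA : Module.End ℝ (DG T v b p) :=
  opOf (volForm c t.delta + facetForm c S t.delta)

/-- `M(τ) = M₀ - τ M₁`. -/
def opM (τ : ℝ) : Module.End ℝ (DG T v b p) :=
  opM0 p c t - τ • opM1 p c t

/-- `X₀ = I` and `X_i = τ M₀⁻¹ (A + i M₁) X_{i-1}`. -/
def opX (τ : ℝ) : ℕ → Module.End ℝ (DG T v b p)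
  | 0 => 1
  | i + 1 => τ • (Ring.inverse (opM0 p c t) *
      (opA p c S t + ((i + 1 : ℕ) : ℝ) • opM1 p c t) * opX τ i)

/-- The SAT step
`R_s = ∑_{i < s} X_i / i! + M(τ)⁻¹ M₀ X_s / s!`. -/
def opR (s : ℕ) (τ : ℝ) : Module.End ℝ (DG T v b p) :=
  ∑ i ∈ Finset.range s, ((i.factorial : ℝ)⁻¹) • opX p c S t τ i
    + Ring.inverse (opM p c t τ) * opM0 p c t * (((s.factorial : ℝ)⁻¹) • opX p c S t τ s)

variable {p}

/-- `B` is selfadjoint and positive definite with respect to the `L²` inner product. -/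
def PositiveDefinite (B : Module.End ℝ (DG T v b p)) : Prop :=
  (∀ w z, ip (B w) z = ip w (B z)) ∧ ∀ w, w ≠ 0 → 0 < ip (B w) w

/-- `‖w‖_B = (B w, w)^{1/2}`. -/
def normOf (B : Module.End ℝ (DG T v b p)) (w : DG T v b p) : ℝ :=
  Real.sqrt (ip (B w) w)

end Forms

end TentSAT

end

/-! Put x_i = X_i w, u(θ) = ∑_{i<s} θ^i/i! x_i and y = M₀ x_s. The recursion for x_i says that u
solves the semidiscrete equation (M₀ - θτM₁)u' = τ(A + M₁)u up to the defect -θ^(s-1)/(s-1)! y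
(`evolution_taylorPoly`). The scheme dissipates: 2(Aw, w) + (M₁w, w) = -2σ(w, w), where σ(w, z) =
(δS⟦w⟧, ⟦z⟧) over the interior facets (`energy_identity`). Pairing the defect with u directly would
lose two powers of τ. Instead 2θ^s/s! (u, y) is added to the energy of u: its derivative cancels the
defect and leaves only a pairing of y with u' = O(τ) (`hasDerivAt_energyFun`). At θ = 1 the added
quantity is the cross term in the square of the M-norm of R_s w = u(1) + M⁻¹y/s!. Hence ‖R_s w‖²_M -
‖w‖²_{M₀} = -2τ∫σ(u, u) + ∫ 2θ^s/s! (u', y) + (M⁻¹y, y)/s!².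

The last two terms are paid for by the dissipation. Let D w = δ div f(w) on each element. Green's
formula with weight δ, together with the continuity of the normal flux that ∑_j ∂_j L^(j) = 0
provides (`flux_nu_eq`), shows that A + M₁ + D sees only jumps (`ip_residual`), with squared norm at
most a constant times σ(w, w). So up to jumps x_{i+1} = τM₀⁻¹(iM₁ - D)x_i. By the product rule iM₁ -
D maps δ^i q to -δ^(i+1) div f(q) on each element, raising the power of δ and lowering the degree of
q (`IsPowMultiple.step`); M₀⁻¹ acts there as a constant matrix. After p + 1 steps nothing is left
but jumps. With J = ∑_{i<s} σ(x_i, x_i) this gives ‖x_{p+1}‖ ≤ Cτ√J, and the remaining s - p - 1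
steps give ‖x_s‖ ≤ Cτ^(s-p)√J (`norm_last_taylorTerm_le`).

The monomials in θ being linearly independent, ∫σ(u, u) ≥ cJ with c depending on s only
(`exists_sum_form_le_integral`). Of the available 2cτJ, one half dominates (M⁻¹y, y)/s!² for small
τ; Young's inequality uses the other half against the term in u', bounded by Cτ·τ^(s-p)‖w‖√J, and
leaves Cτ^(2(s-p)+1)‖w‖². This is `exists_stability_of_smoothTerm_eq_zero`.

Independence of the mesh size comes from |δ(v)|‖g_i‖ being bounded, where g_i is the gradient of a
barycentric coordinate: causality makes δ(v) of the size of the element and shape regularity makes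
‖g_i‖ of the inverse size. The weighted trace and inverse inequalities are therefore scale
invariant, and `exists_dissipativePair` has one constant for all meshes, coefficients and tents.
Positivity holds because M(τ) is the mass operator of the front φ_bot + τδ, whose gradient is a
convex combination of two causal gradients. -/

noncomputable section

namespace TentSAT

/-! ### Finite-dimensional linear algebra -/

section LinearAlgebra

/-- On a finite-dimensional space every linear map is bounded with respect to a positive definite
form. -/
lemma exists_sq_norm_le_of_posDef {V F : Type*} [AddCommGroup V] [Module ℝ V]
    [FiniteDimensional ℝ V] [NormedAddCommGroup F] [NormedSpace ℝ F]
    (B : LinearMap.BilinForm ℝ V) (hsymm : ∀ x y, B x y = B y x)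
    (hpos : ∀ x, x ≠ 0 → 0 < B x x) (f : V →ₗ[ℝ] F) :
    ∃ C : ℝ, 0 < C ∧ ∀ x, ‖f x‖ ^ 2 ≤ C * B x x := by
  let core : InnerProductSpace.Core ℝ V :=
    { inner := fun x y => B x y
      conj_inner_symm := fun x y => by simpa using hsymm y x
      re_inner_nonneg := fun x => by
        by_cases hx : x = 0
        · simp [hx]
        · simpa using (hpos x hx).le
      add_left := fun x y z => by simp
      smul_left := fun x y r => by simp
      definite := fun x hx => by
        by_contra h
        exact (hpos x h).ne' hx }
  let _ : NormedAddCommGroup V := core.toNormedAddCommGroup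
  let _ : InnerProductSpace ℝ V := InnerProductSpace.ofCore core.toCore
  let g : V →L[ℝ] F := LinearMap.toContinuousLinearMap f
  refine ⟨‖g‖ ^ 2 + 1, by positivity, fun x => ?_⟩
  have h1 : ‖f x‖ ≤ ‖g‖ * ‖x‖ := g.le_opNorm x
  have h2 : ‖x‖ ^ 2 = B x x := (real_inner_self_eq_norm_sq x).symm
  calc ‖f x‖ ^ 2 ≤ (‖g‖ * ‖x‖) ^ 2 := by gcongr
    _ = ‖g‖ ^ 2 * B x x := by rw [mul_pow, h2]
    _ ≤ _ := by rw [add_mul, one_mul, ← h2]; nlinarith [sq_nonneg ‖x‖]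

/-- In an orthonormal eigenbasis the quadratic form is a weighted sum of the squared coordinates,
the weights being eigenvalues. -/
lemma abs_inner_map_self_le_of_eigenvalue_le {V : Type*} [NormedAddCommGroup V]
    [InnerProductSpace ℝ V] [FiniteDimensional ℝ V] {T : V →ₗ[ℝ] V} (hT : T.IsSymmetric) {c : ℝ}
    (hc : ∀ w μ, w ≠ 0 → T w = μ • w → |μ| ≤ c) (w : V) :
    |inner ℝ (T w) w| ≤ c * ‖w‖ ^ 2 := by
  have hn : Module.finrank ℝ V = Module.finrank ℝ V := rfl
  let e := hT.eigenvectorBasis hn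
  have hev : ∀ i, |hT.eigenvalues hn i| ≤ c := fun i =>
    hc (e i) _ (e.orthonormal.ne_zero i) (by rw [hT.apply_eigenvectorBasis hn i]; rfl)
  have h1 : inner ℝ (T w) w = ∑ i, hT.eigenvalues hn i * (inner ℝ (e i) w) ^ 2 := by
    rw [← e.sum_inner_mul_inner (T w) w]
    refine Finset.sum_congr rfl fun i _ => ?_
    rw [hT w (e i), hT.apply_eigenvectorBasis hn i]
    simp only [RCLike.ofReal_real_eq_id, id, inner_smul_right]
    rw [real_inner_comm]; ring
  have h2 : ‖w‖ ^ 2 = ∑ i, (inner ℝ (e i) w) ^ 2 := by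
    rw [← e.sum_sq_norm_inner_right w]; simp
  rw [h1, h2, Finset.mul_sum]
  refine (Finset.abs_sum_le_sum_abs _ _).trans (Finset.sum_le_sum fun i _ => ?_)
  rw [abs_mul, abs_of_nonneg (sq_nonneg (inner ℝ (e i) w))]
  exact mul_le_mul_of_nonneg_right (hev i) (sq_nonneg _)

/-- The generalized Rayleigh quotient is bounded by the generalized eigenvalues. -/
lemma abs_form_self_le_of_eigenvalue_le {V : Type*} [AddCommGroup V] [Module ℝ V]
    [FiniteDimensional ℝ V] (B f : LinearMap.BilinForm ℝ V) (hsymm : ∀ x y, B x y = B y x)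
    (hpos : ∀ x, x ≠ 0 → 0 < B x x) (hf : ∀ x y, f x y = f y x) {c : ℝ}
    (hc : ∀ w μ, w ≠ 0 → (∀ z, f w z = μ * B w z) → |μ| ≤ c) (w : V) :
    |f w w| ≤ c * B w w := by
  let core : InnerProductSpace.Core ℝ V :=
    { inner := fun x y => B x y
      conj_inner_symm := fun x y => by simpa using hsymm y x
      re_inner_nonneg := fun x => by
        by_cases hx : x = 0
        · simp [hx]
        · simpa using (hpos x hx).le
      add_left := fun x y z => by simp
      smul_left := fun x y r => by simp
      definite := fun x hx => by
        by_contra h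
        exact (hpos x h).ne' hx }
  let _ : NormedAddCommGroup V := core.toNormedAddCommGroup
  let _ : InnerProductSpace ℝ V := InnerProductSpace.ofCore core.toCore
  have hnd : B.Nondegenerate :=
    ⟨fun w h => by_contra fun hw => (hpos w hw).ne' (h w),
      fun w h => by_contra fun hw => (hpos w hw).ne' (h w)⟩
  -- Taking `B` as inner product turns the pencil into one selfadjoint operator, whose eigenvectors
  -- are the generalized ones.
  let T : V →ₗ[ℝ] V := (B.toDual hnd).symm.toLinearMap ∘ₗ f
  have hT : ∀ x y, inner ℝ (T x) y = f x y := fun x y =>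
    show B (T x) y = f x y by simp [T]
  have hTs : T.IsSymmetric := fun x y => by
    rw [hT, real_inner_comm, hT, hf]
  have h := abs_inner_map_self_le_of_eigenvalue_le hTs (c := c) (fun w μ hw h =>
    hc w μ hw fun z => by
      rw [← hT, h, real_inner_smul_left]; rfl) w
  rw [hT, ← real_inner_self_eq_norm_sq] at h
  exact h

end LinearAlgebra

/-! ### Positivity of integrals of squares of polynomials in time -/

section TimePolynomials

/-- The right side is a positive definite form in the coefficients, since a nonzero polynomial
cannot vanish on all of [0, 1]; in finite dimension it dominates every coordinate. -/
lemma exists_sum_sq_le_integral (n : ℕ) : ∃ c : ℝ, 0 < c ∧ ∀ x : Fin n → ℝ,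
    c * ∑ i, x i ^ 2 ≤ ∫ θ in (0 : ℝ)..1, (∑ i : Fin n, θ ^ (i : ℕ) * x i) ^ 2 := by
  let q : (Fin n → ℝ) → ℝ → ℝ := fun x θ => ∑ i : Fin n, θ ^ (i : ℕ) * x i
  have hcont : ∀ x, Continuous (q x) := fun x => by simp only [q]; fun_prop
  have hadd : ∀ x y θ, q (x + y) θ = q x θ + q y θ := fun x y θ => by
    simp only [q, Pi.add_apply, mul_add, Finset.sum_add_distrib]
  have hsmul : ∀ (r : ℝ) x θ, q (r • x) θ = r * q x θ := fun r x θ => by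
    simp only [q, Pi.smul_apply, smul_eq_mul, Finset.mul_sum]
    exact Finset.sum_congr rfl fun i _ => by ring
  have hint : ∀ x y, IntervalIntegrable (fun θ => q x θ * q y θ) volume 0 1 := fun x y =>
    ((hcont x).mul (hcont y)).intervalIntegrable _ _
  let B : LinearMap.BilinForm ℝ (Fin n → ℝ) := LinearMap.mk₂ ℝ
    (fun x y => ∫ θ in (0 : ℝ)..1, q x θ * q y θ)
    (fun x x' y => by
      rw [← intervalIntegral.integral_add (hint x y) (hint x' y)]
      simp only [hadd, add_mul])
    (fun r x y => by
      rw [smul_eq_mul, ← intervalIntegral.integral_const_mul]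
      simp only [hsmul, mul_assoc])
    (fun x y y' => by
      rw [← intervalIntegral.integral_add (hint x y) (hint x y')]
      simp only [hadd, mul_add])
    (fun r x y => by
      rw [smul_eq_mul, ← intervalIntegral.integral_const_mul]
      simp only [hsmul, mul_left_comm])
  have hB : ∀ x, B x x = ∫ θ in (0 : ℝ)..1, (q x θ) ^ 2 := fun x => by
    simp only [B, LinearMap.mk₂_apply, sq]
  have hpos : ∀ x, x ≠ 0 → 0 < B x x := fun x hx => by
    rw [hB]
    let P : Polynomial ℝ := ∑ i : Fin n, Polynomial.monomial (i : ℕ) (x i)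
    have hP : ∀ θ, P.eval θ = q x θ := fun θ => by
      simp [P, q, Polynomial.eval_finsetSum, Polynomial.eval_monomial, mul_comm]
    have hP0 : P ≠ 0 := by
      obtain ⟨i, hi⟩ := Function.ne_iff.mp hx
      intro h
      apply hi
      have := congrArg (fun Q => Polynomial.coeff Q i) h
      simpa [P, Polynomial.finsetSum_coeff, Polynomial.coeff_monomial, Fin.val_inj] using this
    obtain ⟨θ, hθ, hne⟩ : ∃ θ ∈ Set.Icc (0 : ℝ) 1, P.eval θ ≠ 0 := by
      by_contra! h
      exact hP0 (Polynomial.eq_zero_of_infinite_isRoot P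
        ((Set.Icc_infinite (zero_lt_one' ℝ)).mono fun θ hθ => h θ hθ))
    refine intervalIntegral.integral_pos zero_lt_one ((hcont x).pow 2).continuousOn
      (fun _ _ => sq_nonneg _) ⟨θ, hθ, ?_⟩
    rw [← hP]; positivity
  choose C hC hle using fun i : Fin n => exists_sq_norm_le_of_posDef B
    (fun x y => by simp only [B, LinearMap.mk₂_apply, mul_comm]) hpos (LinearMap.proj i)
  have hS : 0 < 1 + ∑ i, C i := by
    have := Finset.sum_nonneg fun i (_ : i ∈ Finset.univ) => (hC i).le
    linarith
  -- The summand 1 keeps the constant positive when n = 0.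
  refine ⟨(1 + ∑ i, C i)⁻¹, inv_pos.mpr hS, fun x => ?_⟩
  rw [inv_mul_le_iff₀ hS]
  change _ ≤ _ * ∫ θ in (0 : ℝ)..1, (q x θ) ^ 2
  rw [← hB]
  have hnn : 0 ≤ B x x := by
    by_cases hx : x = 0
    · simp [hx]
    · exact (hpos x hx).le
  calc ∑ i, x i ^ 2 ≤ ∑ i, C i * B x x :=
        Finset.sum_le_sum fun i _ => by simpa using hle i x
    _ ≤ _ := by rw [← Finset.sum_mul]; nlinarith

open scoped MatrixOrder in
/-- The Gram matrix of a positive semidefinite symmetric form. -/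
lemma exists_gram_factorization {V : Type*} [AddCommGroup V] [Module ℝ V]
    (σ : LinearMap.BilinForm ℝ V) (hsymm : ∀ x y, σ x y = σ y x) (hpos : ∀ x, 0 ≤ σ x x)
    {n : ℕ} (x : Fin n → V) :
    ∃ B : Matrix (Fin n) (Fin n) ℝ, ∀ a : Fin n → ℝ,
      σ (∑ i, a i • x i) (∑ i, a i • x i) = ∑ k, (∑ i, a i * B k i) ^ 2 := by
  have hexp : ∀ a : Fin n → ℝ, σ (∑ i, a i • x i) (∑ i, a i • x i)
      = ∑ i, a i * ∑ j, σ (x i) (x j) * a j := fun a => by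
    simp only [map_sum, map_smul, LinearMap.sum_apply, LinearMap.smul_apply, smul_eq_mul,
      Finset.mul_sum]
    rw [Finset.sum_comm]
    exact Finset.sum_congr rfl fun i _ => Finset.sum_congr rfl fun j _ => by ring
  have hG : (Matrix.of fun i j => σ (x i) (x j) : Matrix (Fin n) (Fin n) ℝ).PosSemidef := by
    refine Matrix.PosSemidef.of_dotProduct_mulVec_nonneg ?_ fun a => ?_
    · ext i j; simpa using hsymm _ _
    · have := hpos (∑ i, a i • x i)
      rw [hexp] at this
      simpa [dotProduct, Matrix.mulVec] using this
  obtain ⟨B, hB⟩ := CStarAlgebra.nonneg_iff_eq_star_mul_self.mp hG.nonneg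
  refine ⟨B, fun a => ?_⟩
  have hij : ∀ i j, σ (x i) (x j) = ∑ k, B k i * B k j := fun i j => by
    simpa [Matrix.mul_apply, Matrix.star_eq_conjTranspose] using congrFun (congrFun hB i) j
  rw [hexp]
  simp only [hij, sq, Finset.sum_mul, Finset.mul_sum]
  rw [Finset.sum_comm]
  conv_rhs => rw [Finset.sum_comm]; enter [2, i]; rw [Finset.sum_comm]
  rw [Finset.sum_comm]
  exact Finset.sum_congr rfl fun i _ => Finset.sum_congr rfl fun j _ =>
    Finset.sum_congr rfl fun k _ => by ring

/-- The Gram matrix of the x_i factors as BᵀB, so σ of a combination is a sum of squares of scalar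
combinations and the scalar inequality applies row by row. The constant is thus independent of the
space and of σ, hence later of the mesh. -/
lemma exists_sum_form_le_integral (n : ℕ) : ∃ c : ℝ, 0 < c ∧
    ∀ {V : Type} [AddCommGroup V] [Module ℝ V]
    (σ : LinearMap.BilinForm ℝ V), (∀ x y, σ x y = σ y x) → (∀ x, 0 ≤ σ x x) →
    ∀ x : ℕ → V, c * ∑ i ∈ Finset.range n, σ (x i) (x i) ≤
      ∫ θ in (0 : ℝ)..1, σ (∑ i ∈ Finset.range n, θ ^ i • x i)
        (∑ i ∈ Finset.range n, θ ^ i • x i) := by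
  obtain ⟨c, hc, h⟩ := exists_sum_sq_le_integral n
  refine ⟨c, hc, fun σ hsymm hpos x => ?_⟩
  obtain ⟨B, hB⟩ := exists_gram_factorization σ hsymm hpos fun i : Fin n => x i
  have h1 : ∀ θ : ℝ, σ (∑ i ∈ Finset.range n, θ ^ i • x i)
      (∑ i ∈ Finset.range n, θ ^ i • x i) = ∑ k, (∑ i : Fin n, θ ^ (i : ℕ) * B k i) ^ 2 := by
    intro θ
    rw [Finset.sum_range, hB fun i => θ ^ (i : ℕ)]
  have h2 : ∀ i : Fin n, σ (x i) (x i) = ∑ k, B k i ^ 2 := fun i => by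
    have := hB (Pi.single i 1)
    simpa [Pi.single_apply] using this
  simp only [h1]
  rw [intervalIntegral.integral_finsetSum fun k _ => Continuous.intervalIntegrable (by fun_prop) _ _,
    Finset.sum_range]
  simp only [h2]
  rw [Finset.sum_comm, Finset.mul_sum]
  exact Finset.sum_le_sum fun k _ => h (B k)

end TimePolynomials

/-! ### An abstract stability estimate for the structure-aware Taylor step -/

section Recursion

variable {V : Type*} [AddCommGroup V] [Module ℝ V]

/-- The Taylor terms `x₀ = w`, `x_i = τ N₀ (A + i M₁) x_{i-1}`, with `N₀` the inverse of `M₀`. -/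
def taylorTerm (N0 A M1 : Module.End ℝ V) (τ : ℝ) : ℕ → Module.End ℝ V
  | 0 => 1
  | i + 1 => τ • (N0 * (A + ((i + 1 : ℕ) : ℝ) • M1) * taylorTerm N0 A M1 τ i)

/-- The terms of the recursion without the jump contributions. -/
def smoothTerm (N0 D M1 : Module.End ℝ V) : ℕ → Module.End ℝ V
  | 0 => 1
  | i + 1 => N0 * ((i : ℝ) • M1 - D) * smoothTerm N0 D M1 i

end Recursion

section Abstract

variable {V : Type*} [NormedAddCommGroup V] [InnerProductSpace ℝ V]

/-- A discretization whose energy dissipation is the form `σ`. The operator `D` is the part of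
`-(A + M₁)` which does not see the jumps. -/
structure DissipativePair (M0 N0 M1 A D : Module.End ℝ V) (σ : LinearMap.BilinForm ℝ V)
    (m a : ℝ) : Prop where
  pos_m : 0 < m
  one_le_a : 1 ≤ a
  mul_left : N0 * M0 = 1
  mul_right : M0 * N0 = 1
  coercive : ∀ w, m * ‖w‖ ^ 2 ≤ inner ℝ (M0 w) w
  symm_M0 : ∀ w z, inner ℝ (M0 w) z = inner ℝ w (M0 z)
  symm_M1 : ∀ w z, inner ℝ (M1 w) z = inner ℝ w (M1 z)
  bound_M0 : ∀ w, ‖M0 w‖ ≤ a * ‖w‖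
  bound_M1 : ∀ w, ‖M1 w‖ ≤ a * ‖w‖
  bound_D : ∀ w, ‖D w‖ ≤ a * ‖w‖
  symm_σ : ∀ w z, σ w z = σ z w
  nonneg_σ : ∀ w, 0 ≤ σ w w
  bound_σ : ∀ w, σ w w ≤ a ^ 2 * ‖w‖ ^ 2
  bound_res : ∀ w, ‖A w + M1 w + D w‖ ^ 2 ≤ a ^ 2 * σ w w
  energy : ∀ w, 2 * inner ℝ (A w) w + inner ℝ (M1 w) w = -2 * σ w w

namespace DissipativePair

variable {M0 N0 M1 A D : Module.End ℝ V} {σ : LinearMap.BilinForm ℝ V} {m a τ : ℝ}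

lemma inverse_bound (h : DissipativePair M0 N0 M1 A D σ m a) (w : V) :
    ‖N0 w‖ ≤ m⁻¹ * ‖w‖ := by
  have h1 := h.coercive (N0 w)
  have h2 : M0 (N0 w) = w := by
    rw [← Module.End.mul_apply, h.mul_right]; rfl
  rw [h2] at h1
  have h3 := real_inner_le_norm w (N0 w)
  rw [inv_mul_eq_div, le_div_iff₀ h.pos_m]
  by_cases h0 : ‖N0 w‖ = 0
  · rw [h0]; simp
  · have h4 : 0 < ‖N0 w‖ := lt_of_le_of_ne (norm_nonneg _) (Ne.symm h0)
    exact le_of_mul_le_mul_right (by nlinarith) h4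

lemma residual_bound (h : DissipativePair M0 N0 M1 A D σ m a) (w : V) :
    ‖A w + M1 w + D w‖ ≤ a * Real.sqrt (σ w w) := by
  have ha : 0 ≤ a := zero_le_one.trans h.one_le_a
  refine abs_le_of_sq_le_sq' ?_ (by positivity) |>.2
  rw [mul_pow, Real.sq_sqrt (h.nonneg_σ w)]
  exact h.bound_res w

/-- A is the residual minus M₁ minus D, and each of the three is bounded by a²‖w‖ because a ≥ 1. -/
lemma bound_A (h : DissipativePair M0 N0 M1 A D σ m a) (w : V) :
    ‖A w‖ ≤ 3 * a ^ 2 * ‖w‖ := by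
  have ha : 1 ≤ a := h.one_le_a
  have h1 := h.residual_bound w
  have h2 : Real.sqrt (σ w w) ≤ a * ‖w‖ :=
    Real.sqrt_le_iff.mpr ⟨by positivity, by rw [mul_pow]; exact h.bound_σ w⟩
  have h3 : A w = (A w + M1 w + D w) - M1 w - D w := by abel
  have h4 := norm_sub_le ((A w + M1 w + D w) - M1 w) (D w)
  have h5 := norm_sub_le (A w + M1 w + D w) (M1 w)
  rw [← h3] at h4
  have h6 := h.bound_M1 w
  have h7 := h.bound_D w
  have h8 : a * Real.sqrt (σ w w) ≤ a * (a * ‖w‖) := by gcongr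
  have h9 : a * ‖w‖ ≤ a * (a * ‖w‖) := le_mul_of_one_le_left (by positivity) ha
  nlinarith

lemma taylorTerm_succ_apply (w : V) (i : ℕ) :
    taylorTerm N0 A M1 τ (i + 1) w
      = τ • N0 (A (taylorTerm N0 A M1 τ i w) + ((i : ℝ) + 1) • M1 (taylorTerm N0 A M1 τ i w)) := by
  simp [taylorTerm]

lemma M0_taylorTerm_succ (h : DissipativePair M0 N0 M1 A D σ m a) (w : V) (i : ℕ) :
    M0 (taylorTerm N0 A M1 τ (i + 1) w)
      = τ • (A (taylorTerm N0 A M1 τ i w) + ((i : ℝ) + 1) • M1 (taylorTerm N0 A M1 τ i w)) := by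
  rw [taylorTerm_succ_apply, map_smul, ← Module.End.mul_apply, h.mul_right]; rfl

/-- The growth constant of the Taylor terms. -/
def growth (m a : ℝ) (s : ℕ) : ℝ := m⁻¹ * (3 * a ^ 2 + (s + 1) * a)

lemma growth_nonneg (hm : 0 < m) (ha : 1 ≤ a) (s : ℕ) : 0 ≤ growth m a s := by
  unfold growth; positivity

lemma norm_taylorTerm_succ_le (h : DissipativePair M0 N0 M1 A D σ m a) (hτ : 0 ≤ τ) (w : V)
    {i s : ℕ} (hi : i ≤ s) :
    ‖taylorTerm N0 A M1 τ (i + 1) w‖ ≤ τ * growth m a s * ‖taylorTerm N0 A M1 τ i w‖ := by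
  have ha : 1 ≤ a := h.one_le_a
  have hm := h.pos_m
  rw [taylorTerm_succ_apply, norm_smul, Real.norm_of_nonneg hτ, mul_assoc]
  gcongr
  refine (h.inverse_bound _).trans ?_
  set x := taylorTerm N0 A M1 τ i w
  rw [growth, mul_assoc]
  gcongr
  refine (norm_add_le _ _).trans ?_
  rw [add_mul, norm_smul, Real.norm_of_nonneg (by positivity), mul_assoc]
  have hi' : (i : ℝ) ≤ s := by exact_mod_cast hi
  have h1 : ((i : ℝ) + 1) * ‖M1 x‖ ≤ (s + 1) * (a * ‖x‖) :=
    mul_le_mul (by linarith) (h.bound_M1 x) (norm_nonneg _) (by positivity)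
  linarith [h.bound_A x]

lemma norm_taylorTerm_le (h : DissipativePair M0 N0 M1 A D σ m a) (hτ : 0 ≤ τ) (w : V)
    {i s : ℕ} (hi : i ≤ s + 1) :
    ‖taylorTerm N0 A M1 τ i w‖ ≤ (τ * growth m a s) ^ i * ‖w‖ := by
  have hg := growth_nonneg h.pos_m h.one_le_a s
  induction i with
  | zero => simp [taylorTerm]
  | succ i ih =>
    refine (h.norm_taylorTerm_succ_le hτ w (by omega : i ≤ s)).trans ?_
    rw [pow_succ', mul_assoc (τ * growth m a s)]
    gcongr
    exact ih (by omega)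

lemma norm_taylorTerm_add_le (h : DissipativePair M0 N0 M1 A D σ m a) (hτ : 0 ≤ τ) (w : V)
    {i j s : ℕ} (hi : i + j ≤ s + 1) :
    ‖taylorTerm N0 A M1 τ (i + j) w‖
      ≤ (τ * growth m a s) ^ j * ‖taylorTerm N0 A M1 τ i w‖ := by
  have hg := growth_nonneg h.pos_m h.one_le_a s
  induction j with
  | zero => simp
  | succ j ih =>
    refine (h.norm_taylorTerm_succ_le hτ w (by omega : i + j ≤ s)).trans ?_
    rw [pow_succ', mul_assoc (τ * growth m a s)]
    gcongr
    exact ih (by omega)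

/-- The constant in the bound of the nonsmooth part of the `i`-th Taylor term. -/
def jumpConst (m a : ℝ) : ℕ → ℝ
  | 0 => 0
  | i + 1 => m⁻¹ * ((i + 1) * a * jumpConst m a i + a)

lemma jumpConst_nonneg (hm : 0 < m) (ha : 1 ≤ a) (i : ℕ) : 0 ≤ jumpConst m a i := by
  induction i with
  | zero => simp [jumpConst]
  | succ i ih => unfold jumpConst; positivity

/-- The Taylor terms differ from the smooth terms only by jump contributions. -/
lemma norm_taylorTerm_sub_smoothTerm_le (h : DissipativePair M0 N0 M1 A D σ m a) (hτ : 0 ≤ τ)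
    (hτ1 : τ ≤ 1) (w : V) {s : ℕ} {J : ℝ}
    (hJ : ∀ i < s, σ (taylorTerm N0 A M1 τ i w) (taylorTerm N0 A M1 τ i w) ≤ J) {i : ℕ}
    (hi : i ≤ s) :
    ‖taylorTerm N0 A M1 τ i w - τ ^ i • smoothTerm N0 D M1 i w‖
      ≤ jumpConst m a i * τ * Real.sqrt J := by
  have ha : 1 ≤ a := h.one_le_a
  have hm := h.pos_m
  induction i with
  | zero => simp [taylorTerm, smoothTerm, jumpConst]
  | succ i ih =>
    have ih := ih (by omega)
    have hc := jumpConst_nonneg hm ha i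
    set x := taylorTerm N0 A M1 τ i w with hx
    set y := τ ^ i • smoothTerm N0 D M1 i w with hy
    -- From A + (i + 1)M₁ = (iM₁ - D) + (A + M₁ + D): the first summand propagates the smooth term,
    -- the second is a residual controlled by jumps.
    have hsplit : taylorTerm N0 A M1 τ (i + 1) w - τ ^ (i + 1) • smoothTerm N0 D M1 (i + 1) w
        = τ • N0 ((i : ℝ) • M1 (x - y) - D (x - y) + (A x + M1 x + D x)) := by
      have h1 : τ ^ (i + 1) • smoothTerm N0 D M1 (i + 1) w
          = τ • N0 ((i : ℝ) • M1 y - D y) := by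
        simp [smoothTerm, hy, pow_succ', smul_smul, smul_sub, mul_comm, mul_assoc]
      rw [taylorTerm_succ_apply, ← hx, h1, ← smul_sub, ← map_sub]
      congr 2
      simp only [map_sub, smul_sub, add_smul, one_smul]
      abel
    rw [hsplit, norm_smul, Real.norm_of_nonneg hτ]
    have hs : Real.sqrt (σ x x) ≤ Real.sqrt J := Real.sqrt_le_sqrt (hJ i (by omega))
    have hb : ‖(i : ℝ) • M1 (x - y) - D (x - y) + (A x + M1 x + D x)‖
        ≤ (i + 1) * a * jumpConst m a i * Real.sqrt J + a * Real.sqrt J := by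
      refine (norm_add_le _ _).trans (add_le_add ?_ ?_)
      · refine (norm_sub_le _ _).trans ?_
        rw [norm_smul, Real.norm_of_nonneg (by positivity)]
        have h1 := h.bound_M1 (x - y)
        have h2 := h.bound_D (x - y)
        -- The factor τ of the previous error is discarded; each step supplies a new one, and a
        -- single τ suffices.
        have h3 : ‖x - y‖ ≤ jumpConst m a i * Real.sqrt J := ih.trans (by
          gcongr; exact mul_le_of_le_one_right hc hτ1)
        calc (i : ℝ) * ‖M1 (x - y)‖ + ‖D (x - y)‖
            ≤ i * (a * ‖x - y‖) + a * ‖x - y‖ := by gcongr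
          _ = (i + 1) * a * ‖x - y‖ := by ring
          _ ≤ (i + 1) * a * (jumpConst m a i * Real.sqrt J) := by gcongr
          _ = _ := by ring
      · exact (h.residual_bound x).trans (by gcongr)
    calc τ * ‖N0 ((i : ℝ) • M1 (x - y) - D (x - y) + (A x + M1 x + D x))‖
        ≤ τ * (m⁻¹ * ((i + 1) * a * jumpConst m a i * Real.sqrt J + a * Real.sqrt J)) := by
          gcongr
          exact (h.inverse_bound _).trans (by gcongr)
      _ = _ := by simp only [jumpConst]; ring

/-- The smooth part is gone at index p + 1, so x_{p+1} consists of jump contributions with one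
factor τ; each of the s - p - 1 further steps gains another τ. -/
lemma norm_last_taylorTerm_le (h : DissipativePair M0 N0 M1 A D σ m a) {p : ℕ}
    (hnil : smoothTerm N0 D M1 (p + 1) = 0) (hτ : 0 ≤ τ)
    (hτ1 : τ ≤ 1) (w : V) {s : ℕ} (hps : p + 1 ≤ s) {J : ℝ}
    (hJ : ∀ i < s, σ (taylorTerm N0 A M1 τ i w) (taylorTerm N0 A M1 τ i w) ≤ J) :
    ‖taylorTerm N0 A M1 τ s w‖
      ≤ growth m a s ^ (s - p - 1) * jumpConst m a (p + 1) * τ ^ (s - p) * Real.sqrt J := by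
  have hg := growth_nonneg h.pos_m h.one_le_a s
  have h1 := h.norm_taylorTerm_sub_smoothTerm_le hτ hτ1 w hJ hps
  rw [hnil] at h1
  have h2 := h.norm_taylorTerm_add_le (i := p + 1) (j := s - p - 1) (s := s) hτ w (by omega)
  rw [show p + 1 + (s - p - 1) = s by omega] at h2
  simp only [LinearMap.zero_apply, smul_zero, sub_zero] at h1
  refine h2.trans ((mul_le_mul_of_nonneg_left h1 (by positivity)).trans (le_of_eq ?_))
  rw [show s - p = (s - p - 1) + 1 by omega, mul_pow, pow_succ, Nat.add_sub_cancel]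
  ring

end DissipativePair

end Abstract

/-! ### Energy balance of the Taylor polynomial -/

section AbstractEnergy

variable {V : Type} [NormedAddCommGroup V] [InnerProductSpace ℝ V]

/-- The Taylor polynomial `∑_{i < n} θ^i / i! x_i`. -/
def taylorPoly (x : ℕ → V) (n : ℕ) (θ : ℝ) : V :=
  ∑ i ∈ Finset.range n, (θ ^ i / (i.factorial : ℝ)) • x i

lemma map_taylorPoly (B : Module.End ℝ V) (x : ℕ → V) (n : ℕ) (θ : ℝ) :
    B (taylorPoly x n θ) = taylorPoly (fun i => B (x i)) n θ := by
  simp [taylorPoly]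

lemma hasDerivAt_taylorPoly (x : ℕ → V) (n : ℕ) (θ : ℝ) :
    HasDerivAt (taylorPoly x (n + 1)) (taylorPoly (fun i => x (i + 1)) n θ) θ := by
  induction n with
  | zero =>
    have : taylorPoly x (0 + 1) = fun _ => x 0 := by ext; simp [taylorPoly]
    rw [this]
    simpa [taylorPoly] using hasDerivAt_const θ (x 0)
  | succ n ih =>
    have h1 : taylorPoly x (n + 1 + 1) = fun θ => taylorPoly x (n + 1) θ
        + (θ ^ (n + 1) / ((n + 1).factorial : ℝ)) • x (n + 1) := by
      ext θ; rw [taylorPoly, Finset.sum_range_succ]; rfl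
    have h2 : taylorPoly (fun i => x (i + 1)) (n + 1) θ = taylorPoly (fun i => x (i + 1)) n θ
        + (θ ^ n / (n.factorial : ℝ)) • x (n + 1) := by
      rw [taylorPoly, Finset.sum_range_succ]; rfl
    have h3 : HasDerivAt (fun θ : ℝ => θ ^ (n + 1) / ((n + 1).factorial : ℝ))
        (θ ^ n / (n.factorial : ℝ)) θ := by
      have := (hasDerivAt_pow (n + 1) θ).div_const ((n + 1).factorial : ℝ)
      convert! this using 1
      rw [Nat.factorial_succ]
      have : (n.factorial : ℝ) ≠ 0 := by positivity
      push_cast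
      field_simp
    rw [h1, h2]
    exact ih.add (h3.smul_const (x (n + 1)))

lemma continuous_taylorPoly (x : ℕ → V) (n : ℕ) : Continuous (taylorPoly x n) := by
  unfold taylorPoly; fun_prop

lemma taylorPoly_zero_right (x : ℕ → V) (n : ℕ) : taylorPoly x (n + 1) 0 = x 0 := by
  rw [taylorPoly, Finset.sum_range_succ']
  simp

lemma norm_taylorPoly_le (x : ℕ → V) (n : ℕ) {θ : ℝ} (h0 : 0 ≤ θ) (h1 : θ ≤ 1) :
    ‖taylorPoly x n θ‖ ≤ ∑ i ∈ Finset.range n, ‖x i‖ := by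
  refine (norm_sum_le _ _).trans (Finset.sum_le_sum fun i _ => ?_)
  rw [norm_smul, Real.norm_of_nonneg (by positivity)]
  refine mul_le_of_le_one_left (norm_nonneg _) ?_
  rw [div_le_one (by positivity)]
  exact (pow_le_one₀ h0 h1).trans (by exact_mod_cast i.factorial_pos)

namespace DissipativePair

variable {M0 N0 M1 A D : Module.End ℝ V} {σ : LinearMap.BilinForm ℝ V} {m a τ : ℝ}

/-- The evolution equation satisfied by the Taylor polynomial, up to its last term. -/
lemma evolution_taylorPoly (h : DissipativePair M0 N0 M1 A D σ m a) (w : V) (n : ℕ) (θ : ℝ) :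
    M0 (taylorPoly (fun i => taylorTerm N0 A M1 τ (i + 1) w) n θ)
        - (θ * τ) • M1 (taylorPoly (fun i => taylorTerm N0 A M1 τ (i + 1) w) n θ)
      = τ • (A (taylorPoly (fun i => taylorTerm N0 A M1 τ i w) (n + 1) θ)
          + M1 (taylorPoly (fun i => taylorTerm N0 A M1 τ i w) (n + 1) θ))
        - (θ ^ n / (n.factorial : ℝ)) • M0 (taylorTerm N0 A M1 τ (n + 1) w) := by
  induction n with
  | zero => simp [taylorPoly, h.M0_taylorTerm_succ]
  | succ n ih =>
    set x : ℕ → V := fun i => taylorTerm N0 A M1 τ i w with hx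
    have h1 : taylorPoly (fun i => x (i + 1)) (n + 1) θ = taylorPoly (fun i => x (i + 1)) n θ
        + (θ ^ n / (n.factorial : ℝ)) • x (n + 1) := by
      rw [taylorPoly, Finset.sum_range_succ]; rfl
    have h2 : taylorPoly x (n + 1 + 1) θ = taylorPoly x (n + 1) θ
        + (θ ^ (n + 1) / ((n + 1).factorial : ℝ)) • x (n + 1) := by
      rw [taylorPoly, Finset.sum_range_succ]; rfl
    have h3 := h.M0_taylorTerm_succ (τ := τ) w (n + 1)
    change M0 (x (n + 1 + 1)) = τ • (A (x (n + 1)) + (((n + 1 : ℕ) : ℝ) + 1) • M1 (x (n + 1))) at h3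
    change _ - _ = _ - (θ ^ n / (n.factorial : ℝ)) • M0 (x (n + 1)) at ih
    change M0 (taylorPoly (fun i => x (i + 1)) (n + 1) θ)
      - (θ * τ) • M1 (taylorPoly (fun i => x (i + 1)) (n + 1) θ)
      = τ • (A (taylorPoly x (n + 1 + 1) θ) + M1 (taylorPoly x (n + 1 + 1) θ))
        - (θ ^ (n + 1) / ((n + 1).factorial : ℝ)) • M0 (x (n + 1 + 1))
    rw [h1, h2, h3]
    simp only [map_add, map_smul]
    rw [smul_add (θ * τ), add_sub_add_comm, ih]
    -- This is why the recursion weighs M₁ with the running index: the new term of θτM₁u' supplies n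
    -- + 1 of the n + 2 copies of τM₁x_{n+1}, and the right side supplies the remaining one.
    have h4 : θ ^ n / (n.factorial : ℝ) * θ
        = θ ^ (n + 1) / ((n + 1).factorial : ℝ) * ((n + 1 : ℕ) : ℝ) := by
      rw [Nat.factorial_succ]
      have : (n.factorial : ℝ) ≠ 0 := by positivity
      push_cast
      field_simp
      ring
    have h5 : (θ * τ) • (θ ^ n / (n.factorial : ℝ)) • M1 (x (n + 1))
        = (τ * (θ ^ (n + 1) / ((n + 1).factorial : ℝ) * ((n + 1 : ℕ) : ℝ))) • M1 (x (n + 1)) := by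
      rw [← h4, smul_smul]; congr 1; ring
    rw [h5]
    module

/-- The energy of the Taylor polynomial, with the mixed term of the last Taylor term. -/
def energyFun (M0 M1 : Module.End ℝ V) (τ : ℝ) (x : ℕ → V) (n : ℕ) (θ : ℝ) : ℝ :=
  inner ℝ (M0 (taylorPoly x (n + 1) θ) - (θ * τ) • M1 (taylorPoly x (n + 1) θ))
      (taylorPoly x (n + 1) θ)
    + 2 * (θ ^ (n + 1) / ((n + 1).factorial : ℝ))
      * inner ℝ (taylorPoly x (n + 1) θ) (M0 (x (n + 1)))

lemma hasDerivAt_energyFun (h : DissipativePair M0 N0 M1 A D σ m a) (w : V) (n : ℕ) (θ : ℝ) :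
    HasDerivAt (energyFun M0 M1 τ (fun i => taylorTerm N0 A M1 τ i w) n)
      (-2 * τ * σ (taylorPoly (fun i => taylorTerm N0 A M1 τ i w) (n + 1) θ)
          (taylorPoly (fun i => taylorTerm N0 A M1 τ i w) (n + 1) θ)
        + 2 * (θ ^ (n + 1) / ((n + 1).factorial : ℝ))
          * inner ℝ (taylorPoly (fun i => taylorTerm N0 A M1 τ (i + 1) w) n θ)
            (M0 (taylorTerm N0 A M1 τ (n + 1) w))) θ := by
  have hev := h.evolution_taylorPoly (τ := τ) w n θ
  set x : ℕ → V := fun i => taylorTerm N0 A M1 τ i w with hx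
  set u := taylorPoly x (n + 1) θ with hu
  set u' := taylorPoly (fun i => x (i + 1)) n θ with hu'
  have d0 : HasDerivAt (taylorPoly x (n + 1)) u' θ := hasDerivAt_taylorPoly x n θ
  have dB : ∀ B : Module.End ℝ V,
      HasDerivAt (fun θ => B (taylorPoly x (n + 1) θ)) (B u') θ := fun B => by
    simp only [map_taylorPoly, hu']
    exact hasDerivAt_taylorPoly (fun i => B (x i)) n θ
  have dθ : HasDerivAt (fun θ : ℝ => θ * τ) τ θ := by
    simpa using (hasDerivAt_id θ).mul_const τ
  have dp : HasDerivAt (fun θ : ℝ => 2 * (θ ^ (n + 1) / ((n + 1).factorial : ℝ)))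
      (2 * (θ ^ n / (n.factorial : ℝ))) θ := by
    have := ((hasDerivAt_pow (n + 1) θ).div_const ((n + 1).factorial : ℝ)).const_mul 2
    convert! this using 1
    rw [Nat.factorial_succ]
    have : (n.factorial : ℝ) ≠ 0 := by positivity
    push_cast
    field_simp
  have d1 := ((dB M0).sub (dθ.smul (dB M1))).inner ℝ d0
  have d2 := dp.mul (d0.inner ℝ (hasDerivAt_const θ (M0 (x (n + 1)))))
  refine (d1.add d2).congr_deriv ?_
  have e1 : inner ℝ (M0 u - (θ * τ) • M1 u) u' = inner ℝ (M0 u' - (θ * τ) • M1 u') u := by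
    rw [inner_sub_left, inner_smul_left, h.symm_M0, h.symm_M1, real_inner_comm,
      real_inner_comm (M1 u'), inner_sub_left, inner_smul_left]
  have e2 : M0 u' - ((θ * τ) • M1 u' + τ • M1 u)
      = (M0 u' - (θ * τ) • M1 u') - τ • M1 u := by abel
  change inner ℝ (M0 u - (θ * τ) • M1 u) u' + inner ℝ (M0 u' - ((θ * τ) • M1 u' + τ • M1 u)) u
    + (2 * (θ ^ n / (n.factorial : ℝ)) * inner ℝ u (M0 (x (n + 1)))
      + 2 * (θ ^ (n + 1) / ((n + 1).factorial : ℝ))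
        * (inner ℝ u 0 + inner ℝ u' (M0 (x (n + 1))))) = _
  change M0 u' - (θ * τ) • M1 u' = τ • (A u + M1 u)
    - (θ ^ n / (n.factorial : ℝ)) • M0 (x (n + 1)) at hev
  -- Twice the evolution equation tested with u, minus the τ(M₁u, u) from differentiating the
  -- operator, gives τ(2(Au, u) + (M₁u, u)). The defect enters twice and cancels against the
  -- derivative of the coefficient of the mixed term.
  rw [e1, e2, inner_sub_left (M0 u' - (θ * τ) • M1 u'), hev, inner_sub_left, inner_smul_left,
    inner_smul_left, inner_smul_left, inner_add_left, inner_zero_right]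
  have e3 := h.energy u
  have e4 : inner ℝ (M0 (x (n + 1))) u = inner ℝ u (M0 (x (n + 1))) := real_inner_comm _ _
  change _ = -2 * τ * σ u u + 2 * (θ ^ (n + 1) / ((n + 1).factorial : ℝ))
    * inner ℝ u' (M0 (x (n + 1)))
  simp only [conj_trivial]
  rw [e4]
  linear_combination τ * e3

lemma energyFun_one_sub_zero (h : DissipativePair M0 N0 M1 A D σ m a) (w : V) (n : ℕ) :
    let x : ℕ → V := fun i => taylorTerm N0 A M1 τ i w
    energyFun M0 M1 τ x n 1 - inner ℝ (M0 w) w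
      = -2 * τ * (∫ θ in (0 : ℝ)..1, σ (taylorPoly x (n + 1) θ) (taylorPoly x (n + 1) θ))
        + ∫ θ in (0 : ℝ)..1, 2 * (θ ^ (n + 1) / ((n + 1).factorial : ℝ))
          * inner ℝ (taylorPoly (fun i => x (i + 1)) n θ) (M0 (x (n + 1))) := by
  intro x
  have hc : Continuous fun θ => σ (taylorPoly x (n + 1) θ) (taylorPoly x (n + 1) θ) := by
    -- The form σ carries no continuity assumption; the energy identity expresses it through inner
    -- products of Taylor polynomials, which are continuous in θ.
    have : ∀ u, σ u u = -(1 / 2) * (2 * inner ℝ (A u) u + inner ℝ (M1 u) u) := fun u => by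
      rw [h.energy u]; ring
    simp only [this, map_taylorPoly]
    have := continuous_taylorPoly (fun i => A (x i)) (n + 1)
    have := continuous_taylorPoly (fun i => M1 (x i)) (n + 1)
    have := continuous_taylorPoly x (n + 1)
    fun_prop
  have hc' : Continuous fun θ : ℝ => 2 * (θ ^ (n + 1) / ((n + 1).factorial : ℝ))
      * inner ℝ (taylorPoly (fun i => x (i + 1)) n θ) (M0 (x (n + 1))) := by
    have := continuous_taylorPoly (fun i => x (i + 1)) n
    fun_prop
  have h0 : energyFun M0 M1 τ x n 0 = inner ℝ (M0 w) w := by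
    simp [energyFun, taylorPoly_zero_right, x, taylorTerm]
  rw [← h0, ← intervalIntegral.integral_const_mul, ← intervalIntegral.integral_add
    ((hc.const_mul _).intervalIntegrable _ _) (hc'.intervalIntegrable _ _)]
  exact (intervalIntegral.integral_eq_sub_of_hasDerivAt
    (fun θ _ => h.hasDerivAt_energyFun w n θ)
    (((hc.const_mul _).add hc').intervalIntegrable _ _)).symm

end DissipativePair

end AbstractEnergy

/-! ### Absorption of the last Taylor term by the dissipation -/

section AbstractStability

open DissipativePair

set_option maxHeartbeats 1000000 in
/-- If the `p + 1`-st smooth term vanishes, then the structure-aware Taylor step with `s > p`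
stages increases the energy by a factor of at most `1 + C τ^(2 (s - p) + 1)`. -/
theorem exists_stability_of_smoothTerm_eq_zero (s p : ℕ) (hps : p + 1 ≤ s) (m a : ℝ) (hm : 0 < m)
    (ha : 1 ≤ a) :
    ∃ τ₀ : ℝ, 0 < τ₀ ∧ τ₀ ≤ 1 ∧ ∃ C : ℝ, 0 < C ∧
      ∀ {V : Type} [NormedAddCommGroup V] [InnerProductSpace ℝ V]
        {M0 N0 M1 A D : Module.End ℝ V} {σ : LinearMap.BilinForm ℝ V},
        DissipativePair M0 N0 M1 A D σ m a → smoothTerm N0 D M1 (p + 1) = 0 →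
        ∀ τ : ℝ, 0 < τ → τ ≤ τ₀ → ∀ N : Module.End ℝ V, (M0 - τ • M1) * N = 1 →
        (∀ w, m * ‖w‖ ^ 2 ≤ inner ℝ ((M0 - τ • M1) w) w) →
        ∀ w r : V, r = ∑ i ∈ Finset.range s, ((i.factorial : ℝ)⁻¹) • taylorTerm N0 A M1 τ i w
            + N (M0 (((s.factorial : ℝ)⁻¹) • taylorTerm N0 A M1 τ s w)) →
          inner ℝ ((M0 - τ • M1) r) r
            ≤ (1 + C * τ ^ (2 * (s - p) + 1)) * inner ℝ (M0 w) w := by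
  obtain ⟨n, rfl⟩ : ∃ n, s = n + 1 := ⟨s - 1, by omega⟩
  obtain ⟨c₁, hc₁, hJint⟩ := exists_sum_form_le_integral (n + 1)
  set F : ℝ := ((n + 1).factorial : ℝ) with hF
  have hF1 : 1 ≤ F := by rw [hF]; exact_mod_cast (n + 1).factorial_pos
  -- The coefficients of the Taylor polynomial are x_i/i! with i! ≤ F, so bounding J itself from
  -- above costs F².
  set c : ℝ := c₁ / F ^ 2 with hc
  have hcpos : 0 < c := by positivity
  set g : ℝ := growth m a (n + 1) with hg
  have hgnn : 0 ≤ g := growth_nonneg hm ha _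
  set k : ℝ := g ^ (n + 1 - p - 1) * jumpConst m a (p + 1) with hk
  have hknn : 0 ≤ k := mul_nonneg (by positivity) (jumpConst_nonneg hm ha _)
  -- Bounds the n terms of u', each of which has at least one factor τ; 1 + g replaces g so that its
  -- powers increase.
  set G : ℝ := n * (1 + g) ^ (n + 1) with hG
  have hGnn : 0 ≤ G := by positivity
  -- The constant that Young's inequality leaves when the term in u' is split against cτJ.
  set C₀ : ℝ := (a * G * k) ^ 2 / c with hC₀
  have hC₀nn : 0 ≤ C₀ := by positivity
  have ha0 : 0 ≤ a := zero_le_one.trans ha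
  -- The first bound lets powers of τ be lowered; the second makes the quadratic term in y at most
  -- cτJ. The two added 1's exclude a zero denominator and a zero C.
  refine ⟨min 1 (c * m / (a ^ 2 * k ^ 2 + 1)), lt_min one_pos (by positivity), min_le_left _ _,
    C₀ / m + 1, by positivity, ?_⟩
  intro V _ _ M0 N0 M1 A D σ h hnil τ hτ hττ N hN hcoer w r hr
  have hτ1 : τ ≤ 1 := hττ.trans (min_le_left _ _)
  have hτ2 : τ * (a ^ 2 * k ^ 2 + 1) ≤ c * m :=
    (le_div_iff₀ (by positivity)).mp (hττ.trans (min_le_right _ _))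
  set x : ℕ → V := fun i => taylorTerm N0 A M1 τ i w with hx
  set J : ℝ := ∑ i ∈ Finset.range (n + 1), σ (x i) (x i) with hJ
  have hJnn : 0 ≤ J := Finset.sum_nonneg fun i _ => h.nonneg_σ _
  have hJi : ∀ i < n + 1, σ (x i) (x i) ≤ J := fun i hi =>
    Finset.single_le_sum (f := fun i => σ (x i) (x i)) (fun i _ => h.nonneg_σ _)
      (Finset.mem_range.mpr hi)
  set q := n + 1 - p with hq
  have hlast : ‖x (n + 1)‖ ≤ k * τ ^ q * Real.sqrt J :=
    h.norm_last_taylorTerm_le hnil hτ.le hτ1 w hps hJi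
  have hτq : τ ^ q ≤ τ := by
    calc τ ^ q ≤ τ ^ 1 := pow_le_pow_of_le_one hτ.le hτ1 (by omega)
      _ = τ := pow_one τ
  set y := M0 (x (n + 1)) with hy
  have hyb : ‖y‖ ≤ a * (k * τ ^ q * Real.sqrt J) :=
    (h.bound_M0 _).trans (by gcongr)
  set u := taylorPoly x (n + 1) 1 with hu
  have hrr : r = u + F⁻¹ • N y := by
    rw [hr, hu, taylorPoly]
    simp only [one_pow, one_div, map_smul]
    rfl
  have hMN : ∀ z, (M0 - τ • M1) (N z) = z := fun z => by
    rw [← Module.End.mul_apply, hN]; rfl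
  have hsym : ∀ z z', inner ℝ ((M0 - τ • M1) z) z' = inner ℝ z ((M0 - τ • M1) z') :=
    fun z z' => by
      simp only [LinearMap.sub_apply, LinearMap.smul_apply, inner_sub_left, inner_sub_right,
        inner_smul_left, inner_smul_right, h.symm_M0, h.symm_M1, conj_trivial]
  -- Since the last stage enters through M⁻¹M₀, the cross term is 2(u, y)/s!, without M; this is the
  -- mixed term of the energy at θ = 1.
  have hexp : inner ℝ ((M0 - τ • M1) r) r
      = energyFun M0 M1 τ x n 1 + F⁻¹ ^ 2 * inner ℝ y (N y) := by
    have h1 : inner ℝ ((M0 - τ • M1) u) (N y) = inner ℝ u y := by rw [hsym, hMN]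
    have h2 : inner ℝ y u = inner ℝ u y := real_inner_comm _ _
    have h3 : energyFun M0 M1 τ x n 1
        = inner ℝ ((M0 - τ • M1) u) u + 2 * F⁻¹ * inner ℝ u y := by
      simp [energyFun, ← hu, ← hy, ← hF]
    rw [hrr, map_add, map_smul, hMN, inner_add_left, inner_add_right, inner_add_right,
      inner_smul_left, inner_smul_left, inner_smul_right, inner_smul_right, h1, h2, h3]
    simp only [conj_trivial]
    ring
  have hNy : inner ℝ y (N y) ≤ m⁻¹ * ‖y‖ ^ 2 := by
    have h1 := hcoer (N y)
    rw [hMN] at h1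
    have h2 := real_inner_le_norm y (N y)
    have h3 : m * ‖N y‖ ≤ ‖y‖ := by
      by_cases h0 : ‖N y‖ = 0
      · rw [h0]; simp
      · have h4 : 0 < ‖N y‖ := lt_of_le_of_ne (norm_nonneg _) (Ne.symm h0)
        exact le_of_mul_le_mul_right (by nlinarith) h4
    refine h2.trans ?_
    rw [inv_mul_eq_div, le_div_iff₀ hm]
    nlinarith [norm_nonneg y]
  -- One half of the dissipation 2cτJ is spent here, the other half in `hyoung`.
  have hthird : F⁻¹ ^ 2 * inner ℝ y (N y) ≤ c * τ * J := by
    have h1 : F⁻¹ ^ 2 ≤ 1 := pow_le_one₀ (by positivity) (inv_le_one_of_one_le₀ hF1)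
    have h2 : ‖y‖ ^ 2 ≤ (a * (k * τ ^ q * Real.sqrt J)) ^ 2 := by gcongr
    have h3 : (a * (k * τ ^ q * Real.sqrt J)) ^ 2 ≤ a ^ 2 * k ^ 2 * τ ^ 2 * J := by
      calc (a * (k * τ ^ q * Real.sqrt J)) ^ 2 = a ^ 2 * k ^ 2 * (τ ^ q) ^ 2 * J := by
            rw [mul_pow, mul_pow, mul_pow, Real.sq_sqrt hJnn]; ring
        _ ≤ _ := by gcongr
    have h4 : m⁻¹ * (a ^ 2 * k ^ 2 * τ ^ 2 * J) ≤ c * τ * J := by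
      rw [inv_mul_le_iff₀ hm]
      have : τ * (a ^ 2 * k ^ 2) ≤ c * m := by nlinarith
      calc a ^ 2 * k ^ 2 * τ ^ 2 * J = (τ * (a ^ 2 * k ^ 2)) * (τ * J) := by ring
        _ ≤ (c * m) * (τ * J) := by gcongr
        _ = _ := by ring
    calc F⁻¹ ^ 2 * inner ℝ y (N y) ≤ F⁻¹ ^ 2 * (m⁻¹ * ‖y‖ ^ 2) := by gcongr
      _ ≤ 1 * (m⁻¹ * ‖y‖ ^ 2) := by gcongr
      _ ≤ m⁻¹ * (a ^ 2 * k ^ 2 * τ ^ 2 * J) := by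
          rw [one_mul]; gcongr; exact h2.trans h3
      _ ≤ _ := h4
  have hdiss : c * J ≤ ∫ θ in (0 : ℝ)..1, σ (taylorPoly x (n + 1) θ)
      (taylorPoly x (n + 1) θ) := by
    have h1 := hJint σ h.symm_σ h.nonneg_σ fun i => ((i.factorial : ℝ)⁻¹) • x i
    have h2 : ∀ θ : ℝ, ∑ i ∈ Finset.range (n + 1), θ ^ i • ((i.factorial : ℝ)⁻¹) • x i
        = taylorPoly x (n + 1) θ := fun θ => by
      simp only [taylorPoly, smul_smul, div_eq_mul_inv]
    simp only [h2] at h1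
    refine le_trans ?_ h1
    rw [hc, div_mul_eq_mul_div, mul_div_assoc, hJ, Finset.sum_div]
    gcongr with i hi
    rw [map_smul, map_smul, LinearMap.smul_apply, smul_eq_mul, smul_eq_mul, ← mul_assoc, ← sq,
      div_eq_inv_mul, inv_pow]
    gcongr
    · exact h.nonneg_σ _
    · rw [hF]; exact_mod_cast Nat.factorial_le (Finset.mem_range.mp hi).le
  have hsum : ∑ i ∈ Finset.range n, ‖x (i + 1)‖ ≤ τ * G * ‖w‖ := by
    have h1 : ∀ i ∈ Finset.range n, ‖x (i + 1)‖ ≤ τ * (1 + g) ^ (n + 1) * ‖w‖ := fun i hi => by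
      have hi := Finset.mem_range.mp hi
      refine (h.norm_taylorTerm_le (i := i + 1) (s := n + 1) hτ.le w (by omega)).trans ?_
      gcongr
      rw [← hg, mul_pow]
      gcongr
      · calc τ ^ (i + 1) ≤ τ ^ 1 := pow_le_pow_of_le_one hτ.le hτ1 (by omega)
          _ = τ := pow_one τ
      · calc g ^ (i + 1) ≤ (1 + g) ^ (i + 1) := by gcongr; linarith
          _ ≤ _ := pow_le_pow_right₀ (by linarith) (by omega)
    refine (Finset.sum_le_sum h1).trans (le_of_eq ?_)
    rw [Finset.sum_const, Finset.card_range, nsmul_eq_mul, hG]; ring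
  have hmixed : (∫ θ in (0 : ℝ)..1, 2 * (θ ^ (n + 1) / ((n + 1).factorial : ℝ))
      * inner ℝ (taylorPoly (fun i => x (i + 1)) n θ) y)
      ≤ 2 * (τ * G * ‖w‖ * (a * (k * τ ^ q * Real.sqrt J))) := by
    have h1 : ∀ θ ∈ Set.uIoc (0 : ℝ) 1, ‖2 * (θ ^ (n + 1) / ((n + 1).factorial : ℝ))
        * inner ℝ (taylorPoly (fun i => x (i + 1)) n θ) y‖
        ≤ 2 * (τ * G * ‖w‖ * (a * (k * τ ^ q * Real.sqrt J))) := fun θ hθ => by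
      rw [Set.uIoc_of_le zero_le_one] at hθ
      have hb : θ ^ (n + 1) / ((n + 1).factorial : ℝ) ≤ 1 := by
        rw [div_le_one (by positivity)]
        exact (pow_le_one₀ hθ.1.le hθ.2).trans hF1
      have hb0 : 0 ≤ θ ^ (n + 1) / ((n + 1).factorial : ℝ) :=
        div_nonneg (pow_nonneg hθ.1.le _) (by positivity)
      rw [norm_mul, norm_mul, Real.norm_of_nonneg hb0, Real.norm_two, mul_assoc]
      have hi : ‖inner ℝ (taylorPoly (fun i => x (i + 1)) n θ) y‖
          ≤ τ * G * ‖w‖ * (a * (k * τ ^ q * Real.sqrt J)) := by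
        refine (norm_inner_le_norm _ _).trans ?_
        gcongr
        exact (norm_taylorPoly_le _ _ hθ.1.le hθ.2).trans hsum
      have := mul_le_mul hb hi (norm_nonneg _) zero_le_one
      linarith
    have h2 := intervalIntegral.norm_integral_le_of_norm_le_const h1
    simp only [sub_zero, abs_one, mul_one] at h2
    exact (le_abs_self _).trans h2
  have hyoung : 2 * (τ * G * ‖w‖ * (a * (k * τ ^ q * Real.sqrt J)))
      ≤ c * τ * J + C₀ * τ ^ (2 * q + 1) * ‖w‖ ^ 2 := by
    -- Young's inequality as a completed square, with √J balanced against τ^q‖w‖; the common factor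
    -- τ makes the exponent 2q + 1.
    have h1 : 0 ≤ τ * c * (Real.sqrt J - a * G * k * τ ^ q * ‖w‖ / c) ^ 2 := by positivity
    have h2 : τ * c * (Real.sqrt J - a * G * k * τ ^ q * ‖w‖ / c) ^ 2
        = c * τ * (Real.sqrt J) ^ 2 + C₀ * τ ^ (2 * q + 1) * ‖w‖ ^ 2
          - 2 * (τ * G * ‖w‖ * (a * (k * τ ^ q * Real.sqrt J))) := by
      rw [hC₀, show τ ^ (2 * q + 1) = (τ ^ q) ^ 2 * τ by ring]
      field_simp
      ring
    rw [Real.sq_sqrt hJnn] at h2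
    linarith
  have hE := h.energyFun_one_sub_zero (τ := τ) w n
  simp only at hE
  change energyFun M0 M1 τ x n 1 - inner ℝ (M0 w) w = -2 * τ * (∫ θ in (0 : ℝ)..1,
    σ (taylorPoly x (n + 1) θ) (taylorPoly x (n + 1) θ)) + ∫ θ in (0 : ℝ)..1,
      2 * (θ ^ (n + 1) / ((n + 1).factorial : ℝ))
          * inner ℝ (taylorPoly (fun i => x (i + 1)) n θ) y at hE
  have hτJ := mul_le_mul_of_nonneg_left hdiss hτ.le
  have hw : C₀ * τ ^ (2 * q + 1) * ‖w‖ ^ 2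
      ≤ (C₀ / m + 1) * τ ^ (2 * q + 1) * inner ℝ (M0 w) w := by
    have h1 := h.coercive w
    have h2 : 0 ≤ inner ℝ (M0 w) w := le_trans (by positivity) h1
    calc C₀ * τ ^ (2 * q + 1) * ‖w‖ ^ 2
        = C₀ / m * τ ^ (2 * q + 1) * (m * ‖w‖ ^ 2) := by field_simp
      _ ≤ C₀ / m * τ ^ (2 * q + 1) * inner ℝ (M0 w) w := by gcongr
      _ ≤ _ := by gcongr; linarith
  rw [hexp]
  linarith

end AbstractStability

/-! ### Calculus on a simplex -/

section Simplex

/-- The linear map sending the standard basis to the given edge vectors. -/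
def edgeMap {m d : ℕ} (e : Fin m → Space d) : Space m →ₗ[ℝ] Space d where
  toFun y := ∑ i, y i • e i
  map_add' x y := by simp [add_smul, Finset.sum_add_distrib]
  map_smul' c x := by simp [mul_smul, Finset.smul_sum]

lemma edgeMap_apply {m d : ℕ} (e : Fin m → Space d) (y : Space m) :
    edgeMap e y = ∑ i, y i • e i := rfl

lemma edgeMap_single {m d : ℕ} (e : Fin m → Space d) (i : Fin m) :
    edgeMap e (EuclideanSpace.single i 1) = e i := by
  rw [edgeMap_apply, Finset.sum_eq_single i] <;> simp +contextual

/-- The unit simplex. -/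
def refSimplex (m : ℕ) : Set (Space m) := {y | (∀ i, 0 ≤ y i) ∧ ∑ i, y i ≤ 1}

lemma isClosed_refSimplex (m : ℕ) : IsClosed (refSimplex m) := by
  have h1 : IsClosed {y : Space m | ∀ i, 0 ≤ y i} := by
    simp only [Set.ofPred_forall]
    exact isClosed_iInter fun i => isClosed_le continuous_const (by fun_prop)
  have h2 : IsClosed {y : Space m | ∑ i, y i ≤ 1} :=
    isClosed_le (by fun_prop) continuous_const
  exact h1.inter h2

lemma le_one_of_mem_refSimplex {m : ℕ} {y : Space m} (hy : y ∈ refSimplex m) (i : Fin m) :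
    y i ≤ 1 :=
  (Finset.single_le_sum (f := fun i => y i) (fun i _ => hy.1 i) (Finset.mem_univ i)).trans hy.2

lemma convex_refSimplex (m : ℕ) : Convex ℝ (refSimplex m) := by
  rintro x ⟨hx, hx'⟩ y ⟨hy, hy'⟩ a b ha hb hab
  refine ⟨fun i => ?_, ?_⟩
  · have := hx i
    have := hy i
    simp only [PiLp.add_apply, PiLp.smul_apply, smul_eq_mul]
    positivity
  · simp only [PiLp.add_apply, PiLp.smul_apply, smul_eq_mul, Finset.sum_add_distrib,
      ← Finset.mul_sum]
    nlinarith

lemma isCompact_refSimplex (m : ℕ) : IsCompact (refSimplex m) := by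
  refine Metric.isCompact_of_isClosed_isBounded (isClosed_refSimplex m) ?_
  rw [isBounded_iff_forall_norm_le]
  refine ⟨Real.sqrt m, fun y hy => ?_⟩
  rw [EuclideanSpace.norm_eq]
  refine Real.sqrt_le_sqrt ?_
  calc ∑ i, ‖y i‖ ^ 2 ≤ ∑ i : Fin m, (1 : ℝ) := Finset.sum_le_sum fun i _ => by
        rw [Real.norm_of_nonneg (hy.1 i)]
        exact pow_le_one₀ (hy.1 i) (le_one_of_mem_refSimplex hy i)
    _ = m := by simp

/-- The barycentric parametrization of the simplex with vertices `v` and `v + e i`. -/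
def simplexMap {m d : ℕ} (v : Space d) (e : Fin m → Space d) (y : Space m) : Space d :=
  v + edgeMap e y

lemma convexHull_eq_image_refSimplex {m d : ℕ} (v : Space d) (e : Fin m → Space d) :
    convexHull ℝ (insert v (Set.range fun i => v + e i)) = simplexMap v e '' refSimplex m := by
  apply Set.Subset.antisymm
  · refine convexHull_min ?_ ?_
    · rintro x (rfl | ⟨i, rfl⟩)
      · exact ⟨0, ⟨fun i => by simp, by simp⟩, by simp [simplexMap]⟩
      · refine ⟨EuclideanSpace.single i 1, ⟨fun j => ?_, ?_⟩, by simp [simplexMap, edgeMap_single]⟩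
        · rw [PiLp.single_apply]; split_ifs <;> norm_num
        · simp [PiLp.single_apply]
    · have h := ((convex_refSimplex m).linear_image (edgeMap e)).vadd v
      rw [← Set.image_vadd, Set.image_image] at h
      exact h
  · rintro _ ⟨y, ⟨hy, hy'⟩, rfl⟩
    have h := (convex_convexHull ℝ (insert v (Set.range fun i => v + e i))).sum_mem
      (t := Finset.univ) (w := fun o : Option (Fin m) => o.elim (1 - ∑ i, y i) fun i => y i)
      (z := fun o : Option (Fin m) => o.elim v fun i => v + e i)
      (fun o _ => by cases o <;> simp [hy, hy'])
      (by simp [Fintype.sum_option])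
      (fun o _ => by
        refine subset_convexHull ℝ _ ?_
        cases o <;> simp)
    rw [Fintype.sum_option] at h
    convert! h using 1
    simp only [Option.elim, simplexMap, edgeMap_apply, smul_add, Finset.sum_add_distrib,
      ← Finset.sum_smul, sub_smul, one_smul]
    abel

lemma continuous_simplexMap {m d : ℕ} (v : Space d) (e : Fin m → Space d) :
    Continuous (simplexMap v e) :=
  continuous_const.add (edgeMap e).continuous_of_finiteDimensional

lemma edgeMap_injective {m d : ℕ} {e : Fin m → Space d} (he : LinearIndependent ℝ e) :
    Function.Injective (edgeMap e) := by
  rw [← LinearMap.ker_eq_bot, LinearMap.ker_eq_bot']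
  intro y hy
  ext i
  exact Fintype.linearIndependent_iff.mp he (fun i => y i) hy i

/-- The Hausdorff measure pulls back along an injective affine map to Lebesgue measure times the
volume factor. With m < d this covers facets. -/
lemma setIntegral_simplexMap {m d : ℕ} (v : Space d) {e : Fin m → Space d}
    (he : LinearIndependent ℝ e) {s : Set (Space m)} (f : Space d → ℝ) :
    ∫ x in simplexMap v e '' s, f x ∂μHE[m]
      = (edgeMap e).normDet * ∫ y in s, f (simplexMap v e y) := by
  have hinj : Function.Injective (simplexMap v e) :=
    (add_right_injective v).comp (edgeMap_injective he)
  have hemb : MeasurableEmbedding (simplexMap v e) :=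
    (continuous_simplexMap v e).measurableEmbedding hinj
  have hcomap : (μHE[m] : Measure (Space d)).comap (simplexMap v e)
      = ENNReal.ofReal (edgeMap e).normDet • volume := by
    ext t ht
    rw [hemb.comap_apply, Measure.smul_apply, smul_eq_mul]
    have h1 : simplexMap v e '' t = (fun z => v +ᵥ z) '' (edgeMap e '' t) := by
      rw [Set.image_image]; rfl
    have hiso : Isometry fun z : Space d => v +ᵥ z := isometry_vadd _ _
    have h2 := (edgeMap e).euclideanHausdorffMeasure_image_eq_normDet_mul_volume t
    rw [finrank_euclideanSpace, Fintype.card_fin] at h2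
    rw [h1, hiso.euclideanHausdorffMeasure_image, h2]
  have hsub : simplexMap v e '' s ⊆ Set.range (simplexMap v e) := Set.image_subset_range _ _
  have h1 : ∫ x in simplexMap v e '' s, f x ∂μHE[m]
      = ∫ x in simplexMap v e '' s, f x ∂(μHE[m]).restrict (Set.range (simplexMap v e)) := by
    rw [Measure.restrict_restrict_of_subset hsub]
  rw [h1, ← hemb.map_comap, hemb.setIntegral_map, hcomap,
    Set.preimage_image_eq _ hinj, Measure.restrict_smul, integral_smul_measure,
    ENNReal.toReal_ofReal (LinearMap.normDet_nonneg _), smul_eq_mul]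

lemma setIntegral_simplexMap_volume {d : ℕ} (v : Space d) {e : Fin d → Space d}
    (he : LinearIndependent ℝ e) {s : Set (Space d)} (f : Space d → ℝ) :
    ∫ x in simplexMap v e '' s, f x
      = (edgeMap e).normDet * ∫ y in s, f (simplexMap v e y) := by
  rw [← setIntegral_simplexMap v he, EuclideanSpace.euclideanHausdorffMeasure_eq_volume]

/-- Comparison of the volume factors of a simplex and of one of its facets. -/
lemma normDet_edgeMap_succAbove {n : ℕ} {e g : Fin (n + 1) → Space (n + 1)}
    (hdual : ∀ i j, inner ℝ (g i) (e j) = if i = j then 1 else 0)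
    (hexp : ∀ x, x = ∑ i, inner ℝ (g i) x • e i) (i : Fin (n + 1)) :
    (edgeMap fun j => e (i.succAbove j)).normDet = (edgeMap e).normDet * ‖g i‖ := by
  have hgram : ∀ {m : ℕ} (e : Fin m → Space (n + 1)),
      (edgeMap e).normDet ^ 2 = (Matrix.gram ℝ e).det := fun {m} e => by
    have := (edgeMap e).normDet_sq_eq_det_gram (EuclideanSpace.basisFun (Fin m) ℝ)
    simpa [edgeMap_single] using this
  -- The Gram matrix of the dual basis is the inverse of that of the edges. By Cramer's rule the
  -- minor deleting row and column i is the determinant times ‖g i‖², and that minor is the Gram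
  -- determinant of the facet.
  have hc : (Matrix.gram ℝ e).mulVec (fun k => inner ℝ (g k) (g i)) = Pi.single i 1 := by
    ext j
    have h1 : ∑ k, inner ℝ (e j) (e k) * inner ℝ (g k) (g i) = inner ℝ (e j) (g i) := by
      conv_rhs => rw [hexp (g i), inner_sum]
      exact Finset.sum_congr rfl fun k _ => by rw [inner_smul_right, mul_comm]
    simp only [Matrix.mulVec, dotProduct, Matrix.gram_apply]
    rw [h1, real_inner_comm, hdual, Pi.single_apply]
    simp only [eq_comm]
  have hadj : (Matrix.gram ℝ e).adjugate i i = (Matrix.gram ℝ e).det * ‖g i‖ ^ 2 := by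
    have h1 := congrArg (fun z => (Matrix.gram ℝ e).adjugate.mulVec z i) hc
    simp only [Matrix.mulVec_mulVec, Matrix.adjugate_mul, Matrix.smul_mulVec,
      Matrix.one_mulVec, Matrix.mulVec_single, Pi.smul_apply, smul_eq_mul] at h1
    rw [← real_inner_self_eq_norm_sq, h1]
    simp
  rw [Matrix.adjugate_fin_succ_eq_det_submatrix] at hadj
  have h2 : (Matrix.gram ℝ e).submatrix i.succAbove i.succAbove
      = Matrix.gram ℝ fun j => e (i.succAbove j) := rfl
  rw [h2, ← hgram, ← hgram, ← two_mul, pow_mul, neg_one_sq, one_pow, one_mul, ← mul_pow] at hadj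
  exact (sq_eq_sq₀ (LinearMap.normDet_nonneg _)
    (mul_nonneg (LinearMap.normDet_nonneg _) (norm_nonneg _))).mp hadj

end Simplex

/-! ### Integration by parts on the unit simplex -/

section ReferenceIntegration

/-- Insertion of a zero coordinate: the parametrization of the `i`-th facet of the unit simplex. -/
def insertCoord {n : ℕ} (i : Fin (n + 1)) (s : ℝ) (y : Space n) : Space (n + 1) :=
  WithLp.toLp 2 (i.insertNth s y.ofLp)

lemma insertCoord_mem_refSimplex_iff {n : ℕ} (i : Fin (n + 1)) (s : ℝ) (y : Space n) :
    insertCoord i s y ∈ refSimplex (n + 1) ↔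
      y ∈ refSimplex n ∧ s ∈ Set.Icc 0 (1 - ∑ j, y j) := by
  simp only [refSimplex, insertCoord, Set.mem_ofPred_eq, Fin.forall_iff_succAbove i,
    Fin.sum_univ_succAbove _ i, Fin.insertNth_apply_same, Fin.insertNth_apply_succAbove,
    Set.mem_Icc]
  constructor
  · rintro ⟨⟨h1, h2⟩, h3⟩
    exact ⟨⟨h2, by linarith⟩, h1, by linarith⟩
  · rintro ⟨⟨h2, h4⟩, h1, h3⟩
    exact ⟨⟨h1, h2⟩, by linarith⟩

lemma hasDerivAt_insertCoord {n : ℕ} (i : Fin (n + 1)) (s : ℝ) (y : Space n) :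
    HasDerivAt (fun s => insertCoord i s y) (EuclideanSpace.single i (1 : ℝ)) s := by
  have h : (fun s => insertCoord i s y)
      = fun s => insertCoord i 0 y + s • EuclideanSpace.single i (1 : ℝ) := by
    ext s j
    refine Fin.succAboveCases i ?_ (fun k => ?_) j <;>
      simp [insertCoord, Fin.succAbove_ne]
  rw [h]
  simpa using ((hasDerivAt_id s).smul_const (EuclideanSpace.single i (1 : ℝ))).const_add
    (insertCoord i 0 y)

lemma integral_eq_integral_insertCoord {n : ℕ} (i : Fin (n + 1)) (f : Space (n + 1) → ℝ)
    (hf : Integrable f) : ∫ x, f x = ∫ y : Space n, ∫ s : ℝ, f (insertCoord i s y) := by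
  let e₁ := (MeasurableEquiv.toLp 2 (Fin (n + 1) → ℝ))
  have h₁ : MeasurePreserving e₁ := PiLp.volume_preserving_toLp (Fin (n + 1))
  let e₂ := (MeasurableEquiv.piFinSuccAbove (fun _ : Fin (n + 1) => ℝ) i).symm
  have h₂ : MeasurePreserving e₂ :=
    (volume_preserving_piFinSuccAbove (fun _ : Fin (n + 1) => ℝ) i).symm _
  let e₃ := (MeasurableEquiv.toLp 2 (Fin n → ℝ))
  have h₃ : MeasurePreserving e₃ := PiLp.volume_preserving_toLp (Fin n)
  have hint : Integrable (fun z : ℝ × (Fin n → ℝ) => f (e₁ (e₂ z))) := by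
    have := (h₁.comp h₂).integrable_comp_emb (e₂.trans e₁).measurableEmbedding (g := f)
    exact this.mpr hf
  rw [← h₁.integral_comp', ← h₂.integral_comp', ← h₃.integral_comp', Measure.volume_eq_prod,
    integral_prod_symm _ hint]
  rfl

/-- The fundamental theorem of calculus on the unit simplex, for a function vanishing on the facet
opposite the origin. -/
lemma integral_refSimplex_partial {n : ℕ} (i : Fin (n + 1)) {Q : Space (n + 1) → ℝ}
    (hQ : ContDiff ℝ 1 Q) (h0 : ∀ y ∈ refSimplex (n + 1), ∑ j, y j = 1 → Q y = 0) :
    ∫ y in refSimplex (n + 1), fderiv ℝ Q y (EuclideanSpace.single i 1)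
      = -∫ y in refSimplex n, Q (insertCoord i 0 y) := by
  have hc : Continuous fun y => fderiv ℝ Q y (EuclideanSpace.single i (1 : ℝ)) :=
    (hQ.continuous_fderiv one_ne_zero).clm_apply continuous_const
  have hm : MeasurableSet (refSimplex (n + 1)) := (isClosed_refSimplex _).measurableSet
  have hm' : MeasurableSet (refSimplex n) := (isClosed_refSimplex _).measurableSet
  rw [← integral_indicator hm, integral_eq_integral_insertCoord i _
    ((hc.continuousOn.integrableOn_compact (isCompact_refSimplex _)).integrable_indicator hm),
    ← integral_indicator hm', ← integral_neg]
  congr 1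
  ext y
  by_cases hy : y ∈ refSimplex n
  -- The chord in direction i ends on the slanted facet, where Q vanishes; only the lower end
  -- contributes, whence the sign.
  · have h1 : ∀ s, (refSimplex (n + 1)).indicator
        (fun y => fderiv ℝ Q y (EuclideanSpace.single i (1 : ℝ))) (insertCoord i s y)
        = (Set.Icc 0 (1 - ∑ j, y j)).indicator (fun s =>
          fderiv ℝ Q (insertCoord i s y) (EuclideanSpace.single i (1 : ℝ))) s := fun s => by
      simp only [Set.indicator, insertCoord_mem_refSimplex_iff, hy, true_and]
    have hle : 0 ≤ 1 - ∑ j, y j := by linarith [hy.2]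
    have hd : ∀ s, HasDerivAt (fun s => Q (insertCoord i s y))
        (fderiv ℝ Q (insertCoord i s y) (EuclideanSpace.single i (1 : ℝ))) s := fun s =>
      ((hQ.differentiable one_ne_zero _).hasFDerivAt).comp_hasDerivAt s
        (hasDerivAt_insertCoord i s y)
    have hci : Continuous fun s => insertCoord i s y :=
      continuous_iff_continuousAt.mpr fun s => (hasDerivAt_insertCoord i s y).continuousAt
    simp only [h1]
    rw [integral_indicator measurableSet_Icc, integral_Icc_eq_integral_Ioc,
      ← intervalIntegral.integral_of_le hle,
      intervalIntegral.integral_eq_sub_of_hasDerivAt (fun s _ => hd s)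
        ((hc.comp hci).intervalIntegrable _ _), Set.indicator_of_mem hy,
      h0 (insertCoord i (1 - ∑ j, y j) y)
        ((insertCoord_mem_refSimplex_iff _ _ _).mpr ⟨hy, hle, le_rfl⟩)
        (by simp [insertCoord, Fin.sum_univ_succAbove _ i]), zero_sub]
  · have h1 : ∀ s, (refSimplex (n + 1)).indicator
        (fun y => fderiv ℝ Q y (EuclideanSpace.single i (1 : ℝ))) (insertCoord i s y) = 0 :=
      fun s => Set.indicator_of_notMem (fun h =>
        hy ((insertCoord_mem_refSimplex_iff _ _ _).mp h).1) _
    simp [h1, Set.indicator_of_notMem hy]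

end ReferenceIntegration

/-! ### Polynomials of bounded degree -/

section Polynomials

variable {d : ℕ}

lemma hasFDerivAt_evalPoly (P : MvPolynomial (Fin d) ℝ) (x : Space d) :
    HasFDerivAt (fun x : Space d => eval x.ofLp P)
      (∑ j, eval x.ofLp (pderiv j P) • (EuclideanSpace.proj j : Space d →L[ℝ] ℝ)) x := by
  induction P using MvPolynomial.induction_on with
  | C a => simpa using hasFDerivAt_const a x
  | add P Q hP hQ =>
    simp only [map_add, add_smul, Finset.sum_add_distrib]
    exact hP.add hQ
  | mul_X P i hP =>
    have hX : HasFDerivAt (fun x : Space d => x i) (EuclideanSpace.proj i : Space d →L[ℝ] ℝ) x :=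
      (EuclideanSpace.proj i : Space d →L[ℝ] ℝ).hasFDerivAt
    have h := hP.mul hX
    simp only [map_mul, eval_X]
    refine h.congr_fderiv ?_
    simp only [Derivation.leibniz, pderiv_X, smul_eq_mul, map_add, map_mul, eval_X, add_smul,
      Finset.sum_add_distrib, Finset.smul_sum, smul_smul]
    congr 1
    rw [Finset.sum_eq_single i]
    · simp
    · intro j _ hj
      simp [hj.symm]
    · simp

lemma contDiff_evalPoly (P : MvPolynomial (Fin d) ℝ) (n : WithTop ℕ∞) :
    ContDiff ℝ n fun x : Space d => eval x.ofLp P := by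
  induction P using MvPolynomial.induction_on with
  | C a => simpa using contDiff_const
  | add P Q hP hQ => simpa only [map_add] using hP.add hQ
  | mul_X P i hP =>
    simp only [map_mul, eval_X]
    exact hP.mul (EuclideanSpace.proj i : Space d →L[ℝ] ℝ).contDiff

lemma fderiv_evalPoly_single (P : MvPolynomial (Fin d) ℝ) (x : Space d) (j : Fin d) :
    fderiv ℝ (fun x : Space d => eval x.ofLp P) x (EuclideanSpace.single j 1)
      = eval x.ofLp (pderiv j P) := by
  rw [(hasFDerivAt_evalPoly P x).fderiv]
  simp [PiLp.single_apply]

lemma totalDegree_bind₁_le {m : ℕ} {f : Fin d → MvPolynomial (Fin m) ℝ}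
    (hf : ∀ i, (f i).totalDegree ≤ 1) (P : MvPolynomial (Fin d) ℝ) :
    (bind₁ f P).totalDegree ≤ P.totalDegree := by
  conv_lhs => rw [P.as_sum, map_sum]
  refine totalDegree_finsetSum_le fun s hs => ?_
  rw [bind₁_monomial]
  refine (totalDegree_mul _ _).trans ?_
  rw [totalDegree_C, zero_add]
  refine (totalDegree_finsetProd _ _).trans ?_
  refine le_trans (Finset.sum_le_sum fun i _ => (totalDegree_pow _ _).trans
    (Nat.mul_le_mul_left _ (hf i))) ?_
  simpa [Finsupp.sum] using le_totalDegree hs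

/-- The polynomials of degree less than `k`. -/
def polyLT (d k : ℕ) : Submodule ℝ (MvPolynomial (Fin d) ℝ) :=
  match k with
  -- The index is the degree bound plus one, so the derivative of a constant falls into the zero
  -- space; with `restrictTotalDegree` at 0 the constants would remain and nilpotency would come one
  -- step late.
  | 0 => ⊥
  | k + 1 => restrictTotalDegree (Fin d) ℝ k

lemma pderiv_mem_polyLT {k : ℕ} {P : MvPolynomial (Fin d) ℝ} (hP : P ∈ polyLT d (k + 1))
    (j : Fin d) : pderiv j P ∈ polyLT d k := by
  rw [polyLT, mem_restrictTotalDegree] at hP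
  have key : ∀ s ∈ P.support, pderiv j (monomial s (P.coeff s)) ∈ polyLT d k := fun s hs => by
    have hs' := (le_totalDegree hs).trans hP
    rw [pderiv_monomial]
    by_cases h0 : s j = 0
    · simp [h0]
    · have hsum : s.sum (fun _ e => e) = (s - Finsupp.single j 1).sum (fun _ e => e) + 1 := by
        have h1 : s = (s - Finsupp.single j 1) + Finsupp.single j 1 := by
          rw [tsub_add_cancel_of_le]
          simpa [Finsupp.single_le_iff] using Nat.one_le_iff_ne_zero.mpr h0
        conv_lhs => rw [h1]
        rw [Finsupp.sum_add_index' (fun _ => rfl) (fun _ _ _ => rfl), Finsupp.sum_single_index rfl]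
      cases k with
      | zero => omega
      | succ k =>
        rw [polyLT, mem_restrictTotalDegree]
        exact (totalDegree_monomial_le _ _).trans
          (show (s - Finsupp.single j 1).sum (fun _ e => e) ≤ k by omega)
  rw [P.as_sum, map_sum]
  exact Submodule.sum_mem _ key

/-- The bound is p + 1 because k exceeds the degree by one. With i = 1 and k = p it shows that
multiplying a derivative by δ stays in V_h. -/
lemma pow_mul_mem_restrictTotalDegree {i k p : ℕ} (hik : i + k ≤ p + 1)
    {l q : MvPolynomial (Fin d) ℝ} (hl : l.totalDegree ≤ 1) (hq : q ∈ polyLT d k) :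
    l ^ i * q ∈ restrictTotalDegree (Fin d) ℝ p := by
  cases k with
  | zero =>
    have : q = 0 := hq
    simp [this]
  | succ k =>
    rw [polyLT, mem_restrictTotalDegree] at hq
    rw [mem_restrictTotalDegree]
    refine (totalDegree_mul _ _).trans ?_
    have := (totalDegree_pow l i).trans (Nat.mul_le_mul_left i hl)
    omega

/-- The affine change of variables of a polynomial along the parametrization of a simplex. -/
def pullback {m : ℕ} (v : Space d) (e : Fin m → Space d) (P : MvPolynomial (Fin d) ℝ) :
    MvPolynomial (Fin m) ℝ :=
  bind₁ (fun j => C (v j) + ∑ i, (e i j) • X i) P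

lemma eval_pullback {m : ℕ} (v : Space d) (e : Fin m → Space d) (P : MvPolynomial (Fin d) ℝ)
    (y : Space m) : eval y.ofLp (pullback v e P) = eval (simplexMap v e y).ofLp P := by
  rw [pullback, ← coe_aeval_eq_eval, ← coe_aeval_eq_eval, RingHom.coe_coe, RingHom.coe_coe,
    aeval_bind₁]
  congr 2
  ext j
  simp [simplexMap, edgeMap_apply, smul_eval, mul_comm]

lemma totalDegree_pullback_le {m : ℕ} (v : Space d) (e : Fin m → Space d)
    (P : MvPolynomial (Fin d) ℝ) : (pullback v e P).totalDegree ≤ P.totalDegree := by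
  refine totalDegree_bind₁_le (fun j => ?_) P
  refine (totalDegree_add _ _).trans (max_le (by simp) ?_)
  refine totalDegree_finsetSum_le fun i _ => ?_
  exact (totalDegree_smul_le _ _).trans (by rw [totalDegree_X])

/-- The chain rule for the affine change of variables. -/
lemma eval_pderiv_pullback {m : ℕ} (v : Space d) (e : Fin m → Space d)
    (P : MvPolynomial (Fin d) ℝ) (y : Space m) (i : Fin m) :
    eval y.ofLp (pderiv i (pullback v e P))
      = ∑ j, e i j * eval (simplexMap v e y).ofLp (pderiv j P) := by
  have hlin : HasFDerivAt (simplexMap v e) (LinearMap.toContinuousLinearMap (edgeMap e)) y :=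
    (LinearMap.toContinuousLinearMap (edgeMap e)).hasFDerivAt.const_add v
  have h1 := (hasFDerivAt_evalPoly P (simplexMap v e y)).comp y hlin
  have h2 : (fun x : Space d => eval x.ofLp P) ∘ simplexMap v e
      = fun y : Space m => eval y.ofLp (pullback v e P) := by
    ext y; rw [eval_pullback]; rfl
  rw [h2] at h1
  rw [← fderiv_evalPoly_single, h1.fderiv]
  simp [edgeMap_single, mul_comm]

end Polynomials

/-! ### Inverse inequalities on the unit simplex -/

section InverseInequalities

lemma refSimplex_interior_nonempty (m : ℕ) : (interior (refSimplex m)).Nonempty := by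
  let U : Set (Space m) := {y | (∀ i, 0 < y i) ∧ ∑ i, y i < 1}
  have hU : IsOpen U := by
    have h1 : IsOpen {y : Space m | ∀ i, 0 < y i} := by
      simp only [Set.ofPred_forall]
      exact isOpen_iInter_of_finite fun i => isOpen_lt continuous_const (by fun_prop)
    have h2 : IsOpen {y : Space m | ∑ i, y i < 1} := isOpen_lt (by fun_prop) continuous_const
    exact h1.inter h2
  have hsub : U ⊆ refSimplex m := fun y hy => ⟨fun i => (hy.1 i).le, hy.2.le⟩
  refine ⟨WithLp.toLp 2 fun _ => 1 / ((m : ℝ) + 1), interior_maximal hsub hU ⟨fun i => ?_, ?_⟩⟩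
  · simp only; positivity
  · simp only [Finset.sum_const, Finset.card_univ, Fintype.card_fin, nsmul_eq_mul]
    rw [mul_one_div, div_lt_one (by positivity)]
    linarith

lemma eq_zero_of_eval_eq_zero_on_open {m : ℕ} {U : Set (Space m)} (hU : IsOpen U)
    (hne : U.Nonempty) {P : MvPolynomial (Fin m) ℝ} (h : ∀ x ∈ U, eval x.ofLp P = 0) : P = 0 := by
  obtain ⟨x₀, hx₀⟩ := hne
  have hop : IsOpen ((WithLp.toLp 2 : (Fin m → ℝ) → Space m) ⁻¹' U) :=
    hU.preimage (PiLp.continuous_toLp 2 _)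
  obtain ⟨ε, hε, hball⟩ := Metric.isOpen_iff.mp hop x₀.ofLp (by simpa using hx₀)
  refine MvPolynomial.funext_set (fun j => Metric.ball (x₀ j) ε) (fun j => ?_) fun y hy => ?_
  · rw [Real.ball_eq_Ioo]; exact Set.Ioo_infinite (by linarith)
  · have hy' : y ∈ Metric.ball x₀.ofLp ε := by
      rw [ball_pi _ hε]; exact hy
    simpa using h (WithLp.toLp 2 y) (hball hy')

/-- The `L²` inner product of polynomials on the unit simplex. -/
def refForm (m p : ℕ) : LinearMap.BilinForm ℝ (restrictTotalDegree (Fin m) ℝ p) :=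
  have hint (P Q : MvPolynomial (Fin m) ℝ) : IntegrableOn
      (fun y : Space m => eval y.ofLp P * eval y.ofLp Q) (refSimplex m) :=
    ((continuous_evalPoly P).mul (continuous_evalPoly Q)).continuousOn.integrableOn_compact
      (isCompact_refSimplex m)
  LinearMap.mk₂ ℝ
    (fun P Q => ∫ y in refSimplex m, eval y.ofLp (P : MvPolynomial (Fin m) ℝ)
      * eval y.ofLp (Q : MvPolynomial (Fin m) ℝ))
    (fun P P' Q => by
      rw [← integral_add (hint _ _) (hint _ _)]
      simp only [Submodule.coe_add, map_add, add_mul])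
    (fun r P Q => by
      rw [smul_eq_mul, ← integral_const_mul]
      simp only [Submodule.coe_smul, smul_eval, mul_assoc])
    (fun P Q Q' => by
      rw [← integral_add (hint _ _) (hint _ _)]
      simp only [Submodule.coe_add, map_add, mul_add])
    (fun r P Q => by
      rw [smul_eq_mul, ← integral_const_mul]
      simp only [Submodule.coe_smul, smul_eval, mul_left_comm])

lemma refForm_self (m p : ℕ) (P : restrictTotalDegree (Fin m) ℝ p) :
    refForm m p P P
      = ∫ y in refSimplex m, eval y.ofLp (P : MvPolynomial (Fin m) ℝ) ^ 2 := by
  simp [refForm, sq]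

lemma refForm_pos (m p : ℕ) {P : restrictTotalDegree (Fin m) ℝ p} (hP : P ≠ 0) :
    0 < refForm m p P P := by
  rw [refForm_self]
  have hc : Continuous fun y : Space m => eval y.ofLp (P : MvPolynomial (Fin m) ℝ) ^ 2 :=
    (continuous_evalPoly _).pow 2
  have hne : ∃ x ∈ interior (refSimplex m), eval x.ofLp (P : MvPolynomial (Fin m) ℝ) ≠ 0 := by
    by_contra! h
    exact hP (Subtype.ext (eq_zero_of_eval_eq_zero_on_open isOpen_interior
      (refSimplex_interior_nonempty m) h))
  obtain ⟨x, hx, hxne⟩ := hne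
  have hopen : IsOpen (interior (refSimplex m) ∩
      {y : Space m | eval y.ofLp (P : MvPolynomial (Fin m) ℝ) ^ 2 ≠ 0}) :=
    isOpen_interior.inter (hc.isOpen_preimage _ isOpen_ne)
  have hpos := hopen.measure_pos volume ⟨x, hx, pow_ne_zero 2 hxne⟩
  exact (setIntegral_pos_iff_support_of_nonneg_ae (.of_forall fun y => sq_nonneg _)
    (hc.continuousOn.integrableOn_compact (isCompact_refSimplex m))).mpr
    (hpos.trans_le (measure_mono fun y hy => ⟨hy.2, interior_subset hy.1⟩))

/-- Evaluation of a linear image of a polynomial as a continuous function on the unit simplex. -/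
def evalOn {m p : ℕ} (f : MvPolynomial (Fin m) ℝ →ₗ[ℝ] MvPolynomial (Fin m) ℝ) :
    restrictTotalDegree (Fin m) ℝ p →ₗ[ℝ] C(refSimplex m, ℝ) where
  toFun P := ⟨fun y => eval (y : Space m).ofLp (f P),
    (continuous_evalPoly _).comp continuous_subtype_val⟩
  map_add' P Q := by ext y; simp
  map_smul' c P := by ext y; simp [smul_eval]

/-- Linear maps on a finite-dimensional space are bounded. Working on the reference simplex makes
the constant independent of the element. -/
lemma exists_sq_eval_le_refForm (m p : ℕ)
    (f : MvPolynomial (Fin m) ℝ →ₗ[ℝ] MvPolynomial (Fin m) ℝ) :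
    ∃ C : ℝ, 0 < C ∧ ∀ P : MvPolynomial (Fin m) ℝ, P.totalDegree ≤ p → ∀ y ∈ refSimplex m,
      eval y.ofLp (f P) ^ 2 ≤ C * ∫ y in refSimplex m, eval y.ofLp P ^ 2 := by
  have : CompactSpace (refSimplex m) := isCompact_iff_compactSpace.mp (isCompact_refSimplex m)
  obtain ⟨C, hC, h⟩ := exists_sq_norm_le_of_posDef (refForm m p)
    (fun P Q => by simp [refForm, mul_comm]) (fun P hP => refForm_pos m p hP) (evalOn f)
  refine ⟨C, hC, fun P hP y hy => ?_⟩
  have h1 := h ⟨P, (mem_restrictTotalDegree _ _ _).mpr hP⟩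
  rw [refForm_self] at h1
  refine le_trans ?_ h1
  have h2 := (evalOn f ⟨P, (mem_restrictTotalDegree _ p _).mpr hP⟩).norm_coe_le_norm ⟨y, hy⟩
  have h3 : eval y.ofLp (f P)
      = evalOn f ⟨P, (mem_restrictTotalDegree _ p _).mpr hP⟩ ⟨y, hy⟩ := rfl
  rw [h3, ← sq_abs]
  gcongr
  exact h2

/-- The constants of the inverse inequalities on the unit simplex. -/
lemma exists_inverse_const (m p : ℕ) : ∃ C : ℝ, 0 < C ∧ ∀ P : MvPolynomial (Fin m) ℝ,
    P.totalDegree ≤ p → ∀ y ∈ refSimplex m,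
      eval y.ofLp P ^ 2 ≤ C * ∫ y in refSimplex m, eval y.ofLp P ^ 2 ∧
      ∀ i, eval y.ofLp (pderiv i P) ^ 2 ≤ C * ∫ y in refSimplex m, eval y.ofLp P ^ 2 := by
  obtain ⟨C₀, hC₀, h₀⟩ := exists_sq_eval_le_refForm m p LinearMap.id
  choose C hC h using fun i : Fin m =>
    exists_sq_eval_le_refForm m p (pderiv i : Derivation ℝ _ _).toLinearMap
  have hsum : ∀ i, C i ≤ ∑ i, C i := fun i =>
    Finset.single_le_sum (fun i _ => (hC i).le) (Finset.mem_univ i)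
  have hnn : 0 ≤ ∑ i, C i := Finset.sum_nonneg fun i _ => (hC i).le
  refine ⟨C₀ + ∑ i, C i, by positivity, fun P hP y hy => ?_⟩
  have hI : 0 ≤ ∫ y in refSimplex m, eval y.ofLp P ^ 2 := integral_nonneg fun y => sq_nonneg _
  refine ⟨(h₀ P hP y hy).trans ?_, fun i => (h i P hP y hy).trans ?_⟩
  · gcongr; linarith
  · gcongr; linarith [hsum i]

end InverseInequalities

/-! ### Frames of elements -/

section Frames

variable {n : ℕ}

open Classical in
/-- The edges `e i` of the simplex `K` emanating from its vertex `v`, with the dual basis `g`, which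
consists of the gradients of the barycentric coordinates of the other vertices. -/
structure Frame (K : Finset (Space (n + 1))) (v : Space (n + 1)) where
  e : Fin (n + 1) → Space (n + 1)
  g : Fin (n + 1) → Space (n + 1)
  dual : ∀ i j, inner ℝ (g i) (e j) = if i = j then 1 else 0
  expand : ∀ x, x = ∑ i, inner ℝ (g i) x • e i
  eq_insert : K = insert v (Finset.univ.image fun i => v + e i)

/-- Affine independence makes the n + 1 edges at v a basis; the Riesz representatives of its
coordinate functionals are the dual vectors. -/
lemma nonempty_frame {K : Finset (Space (n + 1))} {v : Space (n + 1)} (hv : v ∈ K)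
    (hind : AffineIndependent ℝ ((↑) : K → Space (n + 1))) (hcard : K.card = n + 1 + 1) :
    Nonempty (Frame K v) := by
  classical
  have hc : (K.erase v).card = n + 1 := by rw [Finset.card_erase_of_mem hv, hcard]; rfl
  let a : Fin (n + 1) ≃ K.erase v := ((K.erase v).equivFinOfCardEq hc).symm
  let e : Fin (n + 1) → Space (n + 1) := fun i => (a i : Space (n + 1)) - v
  have hlin := (affineIndependent_iff_linearIndependent_vsub ℝ _ (⟨v, hv⟩ : K)).mp hind
  let f : Fin (n + 1) → {x : K // x ≠ ⟨v, hv⟩} := fun i =>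
    ⟨⟨a i, Finset.mem_of_mem_erase (a i).2⟩, fun h =>
      Finset.ne_of_mem_erase (a i).2 (congrArg Subtype.val h)⟩
  have hf : Function.Injective f := fun i j h => by
    have : (a i : Space (n + 1)) = a j := congrArg (fun z => ((z.1 : K) : Space (n + 1))) h
    exact a.injective (Subtype.ext this)
  have he : LinearIndependent ℝ e := hlin.comp f hf
  let b := basisOfLinearIndependentOfCardEqFinrank he (by simp)
  have hb : ∀ i, b i = e i := fun i => by simp [b]
  let g : Fin (n + 1) → Space (n + 1) := fun i =>
    (InnerProductSpace.toDual ℝ _).symm (LinearMap.toContinuousLinearMap (b.coord i))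
  have hg : ∀ i x, inner ℝ (g i) x = b.coord i x := fun i x => by simp [g]
  refine ⟨⟨e, g, fun i j => ?_, fun x => ?_, ?_⟩⟩
  · rw [hg, ← hb j, Module.Basis.coord_apply, Module.Basis.repr_self, Finsupp.single_apply]
    simp only [eq_comm]
  · simp only [hg, Module.Basis.coord_apply, ← hb]
    exact (b.sum_repr x).symm
  · ext x
    simp only [e, Finset.mem_insert, Finset.mem_image, Finset.mem_univ, true_and,
      add_sub_cancel]
    constructor
    · intro hx
      by_cases hxv : x = v
      · exact .inl hxv
      · exact .inr ⟨a.symm ⟨x, Finset.mem_erase.mpr ⟨hxv, hx⟩⟩, by simp⟩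
    · rintro (rfl | ⟨i, rfl⟩)
      · exact hv
      · exact Finset.mem_of_mem_erase (a i).2

namespace Frame

variable {K : Finset (Space (n + 1))} {v : Space (n + 1)}

lemma linearIndependent_e (F : Frame K v) : LinearIndependent ℝ F.e := by
  rw [Fintype.linearIndependent_iff]
  intro c hc i
  have := congrArg (fun x => inner ℝ (F.g i) x) hc
  simpa [inner_sum, inner_smul_right, F.dual] using this

lemma e_ne_zero (F : Frame K v) (i : Fin (n + 1)) : F.e i ≠ 0 := F.linearIndependent_e.ne_zero i

lemma g_ne_zero (F : Frame K v) (i : Fin (n + 1)) : F.g i ≠ 0 := fun h => by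
  simpa [h] using F.dual i i

lemma e_injective (F : Frame K v) : Function.Injective F.e := F.linearIndependent_e.injective

lemma mem (F : Frame K v) : v ∈ K := by rw [F.eq_insert]; simp

lemma add_e_mem (F : Frame K v) (i : Fin (n + 1)) : v + F.e i ∈ K := by
  classical
  exact (Finset.ext_iff.mp F.eq_insert _).mpr (by simp)

lemma eq_or_eq_of_mem (F : Frame K v) {a : Space (n + 1)} (ha : a ∈ K) :
    a = v ∨ ∃ i, a = v + F.e i := by
  classical
  rw [F.eq_insert] at ha
  simpa [eq_comm] using ha

/-- The barycentric coordinates. -/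
lemma inner_g_simplexMap (F : Frame K v) (i : Fin (n + 1)) (y : Space (n + 1)) :
    inner ℝ (F.g i) (simplexMap v F.e y - v) = y i := by
  simp [simplexMap, edgeMap_apply, inner_sum, inner_smul_right, F.dual]

lemma simplexMap_inner_g (F : Frame K v) (x : Space (n + 1)) :
    simplexMap v F.e (WithLp.toLp 2 fun i => inner ℝ (F.g i) (x - v)) = x := by
  rw [simplexMap, edgeMap_apply]
  simp only
  rw [← F.expand (x - v)]
  abel

lemma coe_eq (F : Frame K v) :
    (K : Set (Space (n + 1))) = insert v (Set.range fun i => v + F.e i) := by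
  classical
  conv_lhs => rw [F.eq_insert]
  simp

lemma body_eq (F : Frame K v) : body K = simplexMap v F.e '' refSimplex (n + 1) := by
  rw [body, F.coe_eq, convexHull_eq_image_refSimplex]

lemma mem_body_iff (F : Frame K v) (x : Space (n + 1)) :
    x ∈ body K ↔ (∀ i, 0 ≤ inner ℝ (F.g i) (x - v)) ∧ ∑ i, inner ℝ (F.g i) (x - v) ≤ 1 := by
  rw [F.body_eq]
  constructor
  · rintro ⟨y, hy, rfl⟩
    simp only [F.inner_g_simplexMap]
    exact hy
  · intro h
    exact ⟨_, h, F.simplexMap_inner_g x⟩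

lemma add_e_ne (F : Frame K v) (i : Fin (n + 1)) : v + F.e i ≠ v := by
  simpa using F.e_ne_zero i

open Classical in
lemma mem_erase_iff (F : Frame K v) (i : Fin (n + 1)) (a : Space (n + 1)) :
    a ∈ K.erase (v + F.e i) ↔ a = v ∨ ∃ j, a = v + F.e (i.succAbove j) := by
  rw [Finset.mem_erase]
  constructor
  · rintro ⟨h1, h2⟩
    rcases F.eq_or_eq_of_mem h2 with h | ⟨k, rfl⟩
    · exact .inl h
    · obtain ⟨j, hj⟩ := Fin.exists_succAbove_eq (x := k) (y := i) (by rintro rfl; exact h1 rfl)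
      exact .inr ⟨j, by rw [hj]⟩
  · rintro (rfl | ⟨j, rfl⟩)
    · exact ⟨(F.add_e_ne i).symm, F.mem⟩
    · exact ⟨fun h => Fin.succAbove_ne i j (F.e_injective (add_left_cancel h)), F.add_e_mem _⟩

open Classical in
lemma body_erase_eq (F : Frame K v) (i : Fin (n + 1)) :
    body (K.erase (v + F.e i))
      = simplexMap v (fun j => F.e (i.succAbove j)) '' refSimplex n := by
  rw [body, ← convexHull_eq_image_refSimplex]
  congr 1
  ext a
  rw [Finset.mem_coe, F.mem_erase_iff]
  simp [eq_comm]

lemma simplexMap_succAbove (F : Frame K v) (i : Fin (n + 1)) (y : Space n) :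
    simplexMap v (fun j => F.e (i.succAbove j)) y = simplexMap v F.e (insertCoord i 0 y) := by
  simp [simplexMap, edgeMap_apply, insertCoord, Fin.sum_univ_succAbove _ i]

/-- The volume factor. -/
def vol (F : Frame K v) : ℝ := (edgeMap F.e).normDet

lemma vol_pos (F : Frame K v) : 0 < F.vol := by
  refine lt_of_le_of_ne (LinearMap.normDet_nonneg _) (Ne.symm ?_)
  rw [vol, Ne, LinearMap.normDet_eq_zero_iff_ker_ne_bot, not_not, LinearMap.ker_eq_bot]
  exact edgeMap_injective F.linearIndependent_e

lemma setIntegral_body (F : Frame K v) (f : Space (n + 1) → ℝ) :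
    ∫ x in body K, f x = F.vol * ∫ y in refSimplex (n + 1), f (simplexMap v F.e y) := by
  rw [F.body_eq, setIntegral_simplexMap_volume v F.linearIndependent_e, vol]

open Classical in
lemma setIntegral_facet (F : Frame K v) (i : Fin (n + 1)) (f : Space (n + 1) → ℝ) :
    ∫ x in body (K.erase (v + F.e i)), f x ∂μHE[n]
      = F.vol * ‖F.g i‖ * ∫ y in refSimplex n, f (simplexMap v F.e (insertCoord i 0 y)) := by
  have hl : LinearIndependent ℝ fun j => F.e (i.succAbove j) :=
    F.linearIndependent_e.comp _ Fin.succAbove_right_injective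
  rw [F.body_erase_eq, setIntegral_simplexMap v hl, normDet_edgeMap_succAbove F.dual F.expand, vol]
  simp only [F.simplexMap_succAbove]

/-- The outward unit normal on the facet opposite the vertex `v + e i`. -/
def nu (F : Frame K v) (i : Fin (n + 1)) : Space (n + 1) := -(‖F.g i‖⁻¹ • F.g i)

open Classical in
/-- Integration by parts on an element, for a function vanishing on the facet opposite `v`. -/
lemma setIntegral_fderiv (F : Frame K v) {Q : Space (n + 1) → ℝ} (hQ : ContDiff ℝ 1 Q)
    (h0 : ∀ x ∈ body K, ∑ i, inner ℝ (F.g i) (x - v) = 1 → Q x = 0) (j : Fin (n + 1)) :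
    ∫ x in body K, fderiv ℝ Q x (EuclideanSpace.single j 1)
      = ∑ i, F.nu i j * ∫ x in body (K.erase (v + F.e i)), Q x ∂μHE[n] := by
  let φ : Space (n + 1) → Space (n + 1) := simplexMap v F.e
  have hφ : ∀ y, HasFDerivAt φ (LinearMap.toContinuousLinearMap (edgeMap F.e)) y := fun y =>
    (LinearMap.toContinuousLinearMap (edgeMap F.e)).hasFDerivAt.const_add v
  have hφc : ContDiff ℝ 1 φ :=
    contDiff_const.add (LinearMap.toContinuousLinearMap (edgeMap F.e)).contDiff
  have hQφ : ContDiff ℝ 1 (Q ∘ φ) := hQ.comp hφc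
  have hder : ∀ y i, fderiv ℝ (Q ∘ φ) y (EuclideanSpace.single i 1) = fderiv ℝ Q (φ y) (F.e i) :=
    fun y i => by
      have h1 := ((hQ.differentiable one_ne_zero (φ y)).hasFDerivAt).comp y (hφ y)
      rw [h1.fderiv]
      simp [edgeMap_single]
  -- The j-th unit vector has coordinates g_i(j) along the edges, so ∂_j becomes a combination of
  -- derivatives in reference coordinates.
  have hexp : ∀ y, fderiv ℝ Q (φ y) (EuclideanSpace.single j 1)
      = ∑ i, F.g i j * fderiv ℝ (Q ∘ φ) y (EuclideanSpace.single i 1) := fun y => by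
    conv_lhs => rw [F.expand (EuclideanSpace.single j 1), map_sum]
    simp only [map_smul, hder, smul_eq_mul]
    refine Finset.sum_congr rfl fun i _ => ?_
    congr 1
    simp [EuclideanSpace.inner_single_right]
  have hint : ∀ i, IntegrableOn (fun y => F.g i j * fderiv ℝ (Q ∘ φ) y
      (EuclideanSpace.single i (1 : ℝ))) (refSimplex (n + 1)) := fun i =>
    (((hQφ.continuous_fderiv one_ne_zero).clm_apply continuous_const).const_smul
      (F.g i j)).continuousOn.integrableOn_compact (isCompact_refSimplex _)
  have hvan : ∀ y ∈ refSimplex (n + 1), ∑ k, y k = 1 → (Q ∘ φ) y = 0 := fun y hy hy1 => by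
    refine h0 (φ y) (by rw [F.body_eq]; exact ⟨y, hy, rfl⟩) ?_
    simpa only [φ, F.inner_g_simplexMap] using hy1
  rw [F.setIntegral_body]
  change F.vol * ∫ y in refSimplex (n + 1), fderiv ℝ Q (φ y) (EuclideanSpace.single j 1) = _
  simp only [hexp]
  rw [integral_finsetSum _ fun i _ => hint i, Finset.mul_sum]
  refine Finset.sum_congr rfl fun i _ => ?_
  -- The facet integral carries the extra factor ‖g_i‖, which normalizes -g_i to the outward unit
  -- normal.
  rw [integral_const_mul, integral_refSimplex_partial i hQφ hvan, F.setIntegral_facet]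
  have hg : ‖F.g i‖ ≠ 0 := norm_ne_zero_iff.mpr (F.g_ne_zero i)
  simp only [nu, PiLp.neg_apply, PiLp.smul_apply, smul_eq_mul, Function.comp_apply, φ]
  field_simp

/-- The barycenter has equal barycentric coordinates. -/
lemma inner_g_barycenter (F : Frame K v) (i : Fin (n + 1)) :
    inner ℝ (F.g i) (barycenter K - v) = 1 / ((n : ℝ) + 2) := by
  classical
  have hcard : K.card = n + 1 + 1 := by
    rw [F.eq_insert, Finset.card_insert_of_notMem, Finset.card_image_of_injective]
    · simp
    · exact fun i j h => F.e_injective (add_left_cancel h)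
    · simp [F.e_ne_zero]
  have hb : barycenter K = v + (1 / ((n : ℝ) + 2)) • ∑ i, F.e i := by
    rw [barycenter, Finset.centroid_eq_centerMass _ ⟨v, F.mem⟩, Finset.centerMass]
    have hw : ∀ i ∈ K, K.centroidWeights ℝ i = 1 / ((n : ℝ) + 2) := fun i _ => by
      rw [Finset.centroidWeights_apply, hcard]; push_cast; rw [one_div]; ring
    rw [Finset.sum_centroidWeights_eq_one_of_nonempty _ _ ⟨v, F.mem⟩, inv_one, one_smul,
      ← Finset.smul_sum.trans (Finset.sum_congr rfl fun i hi => by rw [hw i hi])]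
    have hs : ∑ i ∈ K, id i = v + ∑ i, (v + F.e i) := by
      conv_lhs => rw [F.eq_insert]
      rw [Finset.sum_insert (by simp [F.e_ne_zero]),
        Finset.sum_image fun i _ j _ h => F.e_injective (add_left_cancel h)]
      rfl
    rw [hs, Finset.sum_add_distrib, Finset.sum_const, Finset.card_univ, Fintype.card_fin,
      ← add_assoc, smul_add, ← Nat.cast_smul_eq_nsmul ℝ]
    congr 1
    have h2 : (n : ℝ) + 2 ≠ 0 := by positivity
    have : v + ((n + 1 : ℕ) : ℝ) • v = ((n : ℝ) + 2) • v := by push_cast; module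
    rw [this, smul_smul, one_div, inv_mul_cancel₀ h2, one_smul]
  rw [hb, add_sub_cancel_left, inner_smul_right, inner_sum]
  simp [F.dual]

lemma isOpen_openSimplex (F : Frame K v) : IsOpen {x | (∀ i, 0 < inner ℝ (F.g i) (x - v)) ∧
    ∑ i, inner ℝ (F.g i) (x - v) < 1} := by
  have h1 : IsOpen {x | ∀ i, 0 < inner ℝ (F.g i) (x - v)} := by
    simp only [Set.ofPred_forall]
    exact isOpen_iInter_of_finite fun i => isOpen_lt continuous_const (by fun_prop)
  have h2 : IsOpen {x | ∑ i, inner ℝ (F.g i) (x - v) < 1} :=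
    isOpen_lt (by fun_prop) continuous_const
  exact h1.inter h2

lemma body_mem_nhds_barycenter (F : Frame K v) : body K ∈ nhds (barycenter K) := by
  refine Filter.mem_of_superset (F.isOpen_openSimplex.mem_nhds ⟨fun i => ?_, ?_⟩)
    fun x hx => (F.mem_body_iff x).mpr ⟨fun i => (hx.1 i).le, hx.2.le⟩
  · rw [F.inner_g_barycenter]; positivity
  · simp only [F.inner_g_barycenter, Finset.sum_const, Finset.card_univ, Fintype.card_fin,
      nsmul_eq_mul]
    rw [mul_one_div, div_lt_one (by positivity)]
    push_cast; linarith

/-- Across the diameter of the ball in direction g_i the i-th barycentric coordinate grows by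
2r‖g_i‖, while on the element it stays in [0, 1]. -/
lemma norm_g_mul_le (F : Frame K v) {x : Space (n + 1)} {r : ℝ} (hr : 0 ≤ r)
    (h : Metric.closedBall x r ⊆ body K) (i : Fin (n + 1)) : 2 * r * ‖F.g i‖ ≤ 1 := by
  have hg : ‖F.g i‖ ≠ 0 := norm_ne_zero_iff.mpr (F.g_ne_zero i)
  have hnorm : ‖(r * ‖F.g i‖⁻¹) • F.g i‖ = r := by
    rw [norm_smul, norm_mul, norm_inv, norm_norm, Real.norm_of_nonneg hr]
    field_simp
  have h1 : x + (r * ‖F.g i‖⁻¹) • F.g i ∈ body K := h (by simp [hnorm])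
  have h2 : x - (r * ‖F.g i‖⁻¹) • F.g i ∈ body K := h (by simp [hnorm])
  rw [F.mem_body_iff] at h1 h2
  have h3 := (Finset.single_le_sum (fun i _ => h1.1 i) (Finset.mem_univ i)).trans h1.2
  have h4 := h2.1 i
  have h5 : inner ℝ (F.g i) ((r * ‖F.g i‖⁻¹) • F.g i) = r * ‖F.g i‖ := by
    rw [inner_smul_right, real_inner_self_eq_norm_sq]
    field_simp
  rw [add_sub_right_comm, inner_add_right, h5] at h3
  rw [sub_right_comm, inner_sub_right, h5] at h4
  linarith

end Frame

end Frames

/-! ### The height of the tent on an element -/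

section Height

variable {n : ℕ} {T : Mesh (n + 1)} {K : Finset (Space (n + 1))} {v : Space (n + 1)}

lemma Frame.mem_body_of_mem {a : Space (n + 1)} (ha : a ∈ K) : a ∈ body K :=
  subset_convexHull ℝ _ ha

namespace LagrangeP1

/-- The gradient is taken at the barycenter, an interior point of the element, near which φ equals
its affine piece. -/
lemma apply_eq_add_inner_grad (φ : LagrangeP1 T) (F : Frame K v) (hK : T.IsElement K)
    {x : Space (n + 1)} (hx : x ∈ body K) :
    φ.toFun x = φ.toFun v + inner ℝ (φ.grad K) (x - v) := by
  obtain ⟨A, hA⟩ := φ.affine K hK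
  have hlin : ∀ x y, A x = A y + A.linear (x - y) := fun x y => by
    have := A.linearMap_vsub x y
    simp only [vsub_eq_sub] at this
    rw [this]; ring
  have hder : HasFDerivAt A (LinearMap.toContinuousLinearMap A.linear) (barycenter K) := by
    have h : (A : Space (n + 1) → ℝ) = fun x => A.linear x + A 0 := by
      ext x; rw [hlin x 0]; simp [add_comm]
    rw [h]
    exact (LinearMap.toContinuousLinearMap A.linear).hasFDerivAt.add_const (A 0)
  have heq : φ.toFun =ᶠ[nhds (barycenter K)] A :=
    Filter.eventuallyEq_of_mem F.body_mem_nhds_barycenter hA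
  have hg : ∀ u, inner ℝ (φ.grad K) u = A.linear u := fun u => by
    rw [grad, gradient, InnerProductSpace.toDual_symm_apply, heq.fderiv_eq, hder.fderiv]
    rfl
  rw [hA hx, hA (Frame.mem_body_of_mem F.mem), hlin x v, hg]

lemma grad_sub {φ ψ χ : LagrangeP1 T} (h : ∀ x, χ.toFun x = φ.toFun x - ψ.toFun x)
    (F : Frame K v) (hK : T.IsElement K) : χ.grad K = φ.grad K - ψ.grad K := by
  have key : ∀ i, inner ℝ (χ.grad K) (F.e i) = inner ℝ (φ.grad K - ψ.grad K) (F.e i) := fun i => by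
    have hm := Frame.mem_body_of_mem (F.add_e_mem i)
    have h1 := χ.apply_eq_add_inner_grad F hK hm
    have h2 := φ.apply_eq_add_inner_grad F hK hm
    have h3 := ψ.apply_eq_add_inner_grad F hK hm
    rw [h, h v] at h1
    simp only [add_sub_cancel_left] at h1 h2 h3
    rw [inner_sub_left]
    linarith
  refine ext_inner_right ℝ fun x => ?_
  rw [F.expand x]
  simp only [inner_sum, inner_smul_right, key]

/-- The affine polynomial which agrees with `δ` on the element `K`. -/
def poly (δ : LagrangeP1 T) (K : Finset (Space (n + 1))) (v : Space (n + 1)) :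
    MvPolynomial (Fin (n + 1)) ℝ :=
  C (δ.toFun v) + ∑ j, (δ.grad K j) • (X j - C (v j))

lemma totalDegree_poly_le (δ : LagrangeP1 T) (K : Finset (Space (n + 1))) (v : Space (n + 1)) :
    (δ.poly K v).totalDegree ≤ 1 := by
  refine (totalDegree_add _ _).trans (max_le (by simp) ?_)
  refine totalDegree_finsetSum_le fun i _ => (totalDegree_smul_le _ _).trans ?_
  refine (totalDegree_sub _ _).trans (max_le (by rw [totalDegree_X]) (by simp))

lemma eval_poly' (δ : LagrangeP1 T) (K : Finset (Space (n + 1))) (v x : Space (n + 1)) :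
    eval x.ofLp (δ.poly K v) = δ.toFun v + inner ℝ (δ.grad K) (x - v) := by
  simp [poly, smul_eval, PiLp.inner_apply, mul_comm]

lemma eval_poly (δ : LagrangeP1 T) (F : Frame K v) (hK : T.IsElement K) {x : Space (n + 1)}
    (hx : x ∈ body K) : eval x.ofLp (δ.poly K v) = δ.toFun x := by
  rw [eval_poly', ← δ.apply_eq_add_inner_grad F hK hx]

lemma pderiv_poly (δ : LagrangeP1 T) (K : Finset (Space (n + 1))) (v : Space (n + 1))
    (j : Fin (n + 1)) : pderiv j (δ.poly K v) = C (δ.grad K j) := by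
  simp only [poly, map_add, map_sum, Derivation.map_smul, pderiv_C, zero_add]
  rw [Finset.sum_eq_single j]
  · simp [smul_eq_C_mul]
  · intro i _ hi; simp [hi]
  · simp

/-- A function which vanishes at all vertices of `K` except `v`. -/
def VanishesOff (δ : LagrangeP1 T) (K : Finset (Space (n + 1))) (v : Space (n + 1)) : Prop :=
  ∀ a ∈ K, a ≠ v → δ.toFun a = 0

section

variable {δ : LagrangeP1 T}

lemma inner_grad_e (F : Frame K v) (hK : T.IsElement K)
    (hδ : δ.VanishesOff K v) (i : Fin (n + 1)) : inner ℝ (δ.grad K) (F.e i) = -δ.toFun v := by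
  have h1 := δ.apply_eq_add_inner_grad F hK (Frame.mem_body_of_mem (F.add_e_mem i))
  rw [hδ _ (F.add_e_mem i) (F.add_e_ne i), add_sub_cancel_left] at h1
  linarith

/-- An affine function that vanishes at the other vertices is its value at v times the barycentric
coordinate of v. Sign, size and vanishing on the facet opposite v are read off from this. -/
lemma eval_poly_eq (F : Frame K v) (hK : T.IsElement K)
    (hδ : δ.VanishesOff K v) (x : Space (n + 1)) :
    eval x.ofLp (δ.poly K v) = δ.toFun v * (1 - ∑ i, inner ℝ (F.g i) (x - v)) := by
  rw [eval_poly']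
  conv_lhs => rw [F.expand (x - v)]
  simp only [inner_sum, inner_smul_right, inner_grad_e F hK hδ, ← Finset.sum_mul]
  ring

lemma abs_eval_poly_le (F : Frame K v) (hK : T.IsElement K)
    (hδ : δ.VanishesOff K v) {x : Space (n + 1)} (hx : x ∈ body K) :
    |eval x.ofLp (δ.poly K v)| ≤ |δ.toFun v| := by
  rw [eval_poly_eq F hK hδ, abs_mul]
  obtain ⟨h1, h2⟩ := (F.mem_body_iff x).mp hx
  have h3 := Finset.sum_nonneg fun i (_ : i ∈ Finset.univ) => h1 i
  exact mul_le_of_le_one_right (abs_nonneg _) (abs_le.mpr ⟨by linarith, by linarith⟩)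

lemma nonneg_of_mem_body (F : Frame K v) (hK : T.IsElement K)
    (hδ : δ.VanishesOff K v) (h0 : 0 ≤ δ.toFun v) {x : Space (n + 1)} (hx : x ∈ body K) :
    0 ≤ δ.toFun x := by
  rw [← δ.eval_poly F hK hx, eval_poly_eq F hK hδ]
  have := ((F.mem_body_iff x).mp hx).2
  exact mul_nonneg h0 (by linarith)

/-- The height of the tent pole is controlled by the gradient and the shape of the element. -/
lemma abs_mul_norm_g_le (F : Frame K v) (hK : T.IsElement K)
    (hδ : δ.VanishesOff K v) {κ L : ℝ} (hκ : 0 < κ)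
    (hshape : ∃ x, Metric.closedBall x (Metric.diam (body K) / κ) ⊆ body K)
    (hL : ‖δ.grad K‖ ≤ L) (i : Fin (n + 1)) : |δ.toFun v| * ‖F.g i‖ ≤ L * κ := by
  obtain ⟨x, hx⟩ := hshape
  have hr : 0 ≤ Metric.diam (body K) / κ := div_nonneg Metric.diam_nonneg hκ.le
  have h1 := F.norm_g_mul_le hr hx i
  -- Along an edge from v the function falls from δ(v) to 0, so the pole is at most slope times
  -- diameter; the inscribed ball bounds ‖g_i‖ by κ over the diameter.
  have h2 : |δ.toFun v| ≤ ‖δ.grad K‖ * ‖F.e 0‖ := by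
    rw [← abs_neg, ← inner_grad_e F hK hδ 0]
    exact abs_real_inner_le_norm _ _
  have h3 : ‖F.e 0‖ ≤ Metric.diam (body K) := by
    have := Metric.dist_le_diam_of_mem (isCompact_body K).isBounded
      (Frame.mem_body_of_mem (F.add_e_mem 0)) (Frame.mem_body_of_mem F.mem)
    simpa [dist_eq_norm] using this
  have h4 : Metric.diam (body K) * ‖F.g i‖ ≤ κ := by
    have : 2 * (Metric.diam (body K) / κ) * ‖F.g i‖ * κ
        = 2 * (Metric.diam (body K) * ‖F.g i‖) := by field_simp
    have h5 := mul_le_mul_of_nonneg_right h1 hκ.le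
    rw [this] at h5
    have : 0 ≤ Metric.diam (body K) * ‖F.g i‖ := mul_nonneg Metric.diam_nonneg (norm_nonneg _)
    linarith
  have hL0 : 0 ≤ L := (norm_nonneg _).trans hL
  calc |δ.toFun v| * ‖F.g i‖ ≤ (L * Metric.diam (body K)) * ‖F.g i‖ := by
        gcongr; exact h2.trans (by gcongr)
    _ = L * (Metric.diam (body K) * ‖F.g i‖) := by ring
    _ ≤ L * κ := by gcongr

open Classical in
/-- Integration by parts on an element with the weight `δ`. -/
lemma elemInt_pderiv (F : Frame K v) (hK : T.IsElement K)
    (hδ : δ.VanishesOff K v) (P : MvPolynomial (Fin (n + 1)) ℝ) (j : Fin (n + 1)) :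
    elemInt K δ.toFun (pderiv j P) + δ.grad K j * elemInt K 1 P
      = ∑ i, F.nu i j * facetInt (K.erase (v + F.e i)) δ.toFun P := by
  have hm : MeasurableSet (body K) := (isCompact_body K).isClosed.measurableSet
  have hc1 : IntegrableOn (fun x : Space (n + 1) =>
      eval x.ofLp (δ.poly K v) * eval x.ofLp (pderiv j P)) (body K) :=
    ((continuous_evalPoly _).mul (continuous_evalPoly _)).continuousOn.integrableOn_compact
      (isCompact_body K)
  have hc2 : IntegrableOn (fun x : Space (n + 1) => δ.grad K j * eval x.ofLp P) (body K) :=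
    ((continuous_const.mul (continuous_evalPoly _)).continuousOn).integrableOn_compact
      (isCompact_body K)
  have h1 : elemInt K δ.toFun (pderiv j P) + δ.grad K j * elemInt K 1 P
      = ∫ x in body K, fderiv ℝ (fun x : Space (n + 1) => eval x.ofLp (δ.poly K v * P)) x
        (EuclideanSpace.single j 1) := by
    rw [elemInt, elemInt, ← integral_const_mul]
    simp only [Pi.one_apply, one_mul]
    rw [setIntegral_congr_fun (g := fun x : Space (n + 1) =>
      eval x.ofLp (δ.poly K v) * eval x.ofLp (pderiv j P)) hm
      (fun x hx => by simp only [δ.eval_poly F hK hx]), ← integral_add hc1 hc2]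
    refine setIntegral_congr_fun hm fun x _ => ?_
    simp only
    rw [fderiv_evalPoly_single, Derivation.leibniz, pderiv_poly]
    simp [mul_comm]
  rw [h1, F.setIntegral_fderiv (contDiff_evalPoly _ _)]
  · refine Finset.sum_congr rfl fun i _ => ?_
    congr 1
    rw [facetInt]
    refine setIntegral_congr_fun (isCompact_body _).isClosed.measurableSet fun x hx => ?_
    have hx' : x ∈ body K := convexHull_mono (by simp) hx
    simp [δ.eval_poly F hK hx']
  · intro x _ hx1
    simp [eval_poly_eq F hK hδ, hx1]

variable {p : ℕ} {Cinv B : ℝ}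

lemma elemInt_sq (F : Frame K v) (P : MvPolynomial (Fin (n + 1)) ℝ) :
    elemInt K 1 (P ^ 2)
      = F.vol * ∫ y in refSimplex (n + 1), eval y.ofLp (pullback v F.e P) ^ 2 := by
  rw [elemInt, F.setIntegral_body]
  simp [eval_pullback]

open Classical in
/-- The weighted trace inequality. -/
lemma facetInt_sq_le (F : Frame K v) (hK : T.IsElement K)
    (hδ : δ.VanishesOff K v) (h0 : 0 ≤ δ.toFun v)
    (hC : ∀ P : MvPolynomial (Fin (n + 1)) ℝ, P.totalDegree ≤ p → ∀ y ∈ refSimplex (n + 1),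
      eval y.ofLp P ^ 2 ≤ Cinv * ∫ y in refSimplex (n + 1), eval y.ofLp P ^ 2)
    (hB : ∀ i, |δ.toFun v| * ‖F.g i‖ ≤ B) {P : MvPolynomial (Fin (n + 1)) ℝ}
    (hP : P.totalDegree ≤ p) (hC0 : 0 ≤ Cinv) (i : Fin (n + 1)) :
    facetInt (K.erase (v + F.e i)) δ.toFun (P ^ 2)
      ≤ volume.real (refSimplex n) * B * Cinv * elemInt K 1 (P ^ 2) := by
  set I := ∫ y in refSimplex (n + 1), eval y.ofLp (pullback v F.e P) ^ 2 with hI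
  have hInn : 0 ≤ I := integral_nonneg fun y => sq_nonneg _
  have hbody : ∀ y ∈ refSimplex n, simplexMap v F.e (insertCoord i 0 y) ∈ body K := fun y hy => by
    rw [F.body_eq]
    refine ⟨_, (insertCoord_mem_refSimplex_iff _ _ _).mpr ⟨hy, le_rfl, ?_⟩, rfl⟩
    linarith [hy.2]
  have hpt : ∀ y ∈ refSimplex n, δ.toFun (simplexMap v F.e (insertCoord i 0 y))
      * eval (simplexMap v F.e (insertCoord i 0 y)).ofLp (P ^ 2) ≤ δ.toFun v * (Cinv * I) :=
    fun y hy => by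
      have h1 := δ.abs_eval_poly_le F hK hδ (hbody y hy)
      rw [δ.eval_poly F hK (hbody y hy), abs_of_nonneg h0] at h1
      have h2 := hC _ ((totalDegree_pullback_le v F.e P).trans hP) (insertCoord i 0 y)
        ((insertCoord_mem_refSimplex_iff _ _ _).mpr ⟨hy, le_rfl, by linarith [hy.2]⟩)
      rw [eval_pullback] at h2
      rw [map_pow]
      exact mul_le_mul ((le_abs_self _).trans h1) h2 (sq_nonneg _) h0
  have hle : ∫ y in refSimplex n, δ.toFun (simplexMap v F.e (insertCoord i 0 y))
      * eval (simplexMap v F.e (insertCoord i 0 y)).ofLp (P ^ 2)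
      ≤ volume.real (refSimplex n) * (δ.toFun v * (Cinv * I)) := by
    have hfin : volume (refSimplex n) < ⊤ := (isCompact_refSimplex n).measure_lt_top
    have hm := (isClosed_refSimplex n).measurableSet
    calc _ ≤ ∫ y in refSimplex n, δ.toFun v * (Cinv * I) :=
          integral_mono_of_nonneg
            (by
              filter_upwards [ae_restrict_mem hm] with y hy
              exact mul_nonneg (nonneg_of_mem_body F hK hδ h0 (hbody y hy))
                (by rw [map_pow]; positivity))
            (integrableOn_const hfin.ne)
            (by filter_upwards [ae_restrict_mem hm] with y hy using hpt y hy)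
      _ = _ := by rw [setIntegral_const, smul_eq_mul]
  have hB' := hB i
  rw [abs_of_nonneg h0] at hB'
  rw [elemInt_sq F, ← hI, facetInt]
  change ∫ x in body (K.erase (v + F.e i)), δ.toFun x * eval x.ofLp (P ^ 2) ∂μHE[n] ≤ _
  rw [F.setIntegral_facet]
  have hvol := F.vol_pos.le
  -- The facet-to-volume ratio ‖g_i‖ scales like the inverse diameter; the weight δ(v) compensates
  -- it.
  calc _ ≤ F.vol * ‖F.g i‖ * (volume.real (refSimplex n) * (δ.toFun v * (Cinv * I))) := by gcongr
    _ = F.vol * volume.real (refSimplex n) * Cinv * I * (δ.toFun v * ‖F.g i‖) := by ring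
    _ ≤ F.vol * volume.real (refSimplex n) * Cinv * I * B := by
        gcongr
    _ = _ := by ring

/-- The inverse inequality for the weighted derivatives. -/
lemma elemInt_sq_poly_mul_pderiv_le (F : Frame K v) (hK : T.IsElement K)
    (hδ : δ.VanishesOff K v)
    (hC : ∀ P : MvPolynomial (Fin (n + 1)) ℝ, P.totalDegree ≤ p → ∀ y ∈ refSimplex (n + 1),
      ∀ i, eval y.ofLp (pderiv i P) ^ 2
        ≤ Cinv * ∫ y in refSimplex (n + 1), eval y.ofLp P ^ 2)
    (hB : ∀ i, |δ.toFun v| * ‖F.g i‖ ≤ B) {P : MvPolynomial (Fin (n + 1)) ℝ}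
    (hP : P.totalDegree ≤ p) (j : Fin (n + 1)) :
    elemInt K 1 ((δ.poly K v * pderiv j P) ^ 2)
      ≤ volume.real (refSimplex (n + 1)) * (n + 1) ^ 2 * B ^ 2 * Cinv * elemInt K 1 (P ^ 2) := by
  set I := ∫ y in refSimplex (n + 1), eval y.ofLp (pullback v F.e P) ^ 2 with hI
  have hexp : ∀ y, eval (simplexMap v F.e y).ofLp (pderiv j P)
      = ∑ i, F.g i j * eval y.ofLp (pderiv i (pullback v F.e P)) := fun y => by
    simp only [eval_pderiv_pullback, Finset.mul_sum, ← mul_assoc]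
    rw [Finset.sum_comm]
    simp only [← Finset.sum_mul]
    have h1 : ∀ k, ∑ i, F.g i j * F.e i k = if k = j then 1 else 0 := fun k => by
      have := congrArg (fun z : Space (n + 1) => z k) (F.expand (EuclideanSpace.single j 1))
      simp only [EuclideanSpace.inner_single_right, PiLp.single_apply] at this
      rw [this]
      simp
    simp [h1]
  have hpt : ∀ y ∈ refSimplex (n + 1),
      eval (simplexMap v F.e y).ofLp ((δ.poly K v * pderiv j P) ^ 2)
        ≤ (n + 1) ^ 2 * B ^ 2 * (Cinv * I) := fun y hy => by
    have hy' : simplexMap v F.e y ∈ body K := by rw [F.body_eq]; exact ⟨y, hy, rfl⟩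
    have h1 := δ.abs_eval_poly_le F hK hδ hy'
    rw [map_pow, map_mul, hexp, mul_pow, ← sq_abs]
    have h2 : (∑ i, F.g i j * eval y.ofLp (pderiv i (pullback v F.e P))) ^ 2
        ≤ (n + 1) * ∑ i, (F.g i j * eval y.ofLp (pderiv i (pullback v F.e P))) ^ 2 := by
      simpa using sq_sum_le_card_mul_sum_sq (s := Finset.univ)
        (f := fun i => F.g i j * eval y.ofLp (pderiv i (pullback v F.e P)))
    calc _ ≤ |δ.toFun v| ^ 2
          * ((n + 1) * ∑ i, (F.g i j * eval y.ofLp (pderiv i (pullback v F.e P))) ^ 2) := by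
          gcongr
      -- The weight is paired with the g_i that the chain rule produces, so no negative power of the
      -- mesh size survives.
      _ = (n + 1) * ∑ i, (|δ.toFun v| * F.g i j) ^ 2
          * eval y.ofLp (pderiv i (pullback v F.e P)) ^ 2 := by
          rw [mul_left_comm, Finset.mul_sum]
          congr 1
          exact Finset.sum_congr rfl fun i _ => by ring
      _ ≤ (n + 1) * ∑ i : Fin (n + 1), B ^ 2 * (Cinv * I) := by
          refine mul_le_mul_of_nonneg_left (Finset.sum_le_sum fun i _ => ?_) (by positivity)
          have hg : |F.g i j| ≤ ‖F.g i‖ := by simpa using PiLp.norm_apply_le (F.g i) j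
          have h3 : (|δ.toFun v| * F.g i j) ^ 2 ≤ B ^ 2 := by
            rw [← sq_abs, abs_mul, abs_abs]
            have : |δ.toFun v| * |F.g i j| ≤ B := le_trans (by gcongr) (hB i)
            gcongr
          exact mul_le_mul h3 (hC _ ((totalDegree_pullback_le v F.e P).trans hP) y hy i)
            (sq_nonneg _) (sq_nonneg _)
      _ = _ := by
          rw [Finset.sum_const, Finset.card_univ, Fintype.card_fin, nsmul_eq_mul]
          push_cast; ring
  rw [elemInt_sq F P, ← hI, elemInt, F.setIntegral_body]
  simp only [Pi.one_apply, one_mul]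
  have hfin : volume (refSimplex (n + 1)) < ⊤ := (isCompact_refSimplex _).measure_lt_top
  have hm := (isClosed_refSimplex (n + 1)).measurableSet
  have hle : ∫ y in refSimplex (n + 1),
      eval (simplexMap v F.e y).ofLp ((δ.poly K v * pderiv j P) ^ 2)
      ≤ volume.real (refSimplex (n + 1)) * ((n + 1) ^ 2 * B ^ 2 * (Cinv * I)) := by
    have hconst : Integrable (fun _ : Space (n + 1) => ((n : ℝ) + 1) ^ 2 * B ^ 2 * (Cinv * I))
        (volume.restrict (refSimplex (n + 1))) := integrableOn_const hfin.ne
    calc _ ≤ ∫ y in refSimplex (n + 1), ((n + 1) ^ 2 * B ^ 2 * (Cinv * I)) :=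
          integral_mono_of_nonneg (.of_forall fun y => by
              simp only [map_pow, Pi.zero_apply]; positivity)
            hconst
            (by filter_upwards [ae_restrict_mem hm] with y hy using hpt y hy)
      _ = _ := by rw [setIntegral_const, smul_eq_mul]
  calc _ ≤ F.vol * (volume.real (refSimplex (n + 1)) * ((n + 1) ^ 2 * B ^ 2 * (Cinv * I))) :=
        mul_le_mul_of_nonneg_left hle F.vol_pos.le
    _ = _ := by ring

end

end LagrangeP1

end Height

/-! ### Neighbouring elements -/

section Neighbours

open scoped Classical in
/-- A point of the simplex with vertices `A ∋ v`, close to the vertex `v` for small `η`. -/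
def facetPoint {d : ℕ} (A : Finset (Space d)) (v : Space d) (η : ℝ) : Space d :=
  v + η • ∑ a ∈ A, (a - v)

lemma continuous_facetPoint {d : ℕ} (A : Finset (Space d)) (v : Space d) :
    Continuous (facetPoint A v) := by
  unfold facetPoint; fun_prop

lemma convex_inner_sub_eq_zero {d : ℕ} (g v : Space d) : Convex ℝ {y | inner ℝ g (y - v) = 0} := by
  intro y hy z hz s t _ _ hst
  simp only [Set.mem_ofPred_eq] at *
  have : s • y + t • z - v = s • (y - v) + t • (z - v) := by
    have : v = (s + t) • v := by rw [hst, one_smul]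
    nth_rw 1 [this]
    module
  rw [this, inner_add_right, inner_smul_right, inner_smul_right, hy, hz]
  ring

variable {n : ℕ} {T : Mesh (n + 1)} {K K' : Finset (Space (n + 1))} {v : Space (n + 1)}

namespace Frame

lemma nonempty_of_isElement (hK : T.IsElement K) (hv : v ∈ K) : Nonempty (Frame K v) :=
  nonempty_frame hv (T.indep hK.1) hK.2

/-- A neighbourhood of the relative interior of the `i`-th facet. -/
def facetNhd (F : Frame K v) (i : Fin (n + 1)) : Set (Space (n + 1)) :=
  {x | (∀ k, k ≠ i → 0 < inner ℝ (F.g k) (x - v)) ∧ ∑ k, inner ℝ (F.g k) (x - v) < 1}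

lemma isOpen_facetNhd (F : Frame K v) (i : Fin (n + 1)) : IsOpen (F.facetNhd i) := by
  have h1 : IsOpen {x | ∀ k, k ≠ i → 0 < inner ℝ (F.g k) (x - v)} := by
    simp only [Set.ofPred_forall]
    exact isOpen_iInter_of_finite fun k => isOpen_iInter_of_finite fun _ =>
      isOpen_lt continuous_const (by fun_prop)
  have h2 : IsOpen {x | ∑ k, inner ℝ (F.g k) (x - v) < 1} :=
    isOpen_lt (by fun_prop) continuous_const
  exact h1.inter h2

lemma mem_body_of_mem_facetNhd (F : Frame K v) {i : Fin (n + 1)} {x : Space (n + 1)}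
    (hx : x ∈ F.facetNhd i) (h0 : 0 ≤ inner ℝ (F.g i) (x - v)) : x ∈ body K := by
  refine (F.mem_body_iff x).mpr ⟨fun k => ?_, hx.2.le⟩
  by_cases h : k = i
  · rwa [h]
  · exact (hx.1 k h).le

open Classical in
lemma inner_g_of_mem_erase (F : Frame K v) (i : Fin (n + 1)) {a : Space (n + 1)}
    (ha : a ∈ K.erase (v + F.e i)) : inner ℝ (F.g i) (a - v) = 0 := by
  rcases (F.mem_erase_iff i a).mp ha with rfl | ⟨j, rfl⟩
  · simp
  · rw [add_sub_cancel_left, F.dual, if_neg (Fin.succAbove_ne i j).symm]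

open Classical in
lemma inner_g_facetPoint (F : Frame K v) (i k : Fin (n + 1)) (η : ℝ) :
    inner ℝ (F.g k) (facetPoint (K.erase (v + F.e i)) v η - v) = if k = i then 0 else η := by
  rw [facetPoint, add_sub_cancel_left, inner_smul_right, inner_sum]
  split_ifs with h
  · subst h
    rw [Finset.sum_eq_zero fun a ha => F.inner_g_of_mem_erase k ha, mul_zero]
  · rw [Finset.sum_eq_single (v + F.e k)]
    · simp [F.dual]
    · intro a ha hak
      refine F.inner_g_of_mem_erase k (Finset.mem_erase.mpr ⟨hak, Finset.mem_of_mem_erase ha⟩)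
    · intro hk
      exact absurd (Finset.mem_erase.mpr ⟨fun h' => h (F.e_injective (add_left_cancel h')),
        F.add_e_mem k⟩) hk

open Classical in
lemma facetPoint_mem_facetNhd (F : Frame K v) (i : Fin (n + 1)) {η : ℝ} (h0 : 0 < η)
    (h1 : (n + 1) * η < 1) : facetPoint (K.erase (v + F.e i)) v η ∈ F.facetNhd i := by
  refine ⟨fun k hk => ?_, ?_⟩
  · rw [F.inner_g_facetPoint, if_neg hk]; exact h0
  · simp only [F.inner_g_facetPoint]
    refine lt_of_le_of_lt (Finset.sum_le_sum (g := fun _ => η) fun k _ => ?_) (by simpa using h1)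
    split_ifs
    · exact h0.le
    · exact le_rfl

open Classical in
/-- A face which contains a point of the relative interior of a facet contains the facet. -/
lemma erase_subset_of_mem_body (F : Frame K v) (hK : K ∈ T.faces) (hK' : K' ∈ T.faces)
    {i : Fin (n + 1)} {x : Space (n + 1)} (hx : x ∈ F.facetNhd i)
    (h0 : 0 ≤ inner ℝ (F.g i) (x - v)) (hx' : x ∈ body K') : K.erase (v + F.e i) ⊆ K' := by
  have hmem : x ∈ convexHull ℝ ((K : Set (Space (n + 1))) ∩ K') :=
    T.inter_subset_convexHull hK hK' ⟨F.mem_body_of_mem_facetNhd hx h0, hx'⟩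
  intro a ha
  -- By conformity x lies in the hull of the common vertices. If a facet vertex were not common, its
  -- barycentric coordinate would vanish on that hull, but it is positive at x. For the vertex v
  -- this coordinate is 1 minus the sum of the others.
  by_contra hna
  rcases (F.mem_erase_iff i a).mp ha with rfl | ⟨j, rfl⟩
  · have hsub : (K : Set (Space (n + 1))) ∩ K'
        ⊆ {y | ∑ k, inner ℝ (F.g k) (y - a) = 1} := by
      rintro y ⟨hy, hy'⟩
      rcases F.eq_or_eq_of_mem (Finset.mem_coe.mp hy) with rfl | ⟨k, rfl⟩
      · exact absurd hy' hna
      · simp [F.dual]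
    have hconv : Convex ℝ {y | ∑ k, inner ℝ (F.g k) (y - a) = 1} := by
      intro y hy z hz s t _ _ hst
      simp only [Set.mem_ofPred_eq] at *
      have : ∀ k, inner ℝ (F.g k) (s • y + t • z - a)
          = s * inner ℝ (F.g k) (y - a) + t * inner ℝ (F.g k) (z - a) := fun k => by
        rw [← inner_smul_right, ← inner_smul_right, ← inner_add_right]
        congr 1
        have : a = (s + t) • a := by rw [hst, one_smul]
        nth_rw 1 [this]
        module
      simp only [this, Finset.sum_add_distrib, ← Finset.mul_sum, hy, hz]
      linarith
    exact hx.2.ne (convexHull_min hsub hconv hmem)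
  · set k := i.succAbove j with hk
    have hsub : (K : Set (Space (n + 1))) ∩ K' ⊆ {y | inner ℝ (F.g k) (y - v) = 0} := by
      rintro y ⟨hy, hy'⟩
      refine F.inner_g_of_mem_erase k (Finset.mem_erase.mpr ⟨?_, hy⟩)
      rintro rfl
      exact hna hy'
    exact (hx.1 k (Fin.succAbove_ne i j)).ne'
      (convexHull_min hsub (convex_inner_sub_eq_zero _ _) hmem)

open Classical in
lemma card_erase (F : Frame K v) (hK : T.IsElement K) (i : Fin (n + 1)) :
    (K.erase (v + F.e i)).card = n + 1 := by
  rw [Finset.card_erase_of_mem (F.add_e_mem i), hK.2]; rfl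

open Classical in
lemma inter_eq_erase (F : Frame K v) (hK : T.IsElement K) (hK' : T.IsElement K') (hne : K' ≠ K)
    {i : Fin (n + 1)} (h : K.erase (v + F.e i) ⊆ K') : K ∩ K' = K.erase (v + F.e i) := by
  symm
  refine Finset.eq_of_subset_of_card_le
    (Finset.subset_inter (Finset.erase_subset _ _) h) ?_
  rw [F.card_erase hK i]
  by_contra! hlt
  have h1 : K ∩ K' = K := Finset.eq_of_subset_of_card_le Finset.inter_subset_left (by
    rw [hK.2]; omega)
  have h2 : K ⊆ K' := Finset.inter_eq_left.mp h1
  exact hne (Finset.eq_of_subset_of_card_le h2 (by rw [hK.2, hK'.2])).symm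

open Classical in
lemma exists_inter_eq_erase (F : Frame K v) (hK : T.IsElement K) (hv' : v ∈ K')
    (hc : (K ∩ K').card = n + 1) : ∃ i, K ∩ K' = K.erase (v + F.e i) := by
  have h1 : (K \ K').card = 1 := by
    have := Finset.card_sdiff_add_card_inter K K'
    rw [hK.2] at this
    omega
  obtain ⟨a, ha⟩ := Finset.card_eq_one.mp h1
  have haK : a ∈ K \ K' := by rw [ha]; simp
  obtain ⟨haK, haK'⟩ := Finset.mem_sdiff.mp haK
  rcases F.eq_or_eq_of_mem haK with rfl | ⟨i, rfl⟩
  · exact absurd hv' haK'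
  · refine ⟨i, Finset.eq_of_subset_of_card_le (fun b hb => ?_) (by rw [hc, F.card_erase hK])⟩
    obtain ⟨hb, hb'⟩ := Finset.mem_inter.mp hb
    exact Finset.mem_erase.mpr ⟨by rintro rfl; exact haK' hb', hb⟩

open Classical in
/-- Two elements with a common facet lie on different sides of it. -/
lemma inner_g_neg_of_inter_eq_erase (F : Frame K v) (hK : T.IsElement K) (hK' : T.IsElement K')
    {i : Fin (n + 1)} (h : K ∩ K' = K.erase (v + F.e i)) (F' : Frame K' v) {i' : Fin (n + 1)}
    (h' : K ∩ K' = K'.erase (v + F'.e i')) : inner ℝ (F.g i) (F'.e i') < 0 := by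
  -- Suppose both elements lie on the same side. Starting inside the common facet and moving towards
  -- the opposite vertex of K', one stays in K for a short while, hence in K ∩ K'. By conformity
  -- that is the common facet, yet the i'-th coordinate on K' has become positive.
  by_contra! hnn
  set x₀ := facetPoint (K.erase (v + F.e i)) v (1 / (n + 2)) with hx₀
  have hpos : (0 : ℝ) < 1 / (n + 2) := by positivity
  have hlt : ((n : ℝ) + 1) * (1 / (n + 2)) < 1 := by
    rw [mul_one_div, div_lt_one (by positivity)]; linarith
  have hx₀N : x₀ ∈ F.facetNhd i := F.facetPoint_mem_facetNhd i hpos hlt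
  have hx₀i : inner ℝ (F.g i) (x₀ - v) = 0 := by
    rw [hx₀, F.inner_g_facetPoint, if_pos rfl]
  have hx₀' : inner ℝ (F'.g i') (x₀ - v) = 0 := by
    rw [hx₀, ← h, h', F'.inner_g_facetPoint, if_pos rfl]
  have hx₀N' : x₀ ∈ F'.facetNhd i' := by
    rw [hx₀, ← h, h']; exact F'.facetPoint_mem_facetNhd i' hpos hlt
  have hx₀K' : x₀ ∈ body K' := F'.mem_body_of_mem_facetNhd hx₀N' hx₀'.ge
  let γ : ℝ → Space (n + 1) := fun ε => x₀ + ε • (v + F'.e i' - x₀)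
  have hγ : Continuous γ := by fun_prop
  have hev : ∀ᶠ ε in nhdsWithin (0 : ℝ) (Set.Ioi 0), γ ε ∈ F.facetNhd i :=
    (hγ.tendsto 0).mono_left nhdsWithin_le_nhds
      ((F.isOpen_facetNhd i).mem_nhds (by simpa [γ] using hx₀N))
  obtain ⟨ε, hεN, hε0, hε1⟩ := (hev.and (Ioo_mem_nhdsGT (zero_lt_one' ℝ))).exists
  have hsplit : γ ε - v = (1 - ε) • (x₀ - v) + ε • F'.e i' := by simp only [γ]; module
  have hγi : 0 ≤ inner ℝ (F.g i) (γ ε - v) := by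
    rw [hsplit, inner_add_right, inner_smul_right, inner_smul_right, hx₀i, mul_zero, zero_add]
    exact mul_nonneg hε0.le hnn
  have hγK' : γ ε ∈ body K' := by
    have := (convex_convexHull ℝ (K' : Set (Space (n + 1)))) hx₀K'
      (Frame.mem_body_of_mem (F'.add_e_mem i')) (sub_nonneg.mpr hε1.le) hε0.le
      (sub_add_cancel 1 ε)
    convert! this using 1
    simp only [γ]; module
  have hmem : γ ε ∈ convexHull ℝ ((K : Set (Space (n + 1))) ∩ K') :=
    T.inter_subset_convexHull hK.1 hK'.1 ⟨F.mem_body_of_mem_facetNhd hεN hγi, hγK'⟩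
  have hsub : (K : Set (Space (n + 1))) ∩ K' ⊆ {y | inner ℝ (F'.g i') (y - v) = 0} := by
    rintro y hy
    refine F'.inner_g_of_mem_erase i' ?_
    rw [← h']
    exact_mod_cast hy
  have h0 : inner ℝ (F'.g i') (γ ε - v) = 0 :=
    convexHull_min hsub (convex_inner_sub_eq_zero _ _) hmem
  rw [hsplit, inner_add_right, inner_smul_right, inner_smul_right, hx₀', F'.dual, if_pos rfl] at h0
  linarith

open Classical in
-- g_i annihilates every edge of K' from v that lies in the common facet, so only the component
-- along the remaining edge survives.
lemma inner_g_eq_mul (F : Frame K v) {i : Fin (n + 1)} (h : K ∩ K' = K.erase (v + F.e i))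
    (F' : Frame K' v) {i' : Fin (n + 1)} (h' : K ∩ K' = K'.erase (v + F'.e i'))
    (x : Space (n + 1)) :
    inner ℝ (F.g i) x = inner ℝ (F'.g i') x * inner ℝ (F.g i) (F'.e i') := by
  conv_lhs => rw [F'.expand x, inner_sum]
  rw [Finset.sum_eq_single i', inner_smul_right]
  · intro k _ hk
    have h1 : v + F'.e k ∈ K.erase (v + F.e i) := by
      rw [← h, h']
      exact Finset.mem_erase.mpr ⟨fun h' => hk (F'.e_injective (add_left_cancel h')),
        F'.add_e_mem k⟩
    have h2 := F.inner_g_of_mem_erase i h1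
    rw [add_sub_cancel_left] at h2
    rw [inner_smul_right, h2, mul_zero]
  · simp

open Classical in
/-- A facet belongs to at most two elements. -/
lemma eq_of_inter_eq_erase (F : Frame K v) (hK : T.IsElement K) {K₁ K₂ : Finset (Space (n + 1))}
    (hK₁ : T.IsElement K₁) (hK₂ : T.IsElement K₂) {i : Fin (n + 1)}
    (h₁ : K ∩ K₁ = K.erase (v + F.e i)) (h₂ : K ∩ K₂ = K.erase (v + F.e i)) : K₁ = K₂ := by
  by_contra hne
  have hvK : v ∈ K.erase (v + F.e i) := Finset.mem_erase.mpr ⟨(F.add_e_ne i).symm, F.mem⟩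
  have hv₁ : v ∈ K₁ := by rw [← h₁] at hvK; exact (Finset.mem_inter.mp hvK).2
  have hv₂ : v ∈ K₂ := by rw [← h₂] at hvK; exact (Finset.mem_inter.mp hvK).2
  obtain ⟨F₁⟩ := nonempty_of_isElement hK₁ hv₁
  obtain ⟨F₂⟩ := nonempty_of_isElement hK₂ hv₂
  have hc := F.card_erase hK i
  obtain ⟨i₁, h₁'⟩ := F₁.exists_inter_eq_erase hK₁ F.mem (by rw [Finset.inter_comm, h₁, hc])
  obtain ⟨i₂, h₂'⟩ := F₂.exists_inter_eq_erase hK₂ F.mem (by rw [Finset.inter_comm, h₂, hc])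
  rw [Finset.inter_comm] at h₁' h₂'
  have hsub₁ : K₁.erase (v + F₁.e i₁) ⊆ K₂ := by
    rw [← h₁', h₁, ← h₂]; exact Finset.inter_subset_right
  have hsub₂ : K₂.erase (v + F₂.e i₂) ⊆ K₁ := by
    rw [← h₂', h₂, ← h₁]; exact Finset.inter_subset_right
  have h12 := F₁.inter_eq_erase hK₁ hK₂ (Ne.symm hne) hsub₁
  have h21 := F₂.inter_eq_erase hK₂ hK₁ hne hsub₂
  rw [Finset.inter_comm] at h21
  have e1 := F.inner_g_neg_of_inter_eq_erase hK hK₁ h₁ F₁ h₁'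
  have e2 := F.inner_g_neg_of_inter_eq_erase hK hK₂ h₂ F₂ h₂'
  have e3 := F₁.inner_g_neg_of_inter_eq_erase hK₁ hK₂ h12 F₂ h21
  -- Three elements cannot lie pairwise on opposite sides of one facet: a negative number would be
  -- the product of two negative ones.
  have e4 := F.inner_g_eq_mul h₁ F₁ h₁' (F₂.e i₂)
  nlinarith

lemma exists_facetPoint_mem (A : Finset (Space (n + 1))) {U : Set (Space (n + 1))}
    (hU : U ∈ nhds v) : ∃ η : ℝ, 0 < η ∧ (n + 1) * η < 1 ∧ facetPoint A v η ∈ U := by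
  have h1 : ∀ᶠ η in nhdsWithin (0 : ℝ) (Set.Ioi 0), facetPoint A v η ∈ U := by
    refine ((continuous_facetPoint A v).tendsto 0).mono_left nhdsWithin_le_nhds ?_
    simpa [facetPoint] using hU
  have hpos : (0 : ℝ) < 1 / (n + 2) := by positivity
  obtain ⟨η, hη, h0, hlt⟩ := (h1.and (Ioo_mem_nhdsGT hpos)).exists
  refine ⟨η, h0, ?_, hη⟩
  have := (lt_div_iff₀ (by positivity)).mp hlt
  nlinarith

lemma isClosed_iUnion_body (T : Mesh (n + 1)) (s : Set (Finset (Space (n + 1))))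
    (hs : ∀ K ∈ s, T.IsElement K) : IsClosed (⋃ K ∈ s, body K) := by
  have hf : LocallyFinite fun L : s => body (L : Finset (Space (n + 1))) :=
    T.locallyFinite.comp_injective (g := fun L : s => (⟨L, (hs L L.2).1⟩ : T.faces))
      fun a b hab => Subtype.ext (Subtype.mk.inj hab)
  rw [Set.biUnion_eq_iUnion]
  exact hf.isClosed_iUnion fun L => (isCompact_body _).isClosed

open Classical in
/-- Every facet which contains an interior vertex belongs to a second element. -/
lemma exists_neighbour (F : Frame K v) (hK : T.IsElement K) (hv : v ∈ interior T.domain)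
    (i : Fin (n + 1)) : ∃ K', T.IsElement K' ∧ K' ≠ K ∧ K ∩ K' = K.erase (v + F.e i) := by
  obtain ⟨η, h0, h1, hη⟩ := exists_facetPoint_mem (K.erase (v + F.e i))
    (isOpen_interior.mem_nhds hv)
  set x := facetPoint (K.erase (v + F.e i)) v η with hx
  have hxN : x ∈ F.facetNhd i := F.facetPoint_mem_facetNhd i h0 h1
  have hxi : inner ℝ (F.g i) (x - v) = 0 := by rw [hx, F.inner_g_facetPoint, if_pos rfl]
  suffices ∃ K', (T.IsElement K' ∧ K' ≠ K) ∧ x ∈ body K' by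
    obtain ⟨K', ⟨hK', hne⟩, hxK'⟩ := this
    exact ⟨K', hK', hne, F.inter_eq_erase hK hK' hne
      (F.erase_subset_of_mem_body hK.1 hK'.1 hxN hxi.ge hxK')⟩
  -- Otherwise a small step from x along -e_i remains in the domain and avoids the closed union of
  -- the other elements. It then lies in K, although its i-th coordinate is negative.
  by_contra! hno
  have hcl := isClosed_iUnion_body T {K' | T.IsElement K' ∧ K' ≠ K} fun _ h => h.1
  have hU : interior T.domain ∩ (⋃ K' ∈ {K' | T.IsElement K' ∧ K' ≠ K}, body K')ᶜ ∈ nhds x := by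
    refine (isOpen_interior.inter hcl.isOpen_compl).mem_nhds ⟨hη, ?_⟩
    simp only [Set.mem_compl_iff, Set.mem_iUnion, not_exists]
    exact fun K' hK' => hno K' hK'
  have hev : ∀ᶠ ε in nhdsWithin (0 : ℝ) (Set.Ioi 0), x - ε • F.e i ∈
      interior T.domain ∩ (⋃ K' ∈ {K' | T.IsElement K' ∧ K' ≠ K}, body K')ᶜ := by
    have hc : Continuous fun ε : ℝ => x - ε • F.e i := by fun_prop
    refine (hc.tendsto 0).mono_left nhdsWithin_le_nhds ?_
    simpa using hU
  obtain ⟨ε, ⟨hεd, hεn⟩, hε0⟩ := (hev.and self_mem_nhdsWithin).exists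
  have hd := interior_subset hεd
  simp only [Mesh.domain, Set.mem_iUnion] at hd
  obtain ⟨K', hK', hεK'⟩ := hd
  by_cases hKK : K' = K
  · subst hKK
    have := ((F.mem_body_iff _).mp hεK').1 i
    rw [sub_right_comm, inner_sub_right, hxi, inner_smul_right, F.dual, if_pos rfl] at this
    have : 0 < ε := hε0
    linarith
  · exact hεn (Set.mem_biUnion (x := K') ⟨hK', hKK⟩ hεK')

end Frame

end Neighbours

/-! ### Normals and continuity of the normal flux -/

section Normals

variable {n : ℕ} {T : Mesh (n + 1)} {K K' : Finset (Space (n + 1))} {v : Space (n + 1)}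

lemma normal_swap {d : ℕ} (K K' : Finset (Space d)) : normal K' K = -normal K K' := by
  have h : barycenter K - barycenter K' = -(barycenter K' - barycenter K) := by abel
  have hi : (open Classical in K' ∩ K = K ∩ K') := Finset.inter_comm _ _
  simp only [normal, hi, h, map_neg, norm_neg, smul_neg]

namespace Frame

open Classical in
/-- The normal directed to the neighbouring element is the outward normal. -/
lemma normal_eq_nu (F : Frame K v) (hK : T.IsElement K) (hK' : T.IsElement K')
    {i : Fin (n + 1)} (h : K ∩ K' = K.erase (v + F.e i)) (F' : Frame K' v) {i' : Fin (n + 1)}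
    (h' : K ∩ K' = K'.erase (v + F'.e i')) : normal K K' = F.nu i := by
  have hg := norm_ne_zero_iff.mpr (F.g_ne_zero i)
  set b := barycenter K' - barycenter K with hb
  set W := vectorSpan ℝ ((K ∩ K' : Finset (Space (n + 1))) : Set (Space (n + 1))) with hW
  -- The barycenters lie on opposite sides of the facet; this fixes the direction of the normal.
  have hbneg : inner ℝ (F.g i) b < 0 := by
    have h1 : b = (barycenter K' - v) - (barycenter K - v) := by rw [hb]; abel
    have h2 : inner ℝ (F.g i) (barycenter K' - v)
        = 1 / ((n : ℝ) + 2) * inner ℝ (F.g i) (F'.e i') := by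
      rw [F.inner_g_eq_mul h F' h', F'.inner_g_barycenter]
    have h3 := F.inner_g_neg_of_inter_eq_erase hK hK' h F' h'
    have hpos : (0 : ℝ) < 1 / ((n : ℝ) + 2) := by positivity
    rw [h1, inner_sub_right, h2, F.inner_g_barycenter]
    nlinarith
  have hgW : F.g i ∈ Wᗮ := by
    rw [hW, vectorSpan_def, Submodule.mem_orthogonal]
    intro u hu
    induction hu using Submodule.span_induction with
    | mem x hx =>
      obtain ⟨a, ha, c, hc, rfl⟩ := hx
      rw [h] at ha hc
      have e1 := F.inner_g_of_mem_erase i ha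
      have e2 := F.inner_g_of_mem_erase i hc
      rw [real_inner_comm]
      change inner ℝ (F.g i) (a - c) = 0
      rw [show a - c = (a - v) - (c - v) by abel, inner_sub_right, e1, e2, sub_zero]
    | zero => simp
    | add x y _ _ hx hy => rw [inner_add_left, hx, hy, add_zero]
    | smul r x _ hx => rw [inner_smul_left, hx, mul_zero]
  -- The orthogonal complement of the facet is the line through g_i, so the projection in `normal`
  -- is a multiple of g_i.
  have hWg : ∀ z ∈ Wᗮ, z = inner ℝ z (F.e i) • F.g i := fun z hz => by
    refine ext_inner_right ℝ fun x => ?_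
    rw [inner_smul_left, conj_trivial]
    conv_lhs => rw [F.expand x, inner_sum]
    rw [Finset.sum_eq_single i, inner_smul_right, mul_comm]
    · intro k _ hk
      have hmem : F.e k ∈ W := by
        have h1 : v ∈ K ∩ K' := by
          rw [h]; exact Finset.mem_erase.mpr ⟨(F.add_e_ne i).symm, F.mem⟩
        have h2 : v + F.e k ∈ K ∩ K' := by
          rw [h]
          exact Finset.mem_erase.mpr ⟨fun h' => hk (F.e_injective (add_left_cancel h')),
            F.add_e_mem k⟩
        have := vsub_mem_vectorSpan ℝ (Finset.mem_coe.mpr h2) (Finset.mem_coe.mpr h1)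
        rwa [vsub_eq_sub, add_sub_cancel_left] at this
      rw [inner_smul_right, (Submodule.mem_orthogonal' _ _).mp hz _ hmem, mul_zero]
    · simp
  set c := inner ℝ (F.g i) b / ‖F.g i‖ ^ 2 with hc
  have hproj : Wᗮ.starProjection b = c • F.g i := by
    refine Submodule.eq_starProjection_of_mem_orthogonal (Submodule.smul_mem _ _ hgW) ?_
    rw [Submodule.mem_orthogonal]
    intro z hz
    rw [hWg z hz, inner_smul_left, inner_sub_right, inner_smul_right, real_inner_self_eq_norm_sq,
      hc]
    field_simp
    simp
  have hcneg : c < 0 := div_neg_of_neg_of_pos hbneg (by positivity)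
  have : normal K K' = ‖Wᗮ.starProjection b‖⁻¹ • Wᗮ.starProjection b := rfl
  rw [this, hproj, nu, norm_smul, Real.norm_of_nonpos hcneg.le, smul_smul, ← neg_smul]
  congr 1
  field_simp
  rw [div_self hcneg.ne]

/-- The second element at the `i`-th facet. -/
def nb (F : Frame K v) (hK : T.IsElement K) (hv : v ∈ interior T.domain) (i : Fin (n + 1)) :
    Finset (Space (n + 1)) :=
  (F.exists_neighbour hK hv i).choose

section

variable (F : Frame K v) (hK : T.IsElement K) (hv : v ∈ interior T.domain) (i : Fin (n + 1))

lemma isElement_nb : T.IsElement (F.nb hK hv i) := (F.exists_neighbour hK hv i).choose_spec.1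

open Classical in
lemma inter_nb : K ∩ F.nb hK hv i = K.erase (v + F.e i) :=
  (F.exists_neighbour hK hv i).choose_spec.2.2

lemma mem_nb : v ∈ F.nb hK hv i := by
  classical
  have hvK : v ∈ K.erase (v + F.e i) := Finset.mem_erase.mpr ⟨(F.add_e_ne i).symm, F.mem⟩
  rw [← F.inter_nb hK hv i] at hvK
  exact (Finset.mem_inter.mp hvK).2

lemma nb_mem_patch : F.nb hK hv i ∈ T.patch v := ⟨F.isElement_nb hK hv i, F.mem_nb hK hv i⟩

end

lemma nb_injective (F : Frame K v) (hK : T.IsElement K) (hv : v ∈ interior T.domain) :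
    Function.Injective (F.nb hK hv) := by
  classical
  intro i j hij
  have h1 := F.inter_nb hK hv i
  rw [hij, F.inter_nb hK hv j] at h1
  have : v + F.e i ∉ K.erase (v + F.e j) := by rw [h1]; simp
  rw [Finset.mem_erase, not_and'] at this
  exact F.e_injective (add_left_cancel (not_not.mp (this (F.add_e_mem i))))

open Classical in
lemma exists_nb_eq (F : Frame K v) (hK : T.IsElement K) (hv : v ∈ interior T.domain)
    (hK' : T.IsElement K') (hv' : v ∈ K') (hc : (K ∩ K').card = n + 1) :
    ∃ i, F.nb hK hv i = K' := by
  obtain ⟨i, hi⟩ := F.exists_inter_eq_erase hK hv' hc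
  exact ⟨i, F.eq_of_inter_eq_erase hK (F.isElement_nb hK hv i) hK' (F.inter_nb hK hv i) hi⟩

open Classical in
lemma normal_nb (F : Frame K v) (hK : T.IsElement K) (hv : v ∈ interior T.domain)
    (i : Fin (n + 1)) : normal K (F.nb hK hv i) = F.nu i := by
  obtain ⟨F'⟩ := nonempty_of_isElement (F.isElement_nb hK hv i) (F.mem_nb hK hv i)
  obtain ⟨i', h'⟩ := F'.exists_inter_eq_erase (F.isElement_nb hK hv i) F.mem
    (by rw [Finset.inter_comm, F.inter_nb hK hv i, F.card_erase hK])
  rw [Finset.inter_comm] at h'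
  exact F.normal_eq_nu hK (F.isElement_nb hK hv i) (F.inter_nb hK hv i) F' h'

open Classical in
/-- Sums over the neighbours of an element in the patch are sums over its facets. -/
lemma sum_patch_eq (F : Frame K v) (hK : T.IsElement K) (hv : v ∈ interior T.domain)
    (f : T.patch v → ℝ) :
    ∑ K' : T.patch v, (if (K ∩ (K' : Finset (Space (n + 1)))).card = n + 1 then f K' else 0)
      = ∑ i, f ⟨F.nb hK hv i, F.nb_mem_patch hK hv i⟩ := by
  rw [← Finset.sum_filter]
  symm
  refine Finset.sum_bij (fun i _ => ⟨F.nb hK hv i, F.nb_mem_patch hK hv i⟩) (fun i _ => ?_)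
    (fun i _ j _ h => F.nb_injective hK hv (congrArg Subtype.val h)) (fun K' h => ?_)
    (fun _ _ => rfl)
  · simp only [Finset.mem_filter, Finset.mem_univ, true_and]
    rw [F.inter_nb hK hv i, F.card_erase hK]
  · simp only [Finset.mem_filter, Finset.mem_univ, true_and] at h
    obtain ⟨i, hi⟩ := F.exists_nb_eq hK hv K'.2.1 K'.2.2 h
    exact ⟨i, Finset.mem_univ i, Subtype.ext hi⟩

open Classical in
/-- The integral of a partial derivative of a test function supported near the `i`-th facet. -/
lemma setIntegral_fderiv_of_tsupport (F : Frame K v) {ψ : Space (n + 1) → ℝ}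
    (hψ : ContDiff ℝ ∞ ψ) {i : Fin (n + 1)} (hsupp : tsupport ψ ⊆ F.facetNhd i)
    (j : Fin (n + 1)) :
    ∫ x in body K, fderiv ℝ ψ x (EuclideanSpace.single j 1)
      = F.nu i j * ∫ x in body (K.erase (v + F.e i)), ψ x ∂μHE[n] := by
  have h0 : ∀ x, x ∉ F.facetNhd i → ψ x = 0 := fun x hx =>
    image_eq_zero_of_notMem_tsupport fun h => hx (hsupp h)
  rw [F.setIntegral_fderiv (hψ.of_le (by exact_mod_cast le_top))
    (fun x _ hx => h0 x fun h => h.2.ne hx), Finset.sum_eq_single i]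
  · intro k _ hk
    rw [setIntegral_eq_zero_of_forall_eq_zero, mul_zero]
    intro x hx
    refine h0 x fun h => (h.1 k hk).ne' ?_
    refine convexHull_min (s := (K.erase (v + F.e k) : Finset (Space (n + 1))))
      (fun a ha => ?_) (convex_inner_sub_eq_zero (F.g k) v) hx
    exact F.inner_g_of_mem_erase k ha
  · simp

open Classical in
/-- The normal flux is continuous across the facets which contain the interior vertex `v`. -/
lemma flux_nu_eq {b : ℕ} {c : Coefficients (n + 1) b} {g₀ Λ cw : ℝ}
    (hc : c.Admissible T g₀ Λ cw) (F : Frame K v) (hK : T.IsElement K)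
    (hv : v ∈ interior T.domain) (hK' : T.IsElement K') {i : Fin (n + 1)}
    (h : K ∩ K' = K.erase (v + F.e i)) (F' : Frame K' v) {i' : Fin (n + 1)}
    (h' : K ∩ K' = K'.erase (v + F'.e i')) : c.flux K (F.nu i) = c.flux K' (F.nu i) := by
  have hne : K ≠ K' := by
    rintro rfl
    rw [Finset.inter_self] at h
    exact Finset.notMem_erase (v + F.e i) K (h ▸ F.add_e_mem i)
  obtain ⟨η, h0, h1, hη⟩ := exists_facetPoint_mem (K ∩ K') (isOpen_interior.mem_nhds hv)
  set x := facetPoint (K ∩ K') v η with hx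
  have hxN : x ∈ F.facetNhd i := by rw [hx, h]; exact F.facetPoint_mem_facetNhd i h0 h1
  have hxN' : x ∈ F'.facetNhd i' := by rw [hx, h']; exact F'.facetPoint_mem_facetNhd i' h0 h1
  have hxi : inner ℝ (F.g i) (x - v) = 0 := by rw [hx, h, F.inner_g_facetPoint, if_pos rfl]
  -- A point inside the facet has a neighbourhood that meets no third element. A bump function
  -- supported there reduces the weak divergence to the two terms of this facet.
  set s : Set (Finset (Space (n + 1))) := {L | T.IsElement L ∧ L ≠ K ∧ L ≠ K'} with hs
  have hcl := isClosed_iUnion_body T s fun _ h => h.1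
  have hU : ((interior T.domain ∩ (⋃ L ∈ s, body L)ᶜ) ∩ (F.facetNhd i ∩ F'.facetNhd i'))
      ∈ nhds x := by
    refine ((isOpen_interior.inter hcl.isOpen_compl).inter
      ((F.isOpen_facetNhd i).inter (F'.isOpen_facetNhd i'))).mem_nhds ⟨⟨hη, ?_⟩, hxN, hxN'⟩
    simp only [Set.mem_compl_iff, Set.mem_iUnion, not_exists]
    rintro L ⟨hL, hLK, hLK'⟩ hxL
    have h2 := F.inter_eq_erase hK hL hLK
      (F.erase_subset_of_mem_body hK.1 hL.1 hxN hxi.ge hxL)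
    exact hLK' (F.eq_of_inter_eq_erase hK hL hK' h2 h)
  obtain ⟨ψ, hψs, hψc, hψd, hψr, hψx⟩ := exists_contDiff_tsupport_subset (n := ⊤) hU
  have hψ0 : ∀ y, 0 ≤ ψ y := fun y => (hψr ⟨y, rfl⟩).1
  have hsF : tsupport ψ ⊆ F.facetNhd i := fun y hy => (hψs hy).2.1
  have hsF' : tsupport ψ ⊆ F'.facetNhd i' := fun y hy => (hψs hy).2.2
  set I := ∫ y in body (K.erase (v + F.e i)), ψ y ∂μHE[n] with hI
  -- The integral of the bump over the facet must be nonzero, since the jump of the flux is obtained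
  -- by dividing by it.
  have hIpos : 0 < I := by
    rw [hI, F.setIntegral_facet]
    refine mul_pos (mul_pos F.vol_pos (norm_pos_iff.mpr (F.g_ne_zero i))) ?_
    have hcont : Continuous fun y : Space n => ψ (simplexMap v F.e (insertCoord i 0 y)) := by
      refine hψd.continuous.comp ((continuous_simplexMap v F.e).comp ?_)
      refine (PiLp.continuous_toLp 2 _).comp ?_
      exact Continuous.finInsertNth i continuous_const (PiLp.continuous_ofLp 2 _)
    have hsub : (Function.support fun y : Space n => ψ (simplexMap v F.e (insertCoord i 0 y)))
        ⊆ refSimplex n := fun y hy => by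
      have hmem := hsF (subset_tsupport ψ hy)
      have h2 : ∀ k, 0 < y k := fun k => by
        have := hmem.1 (i.succAbove k) (Fin.succAbove_ne i k)
        rw [F.inner_g_simplexMap] at this
        simpa [insertCoord] using this
      have h3 := hmem.2
      simp only [F.inner_g_simplexMap] at h3
      refine ⟨fun k => (h2 k).le, ?_⟩
      simpa [insertCoord, Fin.sum_univ_succAbove _ i] using h3.le
    have hne : (Function.support fun y : Space n =>
        ψ (simplexMap v F.e (insertCoord i 0 y))).Nonempty := by
      refine ⟨WithLp.toLp 2 fun _ => η, ?_⟩
      have hpt : simplexMap v F.e (insertCoord i 0 (WithLp.toLp 2 fun _ => η)) = x := by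
        rw [← F.simplexMap_inner_g x]
        congr 1
        ext k
        simp only [hx, h, F.inner_g_facetPoint]
        refine Fin.succAboveCases i ?_ (fun k => ?_) k
        · simp [insertCoord]
        · simp [insertCoord, Fin.succAbove_ne]
      rw [Function.mem_support, hpt, hψx]
      exact one_ne_zero
    refine (setIntegral_pos_iff_support_of_nonneg_ae (.of_forall fun y => hψ0 _)
      (hcont.continuousOn.integrableOn_compact (isCompact_refSimplex n))).mpr ?_
    rw [Set.inter_eq_left.mpr hsub]
    exact (hcont.isOpen_support).measure_pos volume hne
  have hint : ∀ j, ∫ y in body K, fderiv ℝ ψ y (EuclideanSpace.single j 1) = F.nu i j * I :=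
    fun j => F.setIntegral_fderiv_of_tsupport hψd hsF j
  have hint' : ∀ j, ∫ y in body K', fderiv ℝ ψ y (EuclideanSpace.single j 1)
      = -(F.nu i j * I) := fun j => by
    have h2 : F'.nu i' = -F.nu i := by
      rw [← F.normal_eq_nu hK hK' h F' h', ← normal_swap]
      rw [Finset.inter_comm] at h h'
      exact (F'.normal_eq_nu hK' hK h' F h).symm
    rw [F'.setIntegral_fderiv_of_tsupport hψd hsF' j, ← h', h, h2, PiLp.neg_apply, neg_mul]
  ext a d
  have hdiv := hc.divFree ψ hψd hψc (fun y hy => (hψs hy).1.1) a d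
  rw [finsum_mem_eq_sum_of_inter_support_eq (t := {K, K'})] at hdiv
  · rw [Finset.sum_pair hne] at hdiv
    simp only [hint, hint'] at hdiv
    -- The outward normals of the two elements are opposite, so the weak divergence is I times the
    -- jump of the normal flux.
    have h3 : (∑ j, F.nu i j * c.L j K a d) * I = (∑ j, F.nu i j * c.L j K' a d) * I := by
      rw [Finset.sum_mul, Finset.sum_mul, ← sub_eq_zero, ← hdiv, ← Finset.sum_sub_distrib,
        ← Finset.sum_add_distrib]
      exact Finset.sum_congr rfl fun j _ => by ring
    have h4 := mul_right_cancel₀ hIpos.ne' h3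
    simpa [Coefficients.flux, Matrix.sum_apply] using h4
  · ext L
    simp only [Set.mem_inter_iff, Finset.coe_pair, Set.mem_insert_iff, Set.mem_singleton_iff]
    refine and_congr_left fun hL => ⟨fun hLe => ?_, ?_⟩
    · by_contra! hLn
      apply hL
      refine Finset.sum_eq_zero fun j _ => ?_
      rw [setIntegral_eq_zero_of_forall_eq_zero, mul_zero]
      intro y hy
      have hyn : y ∉ tsupport ψ := fun hyt =>
        (hψs hyt).1.2 (Set.mem_biUnion (x := L) ⟨hLe, hLn⟩ hy)
      have : fderiv ℝ ψ y = 0 := by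
        by_contra hne
        exact hyn (support_fderiv_subset ℝ hne)
      rw [this]; rfl
    · rintro (rfl | rfl)
      · exact hK
      · exact hK'

end Frame

end Normals

/-! ### Elementwise constant operators on the discontinuous Galerkin space -/

section MatrixBounds

variable {b : ℕ} {B : Matrix (Fin b) (Fin b) ℝ} {e : ℝ}

lemma mulVec_dotProduct_self_le (hB : ∀ i k, |B i k| ≤ e) (y : Fin b → ℝ) :
    (B.mulVec y) ⬝ᵥ (B.mulVec y) ≤ (b * e) ^ 2 * (y ⬝ᵥ y) := by
  have h1 : ∀ i, (B.mulVec y i) ^ 2 ≤ b * (e ^ 2 * (y ⬝ᵥ y)) := fun i => by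
    have h2 := sq_sum_le_card_mul_sum_sq (s := Finset.univ) (f := fun k => B i k * y k)
    rw [Finset.card_univ, Fintype.card_fin] at h2
    refine h2.trans (mul_le_mul_of_nonneg_left ?_ (Nat.cast_nonneg b))
    rw [dotProduct, Finset.mul_sum]
    refine Finset.sum_le_sum fun k _ => ?_
    rw [mul_pow, ← sq_abs (B i k), ← sq (y k)]
    have := abs_nonneg (B i k)
    gcongr
    exact hB i k
  calc _ = ∑ i, (B.mulVec y i) ^ 2 := Finset.sum_congr rfl fun i _ => (sq _).symm
    _ ≤ ∑ _i : Fin b, b * (e ^ 2 * (y ⬝ᵥ y)) := Finset.sum_le_sum fun i _ => h1 i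
    _ = _ := by rw [Finset.sum_const, Finset.card_univ, Fintype.card_fin, nsmul_eq_mul]; ring

lemma two_mul_abs_dotProduct_mulVec_le (hB : ∀ i k, |B i k| ≤ e) (x y : Fin b → ℝ) :
    2 * |x ⬝ᵥ B.mulVec y| ≤ x ⬝ᵥ x + (b * e) ^ 2 * (y ⬝ᵥ y) := by
  have h1 := mulVec_dotProduct_self_le hB y
  have h2 : ∀ z : Fin b → ℝ, 0 ≤ z ⬝ᵥ z := fun z =>
    Finset.sum_nonneg fun i _ => mul_self_nonneg _
  have h3 := h2 (x - B.mulVec y)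
  have h4 := h2 (x + B.mulVec y)
  simp only [sub_dotProduct, dotProduct_sub, add_dotProduct, dotProduct_add,
    dotProduct_comm (B.mulVec y) x] at h3 h4
  rcases abs_cases (x ⬝ᵥ B.mulVec y) with ⟨h, -⟩ | ⟨h, -⟩ <;> rw [h] <;> linarith

end MatrixBounds

section Elementwise

variable {d b p : ℕ} {T : Mesh d} {v : Space d}

/-- The value of a polynomial vector at a point. -/
def evalVec (x : Space d) (w : Fin b → MvPolynomial (Fin d) ℝ) : Fin b → ℝ :=
  fun i => eval x.ofLp (w i)

lemma evalVec_add (x : Space d) (w z : Fin b → MvPolynomial (Fin d) ℝ) :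
    evalVec x (w + z) = evalVec x w + evalVec x z := by
  ext i; simp [evalVec]

lemma evalVec_sub (x : Space d) (w z : Fin b → MvPolynomial (Fin d) ℝ) :
    evalVec x (w - z) = evalVec x w - evalVec x z := by
  ext i; simp [evalVec]

lemma evalVec_smul (x : Space d) (r : ℝ) (w : Fin b → MvPolynomial (Fin d) ℝ) :
    evalVec x (r • w) = r • evalVec x w := by
  ext i; simp [evalVec, smul_eval]

lemma evalVec_act (x : Space d) (B : Matrix (Fin b) (Fin b) ℝ)
    (w : Fin b → MvPolynomial (Fin d) ℝ) : evalVec x (act B w) = B.mulVec (evalVec x w) := by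
  ext i; simp [evalVec, act, Matrix.mulVec, dotProduct, smul_eval]

lemma eval_dot (x : Space d) (w z : Fin b → MvPolynomial (Fin d) ℝ) :
    eval x.ofLp (dot w z) = evalVec x w ⬝ᵥ evalVec x z := by
  simp [dot, evalVec, dotProduct]

lemma dot_comm (w z : Fin b → MvPolynomial (Fin d) ℝ) : dot w z = dot z w :=
  Finset.sum_congr rfl fun _ _ => mul_comm _ _

lemma act_mul (B B' : Matrix (Fin b) (Fin b) ℝ) (w : Fin b → MvPolynomial (Fin d) ℝ) :
    act (B * B') w = act B (act B' w) := by
  ext1 i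
  simp only [act, Matrix.mul_apply, Finset.sum_smul, Finset.smul_sum, smul_smul]
  exact Finset.sum_comm

lemma sum_act {ι : Type*} (s : Finset ι) (B : ι → Matrix (Fin b) (Fin b) ℝ)
    (w : Fin b → MvPolynomial (Fin d) ℝ) : act (∑ a ∈ s, B a) w = ∑ a ∈ s, act (B a) w := by
  ext1 i
  simp only [act, Matrix.sum_apply, Finset.sum_smul, Finset.sum_apply]
  exact Finset.sum_comm

lemma smul_act (r : ℝ) (B : Matrix (Fin b) (Fin b) ℝ) (w : Fin b → MvPolynomial (Fin d) ℝ) :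
    act (r • B) w = r • act B w := by
  ext1 i; simp [act, Finset.smul_sum, smul_smul]

lemma dot_act_comm {B : Matrix (Fin b) (Fin b) ℝ} (hB : B.IsSymm)
    (w z : Fin b → MvPolynomial (Fin d) ℝ) : dot (act B w) z = dot (act B z) w := by
  simp only [dot, act, Finset.sum_mul]
  rw [Finset.sum_comm]
  refine Finset.sum_congr rfl fun i _ => Finset.sum_congr rfl fun k _ => ?_
  rw [hB.apply i k, smul_mul_assoc, smul_mul_assoc, mul_comm]

lemma elemInt_mono {K : Finset (Space d)} {P Q : MvPolynomial (Fin d) ℝ}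
    (h : ∀ x ∈ body K, eval x.ofLp P ≤ eval x.ofLp Q) : elemInt K 1 P ≤ elemInt K 1 Q := by
  have hf := (isCompact_body K).measure_lt_top (μ := volume)
  exact setIntegral_mono_on (integrableOn_body _ K hf continuousOn_const P)
    (integrableOn_body _ K hf continuousOn_const Q) (isCompact_body K).isClosed.measurableSet
    fun x hx => by simpa using h x hx

lemma elemInt_sum {ι : Type*} {K : Finset (Space d)} {q : Space d → ℝ}
    (hq : ContinuousOn q (body K)) (s : Finset ι) (P : ι → MvPolynomial (Fin d) ℝ) :
    elemInt K q (∑ a ∈ s, P a) = ∑ a ∈ s, elemInt K q (P a) := by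
  classical
  induction s using Finset.induction_on with
  | empty => simp [elemInt]
  | insert a s ha ih => rw [Finset.sum_insert ha, Finset.sum_insert ha, elemInt_add hq, ih]

lemma ip_self (w : DG T v b p) :
    ip w w = ∑ K : T.patch v, ∑ l, elemInt (K : Finset (Space d)) 1 (on w K l ^ 2) := by
  rw [ip_apply]
  refine Finset.sum_congr rfl fun K _ => ?_
  rw [dot, elemInt_sum (q := 1) continuousOn_const]
  simp only [sq]

lemma ip_comm (w z : DG T v b p) : ip w z = ip z w := by
  simp only [ip_apply, dot_comm]

lemma ip_self_nonneg (w : DG T v b p) : 0 ≤ ip w w := by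
  rw [ip_apply]
  exact Finset.sum_nonneg fun K _ => elemInt_dot_self_nonneg _ _

lemma eq_of_ip_eq {w z : DG T v b p} (h : ∀ y, ip w y = ip z y) : w = z := by
  rw [← sub_eq_zero]
  by_contra hne
  have := ip_self_pos hne
  rw [LinearMap.map_sub₂, h, sub_self] at this
  exact lt_irrefl _ this

/-- The operator which acts on the element `K` as the constant matrix `B K`. -/
def actOp (B : Finset (Space d) → Matrix (Fin b) (Fin b) ℝ) : Module.End ℝ (DG T v b p) where
  toFun w K i := ∑ k, B K i k • w K k
  map_add' w z := by
    funext K i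
    simp [Finset.sum_add_distrib]
  map_smul' r w := by
    funext K i
    simp only [Pi.smul_apply, RingHom.id_apply, Finset.smul_sum]
    exact Finset.sum_congr rfl fun k _ => smul_comm _ _ _

lemma on_actOp (B : Finset (Space d) → Matrix (Fin b) (Fin b) ℝ) (w : DG T v b p)
    (K : T.patch v) : on (actOp B w) K = act (B K) (on w K) := by
  ext1 i
  simp [on, act, actOp]

lemma on_injective {w z : DG T v b p} (h : ∀ K, on w K = on z K) : w = z := by
  funext K i
  exact Subtype.ext (congrFun (h K) i)

lemma ip_actOp (B : Finset (Space d) → Matrix (Fin b) (Fin b) ℝ) (w z : DG T v b p) :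
    ip (actOp B w) z = massForm B w z := by
  simp [ip_apply, massForm, on_actOp]

/-- A constant matrix preserves the polynomial degree on each element, so no L² projection takes
place. -/
lemma opOf_massForm (B : Finset (Space d) → Matrix (Fin b) (Fin b) ℝ) :
    (opOf (massForm B) : Module.End ℝ (DG T v b p)) = actOp B :=
  LinearMap.ext fun w => eq_of_ip_eq fun z => by rw [ip_opOf, ip_actOp]

lemma actOp_mul (B B' : Finset (Space d) → Matrix (Fin b) (Fin b) ℝ) :
    (actOp B * actOp B' : Module.End ℝ (DG T v b p)) = actOp fun K => B K * B' K :=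
  LinearMap.ext fun w => on_injective fun K => by
    rw [Module.End.mul_apply, on_actOp, on_actOp, on_actOp, act_mul]

lemma actOp_eq_one {B : Finset (Space d) → Matrix (Fin b) (Fin b) ℝ}
    (h : ∀ K ∈ T.patch v, B K = 1) : (actOp B : Module.End ℝ (DG T v b p)) = 1 :=
  LinearMap.ext fun w => on_injective fun K => by
    rw [on_actOp, h K K.2, act_one]; rfl

lemma ip_actOp_comm {B : Finset (Space d) → Matrix (Fin b) (Fin b) ℝ}
    (hB : ∀ K ∈ T.patch v, (B K).IsSymm) (w z : DG T v b p) :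
    ip (actOp B w) z = ip w (actOp B z) := by
  rw [ip_comm w, ip_apply, ip_apply]
  refine Finset.sum_congr rfl fun K _ => ?_
  rw [on_actOp, on_actOp, dot_act_comm (hB K K.2)]

lemma le_ip_actOp_self {B : Finset (Space d) → Matrix (Fin b) (Fin b) ℝ} {m : ℝ}
    (hB : ∀ K ∈ T.patch v, ∀ y : Fin b → ℝ, m * (y ⬝ᵥ y) ≤ y ⬝ᵥ (B K).mulVec y)
    (w : DG T v b p) : m * ip w w ≤ ip (actOp B w) w := by
  rw [ip_apply, ip_apply, Finset.mul_sum]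
  refine Finset.sum_le_sum fun K _ => ?_
  rw [← elemInt_smul]
  refine elemInt_mono fun x _ => ?_
  rw [smul_eval, eval_dot, eval_dot, on_actOp, evalVec_act, dotProduct_comm (Matrix.mulVec _ _)]
  exact hB K K.2 _

lemma ip_actOp_self_le {B : Finset (Space d) → Matrix (Fin b) (Fin b) ℝ} {e : ℝ}
    (hB : ∀ K ∈ T.patch v, ∀ i k, |B K i k| ≤ e) (w : DG T v b p) :
    ip (actOp B w) (actOp B w) ≤ (b * e) ^ 2 * ip w w := by
  rw [ip_apply, ip_apply, Finset.mul_sum]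
  refine Finset.sum_le_sum fun K _ => ?_
  rw [← elemInt_smul]
  refine elemInt_mono fun x _ => ?_
  rw [smul_eval, eval_dot, eval_dot, on_actOp, evalVec_act]
  exact mulVec_dotProduct_self_le (hB K K.2) _

lemma isUnit_of_coercive {B : Matrix (Fin b) (Fin b) ℝ} {m : ℝ} (hm : 0 < m)
    (hB : ∀ y : Fin b → ℝ, m * (y ⬝ᵥ y) ≤ y ⬝ᵥ B.mulVec y) : IsUnit B := by
  rw [← Matrix.mulVec_injective_iff_isUnit]
  refine (injective_iff_map_eq_zero B.mulVecLin).mpr fun y hy => ?_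
  have h := hB y
  rw [show B.mulVec y = 0 from hy, dotProduct_zero] at h
  refine dotProduct_self_eq_zero.mp (le_antisymm (by nlinarith) ?_)
  exact Finset.sum_nonneg fun i _ => mul_self_nonneg _

section Inverse

variable {B : Finset (Space d) → Matrix (Fin b) (Fin b) ℝ} {m : ℝ}

lemma actOp_mul_inv (hm : 0 < m)
    (hB : ∀ K ∈ T.patch v, ∀ y : Fin b → ℝ, m * (y ⬝ᵥ y) ≤ y ⬝ᵥ (B K).mulVec y) :
    (actOp B * actOp fun K => (B K)⁻¹ : Module.End ℝ (DG T v b p)) = 1 := by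
  rw [actOp_mul]
  refine actOp_eq_one fun K hK => ?_
  exact Matrix.mul_nonsing_inv _ ((Matrix.isUnit_iff_isUnit_det _).mp
    (isUnit_of_coercive hm (hB K hK)))

lemma actOp_inv_mul (hm : 0 < m)
    (hB : ∀ K ∈ T.patch v, ∀ y : Fin b → ℝ, m * (y ⬝ᵥ y) ≤ y ⬝ᵥ (B K).mulVec y) :
    ((actOp fun K => (B K)⁻¹) * actOp B : Module.End ℝ (DG T v b p)) = 1 := by
  rw [actOp_mul]
  refine actOp_eq_one fun K hK => ?_
  exact Matrix.nonsing_inv_mul _ ((Matrix.isUnit_iff_isUnit_det _).mp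
    (isUnit_of_coercive hm (hB K hK)))

/-- `Ring.inverse` is 0 off the units; coercivity provides the unit, so the inverses in `opX` and
`opR` are genuine and act elementwise. -/
lemma inverse_actOp (hm : 0 < m)
    (hB : ∀ K ∈ T.patch v, ∀ y : Fin b → ℝ, m * (y ⬝ᵥ y) ≤ y ⬝ᵥ (B K).mulVec y) :
    Ring.inverse (actOp B : Module.End ℝ (DG T v b p)) = actOp fun K => (B K)⁻¹ :=
  Ring.inverse_unit (⟨actOp B, actOp fun K => (B K)⁻¹, actOp_mul_inv hm hB,
    actOp_inv_mul hm hB⟩ : (Module.End ℝ (DG T v b p))ˣ)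

end Inverse

end Elementwise

/-! ### Coercivity under the causality condition -/

section Causality

variable {d b : ℕ} {T : Mesh d} {c : Coefficients d b} {g₀ Λ cw : ℝ} {K : Finset (Space d)}

lemma Coefficients.flux_isSymm (hc : c.Admissible T g₀ Λ cw) (hK : T.IsElement K) (ξ : Space d) :
    (c.flux K ξ).IsSymm := by
  rw [Coefficients.flux, Matrix.IsSymm, Matrix.transpose_sum]
  refine Finset.sum_congr rfl fun j _ => ?_
  rw [Matrix.transpose_smul, hc.symm_L j K hK]

lemma Coefficients.flux_smul (r : ℝ) (ξ : Space d) : c.flux K (r • ξ) = r • c.flux K ξ := by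
  simp [Coefficients.flux, Finset.smul_sum, smul_smul]

lemma Coefficients.flux_add (ξ η : Space d) : c.flux K (ξ + η) = c.flux K ξ + c.flux K η := by
  simp [Coefficients.flux, add_smul, Finset.sum_add_distrib]

lemma Coefficients.flux_neg (ξ : Space d) : c.flux K (-ξ) = -c.flux K ξ := by
  simp [Coefficients.flux]

lemma Coefficients.abs_flux_le (hc : c.Admissible T g₀ Λ cw) (hK : T.IsElement K) (ξ : Space d)
    (i k : Fin b) : |c.flux K ξ i k| ≤ d * (‖ξ‖ * |Λ|) := by
  rw [Coefficients.flux, Matrix.sum_apply]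
  refine (Finset.abs_sum_le_sum_abs _ _).trans ?_
  calc _ ≤ ∑ _j : Fin d, ‖ξ‖ * |Λ| := by
        refine Finset.sum_le_sum fun j _ => ?_
        rw [Matrix.smul_apply, smul_eq_mul, abs_mul]
        have h1 : |ξ j| ≤ ‖ξ‖ := by simpa using PiLp.norm_apply_le ξ j
        have h2 := (hc.bound_L j K hK i k).trans (le_abs_self Λ)
        gcongr
    _ = _ := by rw [Finset.sum_const, Finset.card_univ, Fintype.card_fin, nsmul_eq_mul]

/-- Wave speeds are the generalized eigenvalues of the flux matrix relative to G, so they bound the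
Rayleigh quotient. The maximum with 0 covers a negative `cw`, possible when there are no
eigenvectors. -/
lemma Coefficients.abs_dotProduct_flux_le (hc : c.Admissible T g₀ Λ cw) (hg₀ : 0 < g₀)
    (hK : T.IsElement K) (ξ : Space d) (y : Fin b → ℝ) :
    |y ⬝ᵥ (c.flux K ξ).mulVec y| ≤ ‖ξ‖ * max cw 0 * (y ⬝ᵥ (c.G K).mulVec y) := by
  by_cases h0 : ξ = 0
  · simp [h0, Coefficients.flux]
  have hξ : 0 < ‖ξ‖ := norm_pos_iff.mpr h0
  have hform : ∀ (M : Matrix (Fin b) (Fin b) ℝ) (x z : Fin b → ℝ),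
      Matrix.toBilin' M x z = x ⬝ᵥ M.mulVec z := fun M x z => by
    rw [Matrix.toBilin'_apply']
  have hsymm : ∀ (M : Matrix (Fin b) (Fin b) ℝ), M.IsSymm → ∀ x z : Fin b → ℝ,
      x ⬝ᵥ M.mulVec z = z ⬝ᵥ M.mulVec x := fun M hM x z => by
    rw [Matrix.dotProduct_mulVec, ← Matrix.mulVec_transpose, hM, dotProduct_comm]
  have key := abs_form_self_le_of_eigenvalue_le (Matrix.toBilin' (c.G K))
    (Matrix.toBilin' (c.flux K (‖ξ‖⁻¹ • ξ)))
    (fun x z => by rw [hform, hform, hsymm _ (hc.symm_G K hK)])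
    (fun x hx => by
      rw [hform]
      refine lt_of_lt_of_le (mul_pos hg₀ ?_) (hc.posDef_G K hK x)
      exact lt_of_le_of_ne (Finset.sum_nonneg fun i _ => mul_self_nonneg _)
        fun h => hx (dotProduct_self_eq_zero.mp h.symm))
    (fun x z => by rw [hform, hform, hsymm _ (Coefficients.flux_isSymm hc hK _)])
    (c := max cw 0)
    (fun w μ hw h => by
      refine (hc.waveSpeed K hK (‖ξ‖⁻¹ • ξ) ?_ w μ hw ?_).trans (le_max_left _ _)
      · rw [norm_smul, norm_inv, norm_norm, inv_mul_cancel₀ hξ.ne']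
      · refine dotProduct_eq _ _ fun z => ?_
        have := h z
        rw [hform, hform, hsymm _ (Coefficients.flux_isSymm hc hK _),
          hsymm _ (hc.symm_G K hK)] at this
        rw [dotProduct_comm, this, smul_dotProduct, dotProduct_comm z, smul_eq_mul]) y
  rw [hform, hform, Coefficients.flux_smul, Matrix.smul_mulVec, dotProduct_smul, smul_eq_mul,
    abs_mul, abs_of_pos (inv_pos.mpr hξ), inv_mul_le_iff₀ hξ] at key
  linarith

/-- Coercivity of `G - ∑ ξ_j L^(j)` for slopes `ξ` obeying the causality condition. -/
lemma Coefficients.coercive_of_norm_le (hc : c.Admissible T g₀ Λ cw) (hg₀ : 0 < g₀)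
    (hK : T.IsElement K) {cmax : ℝ} (hcmax : 0 < cmax) (hcw : cw < cmax) {ξ : Space d}
    (hξ : ‖ξ‖ ≤ 1 / cmax) (y : Fin b → ℝ) :
    (1 - max cw 0 / cmax) * g₀ * (y ⬝ᵥ y) ≤ y ⬝ᵥ (c.G K - c.flux K ξ).mulVec y := by
  have h1 := Coefficients.abs_dotProduct_flux_le hc hg₀ hK ξ y
  have h2 := hc.posDef_G K hK y
  have hG : 0 ≤ y ⬝ᵥ (c.G K).mulVec y :=
    (mul_nonneg hg₀.le (Finset.sum_nonneg fun i _ => mul_self_nonneg _)).trans h2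
  have h3 : ‖ξ‖ * max cw 0 ≤ max cw 0 / cmax := by
    rw [div_eq_mul_one_div, mul_comm]
    exact mul_le_mul_of_nonneg_left hξ (le_max_right _ _)
  have h4 : 0 ≤ 1 - max cw 0 / cmax := by
    rw [sub_nonneg, div_le_one hcmax]
    exact max_le hcw.le hcmax.le
  rw [Matrix.sub_mulVec, dotProduct_sub]
  have h5 := mul_le_mul_of_nonneg_right h3 hG
  have h6 := mul_le_mul_of_nonneg_left h2 h4
  have h7 := le_abs_self (y ⬝ᵥ (c.flux K ξ).mulVec y)
  nlinarith

end Causality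

/-! ### Sums over the interior facets of the patch -/

section FacetSums

variable {d b p : ℕ} {T : Mesh d} {v : Space d} {δ : LagrangeP1 T}

open Classical in
/-- The sum over the interior facets of the patch of the integrals of `δ Φ`, each
facet being met in both directions. -/
def facetSum (δ : LagrangeP1 T) (Φ : T.patch v → T.patch v → MvPolynomial (Fin d) ℝ) : ℝ :=
  (1 / 2 : ℝ) * ∑ K : T.patch v, ∑ K' : T.patch v,
    if ((K : Finset (Space d)) ∩ (K' : Finset (Space d))).card = d then
      facetInt ((K : Finset (Space d)) ∩ (K' : Finset (Space d))) δ.toFun (Φ K K')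
    else 0

lemma facetForm_eq (c : Coefficients d b) (S : Matrix (Fin b) (Fin b) ℝ) (w z : DG T v b p) :
    facetForm c S δ w z
      = facetSum δ fun K K' => dot (numFlux c S w K K') (on z K' - on z K) := rfl

open Classical in
lemma continuousOn_inter (δ : LagrangeP1 T) (K K' : T.patch v) : ContinuousOn δ.toFun
    (body ((K : Finset (Space d)) ∩ (K' : Finset (Space d)))) :=
  δ.continuousOn.mono ((convexHull_mono (by simp)).trans
    (Set.subset_biUnion_of_mem (u := body) K.2.1))

lemma facetSum_add (Φ Ψ : T.patch v → T.patch v → MvPolynomial (Fin d) ℝ) :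
    facetSum δ (fun K K' => Φ K K' + Ψ K K') = facetSum δ Φ + facetSum δ Ψ := by
  simp only [facetSum]
  rw [← mul_add, ← Finset.sum_add_distrib]
  congr 1
  refine Finset.sum_congr rfl fun K _ => ?_
  rw [← Finset.sum_add_distrib]
  refine Finset.sum_congr rfl fun K' _ => ?_
  split_ifs with h
  · exact facetInt_add h (continuousOn_inter δ K K') _ _
  · simp

lemma facetSum_smul (r : ℝ) (Φ : T.patch v → T.patch v → MvPolynomial (Fin d) ℝ) :
    facetSum δ (fun K K' => r • Φ K K') = r * facetSum δ Φ := by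
  simp only [facetSum, facetInt_smul, Finset.mul_sum, mul_ite, mul_zero, mul_left_comm]

/-- Each facet is visited in both directions; this allows one-sided integrands to be symmetrized
into jumps and averages. -/
lemma facetSum_swap (Φ : T.patch v → T.patch v → MvPolynomial (Fin d) ℝ) :
    facetSum δ (fun K K' => Φ K' K) = facetSum δ Φ := by
  classical
  simp only [facetSum]
  rw [Finset.sum_comm]
  simp only [Finset.inter_comm]

open Classical in
lemma facetSum_congr {Φ Ψ : T.patch v → T.patch v → MvPolynomial (Fin d) ℝ}
    (h : ∀ K K' : T.patch v, ((K : Finset (Space d)) ∩ (K' : Finset (Space d))).card = d →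
      Φ K K' = Ψ K K') : facetSum δ Φ = facetSum δ Ψ := by
  simp only [facetSum]
  congr 1
  refine Finset.sum_congr rfl fun K _ => Finset.sum_congr rfl fun K' _ => ?_
  split_ifs with h'
  · rw [h K K' h']
  · rfl

open Classical in
lemma facetSum_mono (hδ : ∀ K ∈ T.patch v, ∀ x ∈ body K, 0 ≤ δ.toFun x)
    {Φ Ψ : T.patch v → T.patch v → MvPolynomial (Fin d) ℝ}
    (h : ∀ K K' : T.patch v, ((K : Finset (Space d)) ∩ (K' : Finset (Space d))).card = d →
      ∀ x : Space d, eval x.ofLp (Φ K K') ≤ eval x.ofLp (Ψ K K')) :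
    facetSum δ Φ ≤ facetSum δ Ψ := by
  simp only [facetSum]
  refine mul_le_mul_of_nonneg_left ?_ (by norm_num)
  refine Finset.sum_le_sum fun K _ => Finset.sum_le_sum fun K' _ => ?_
  split_ifs with h'
  · have hm := facet_measure_lt_top _ h'
    have hcont := continuousOn_inter δ K K'
    refine setIntegral_mono_on (integrableOn_body _ _ hm hcont _) (integrableOn_body _ _ hm hcont _)
      (isCompact_body _).isClosed.measurableSet fun x hx => ?_
    exact mul_le_mul_of_nonneg_left (h K K' h' x)
      (hδ K K.2 x (convexHull_mono (by simp) hx))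
  · exact le_rfl

lemma norm_normal_le (K K' : Finset (Space d)) : ‖normal K K'‖ ≤ 1 := by
  rw [normal, norm_smul, norm_inv, norm_norm]
  exact inv_mul_le_one

end FacetSums

/-! ### Green's formula on the vertex patch -/

section Patch

variable {n b p : ℕ} {T : Mesh (n + 1)} {v : Space (n + 1)} {c : Coefficients (n + 1) b}
  {g₀ Λ cw : ℝ} {δ : LagrangeP1 T}

/-- A frame at `v` of an element of the patch. -/
def patchFrame (K : T.patch v) : Frame (K : Finset (Space (n + 1))) v :=
  Classical.choice (Frame.nonempty_of_isElement K.2.1 K.2.2)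

open Classical in
-- Reversing the normal changes the sign, and by continuity of the normal flux it is immaterial
-- which element supplies the coefficients.
lemma flux_normal_swap (hc : c.Admissible T g₀ Λ cw) (hv : v ∈ interior T.domain)
    (K K' : T.patch v)
    (h : ((K : Finset (Space (n + 1))) ∩ (K' : Finset (Space (n + 1)))).card = n + 1) :
    c.flux K' (normal (K' : Finset (Space (n + 1))) K)
      = -c.flux K (normal (K : Finset (Space (n + 1))) K') := by
  obtain ⟨i, hi⟩ := (patchFrame K).exists_inter_eq_erase K.2.1 K'.2.2 h
  obtain ⟨i', hi'⟩ := (patchFrame K').exists_inter_eq_erase K'.2.1 K.2.2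
    (by rw [Finset.inter_comm, h])
  rw [Finset.inter_comm] at hi'
  rw [normal_swap, Coefficients.flux_neg,
    (patchFrame K).normal_eq_nu K.2.1 K'.2.1 hi (patchFrame K') hi',
    (patchFrame K).flux_nu_eq hc K.2.1 hv K'.2.1 hi (patchFrame K') hi']

open Classical in
/-- The sum over interior facets, arranged by elements. -/
lemma facetSum_eq_sum_faces (hv : v ∈ interior T.domain)
    (Φ : T.patch v → T.patch v → MvPolynomial (Fin (n + 1)) ℝ) :
    facetSum δ Φ = (1 / 2 : ℝ) * ∑ K : T.patch v, ∑ i,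
      facetInt ((K : Finset (Space (n + 1))).erase (v + (patchFrame K).e i)) δ.toFun
        (Φ K ⟨(patchFrame K).nb K.2.1 hv i, (patchFrame K).nb_mem_patch K.2.1 hv i⟩) := by
  rw [facetSum]
  congr 1
  refine Finset.sum_congr rfl fun K _ => ?_
  rw [(patchFrame K).sum_patch_eq K.2.1 hv fun K' =>
    facetInt ((K : Finset (Space (n + 1))) ∩ K') δ.toFun (Φ K K')]
  refine Finset.sum_congr rfl fun i _ => ?_
  simp only [(patchFrame K).inter_nb K.2.1 hv i]

/-! ### Weighted derivatives -/

/-- The operator `w ↦ δ ∂_j w`. -/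
def weightedDeriv (δ : LagrangeP1 T) (j : Fin (n + 1)) : Module.End ℝ (DG T v b p) where
  toFun w K i := ⟨δ.poly K v * pderiv j (w K i : MvPolynomial (Fin (n + 1)) ℝ), by
    -- The affine factor restores the degree that the derivative removed.
    have h := pow_mul_mem_restrictTotalDegree (i := 1) (k := p) (p := p) (by omega)
      (δ.totalDegree_poly_le K v) (pderiv_mem_polyLT (k := p) (w K i).2 j)
    rwa [pow_one] at h⟩
  map_add' w z := by
    funext K i
    exact Subtype.ext (by simp [mul_add])
  map_smul' r w := by
    funext K i
    exact Subtype.ext (by simp)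

lemma on_weightedDeriv (j : Fin (n + 1)) (w : DG T v b p) (K : T.patch v) :
    on (weightedDeriv δ j w) K = fun i => δ.poly K v * pderiv j (on w K i) := rfl

/-- The operator `w ↦ δ div f(w)` on every element. -/
def weightedDiv (c : Coefficients (n + 1) b) (δ : LagrangeP1 T) : Module.End ℝ (DG T v b p) :=
  ∑ j, actOp (c.L j) * weightedDeriv δ j

lemma weightedDiv_apply (w : DG T v b p) :
    weightedDiv c δ w = ∑ j, actOp (c.L j) (weightedDeriv δ j w) := by
  simp [weightedDiv]

lemma elemInt_poly_mul (K : T.patch v) (P : MvPolynomial (Fin (n + 1)) ℝ) :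
    elemInt (K : Finset (Space (n + 1))) 1 (δ.poly K v * P) = elemInt K δ.toFun P := by
  refine setIntegral_congr_fun (isCompact_body _).isClosed.measurableSet fun x hx => ?_
  simp [δ.eval_poly (patchFrame K) K.2.1 hx]

lemma dot_act_mul (B : Matrix (Fin b) (Fin b) ℝ) (P : MvPolynomial (Fin (n + 1)) ℝ)
    (w z : Fin b → MvPolynomial (Fin (n + 1)) ℝ) :
    dot (act B fun i => P * w i) z = P * dot (act B w) z := by
  simp only [dot, act, Finset.mul_sum, Finset.sum_mul]
  refine Finset.sum_congr rfl fun i _ => Finset.sum_congr rfl fun k _ => ?_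
  rw [smul_mul_assoc, smul_mul_assoc, mul_smul_comm, mul_assoc]

lemma ip_weightedDiv (w z : DG T v b p) :
    ip (weightedDiv c δ w) z = ∑ K : T.patch v, ∑ j,
      elemInt (K : Finset (Space (n + 1))) δ.toFun
        (dot (act (c.L j K) (partialD j (on w K))) (on z K)) := by
  rw [weightedDiv_apply, map_sum, LinearMap.sum_apply]
  simp only [ip_apply]
  rw [Finset.sum_comm]
  refine Finset.sum_congr rfl fun K _ => Finset.sum_congr rfl fun j _ => ?_
  rw [on_actOp, on_weightedDeriv, dot_act_mul, elemInt_poly_mul]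
  rfl

lemma volForm_apply (w z : DG T v b p) :
    volForm c δ w z = ∑ K : T.patch v, ∑ j, elemInt (K : Finset (Space (n + 1))) δ.toFun
      (dot (act (c.L j K) (on w K)) (partialD j (on z K))) := rfl

/-- The matrices L^(j) are symmetric, so the derivative may stand on either factor when both are w.
-/
lemma ip_weightedDiv_self (hc : c.Admissible T g₀ Λ cw) (w : DG T v b p) :
    ip (weightedDiv c δ w) w = volForm c δ w w := by
  rw [ip_weightedDiv, volForm_apply]
  refine Finset.sum_congr rfl fun K _ => Finset.sum_congr rfl fun j _ => ?_
  rw [dot_act_comm (hc.symm_L j K K.2.1)]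

lemma pderiv_dot_act (B : Matrix (Fin b) (Fin b) ℝ) (j : Fin (n + 1))
    (w z : Fin b → MvPolynomial (Fin (n + 1)) ℝ) :
    pderiv j (dot (act B w) z)
      = dot (act B (partialD j w)) z + dot (act B w) (partialD j z) := by
  simp only [dot, act, partialD, map_sum, Derivation.leibniz, Derivation.map_smul, smul_eq_mul]
  rw [← Finset.sum_add_distrib]
  refine Finset.sum_congr rfl fun i _ => ?_
  ring

lemma dot_sum_left {ι : Type*} (s : Finset ι) (w : ι → Fin b → MvPolynomial (Fin (n + 1)) ℝ)
    (z : Fin b → MvPolynomial (Fin (n + 1)) ℝ) :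
    dot (∑ a ∈ s, w a) z = ∑ a ∈ s, dot (w a) z := by
  simp only [dot, Finset.sum_apply, Finset.sum_mul]
  exact Finset.sum_comm

lemma dot_act_flux (K : Finset (Space (n + 1))) (ξ : Space (n + 1))
    (w z : Fin b → MvPolynomial (Fin (n + 1)) ℝ) :
    dot (act (c.flux K ξ) w) z = ∑ j, ξ j • dot (act (c.L j K) w) z := by
  rw [Coefficients.flux, sum_act, dot_sum_left]
  simp only [smul_act, dot_smul_left]

lemma facetInt_sum {ι : Type*} {F : Finset (Space (n + 1))} (hF : F.card = n + 1)
    {q : Space (n + 1) → ℝ} (hq : ContinuousOn q (body F)) (s : Finset ι)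
    (P : ι → MvPolynomial (Fin (n + 1)) ℝ) :
    facetInt F q (∑ a ∈ s, P a) = ∑ a ∈ s, facetInt F q (P a) := by
  classical
  induction s using Finset.induction_on with
  | empty => simp [facetInt]
  | insert a s ha ih => rw [Finset.sum_insert ha, Finset.sum_insert ha, facetInt_add hF hq, ih]

/-- Green's formula on the patch with the weight `δ`. -/
lemma ip_weightedDiv_add_volForm (hv : v ∈ interior T.domain)
    (hδ : ∀ K ∈ T.patch v, δ.VanishesOff K v) (w z : DG T v b p) :
    ip (weightedDiv c δ w) z + volForm c δ w z + massForm (fun K => c.flux K (δ.grad K)) w z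
      = 2 * facetSum δ fun K K' : T.patch v =>
        dot (act (c.flux K (normal (K : Finset (Space (n + 1))) K')) (on w K)) (on z K) := by
  classical
  -- The integrand only involves the trace from K, so the factor 2 undoes the halving: what remains
  -- is a sum over all pairs of an element and one of its facets through v. On the facet opposite v
  -- the weight vanishes.
  rw [facetSum_eq_sum_faces hv, ← mul_assoc, mul_one_div_cancel two_ne_zero, one_mul,
    ip_weightedDiv, volForm_apply, ← Finset.sum_add_distrib]
  change _ + ∑ K : T.patch v, elemInt (K : Finset (Space (n + 1))) 1
    (dot (act (c.flux K (δ.grad K)) (on w K)) (on z K)) = _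
  rw [← Finset.sum_add_distrib]
  refine Finset.sum_congr rfl fun K _ => ?_
  have hcont : ContinuousOn δ.toFun (body (K : Finset (Space (n + 1)))) :=
    δ.continuousOn.mono (Set.subset_biUnion_of_mem (u := body) K.2.1)
  simp only [(patchFrame K).normal_nb K.2.1 hv]
  rw [← Finset.sum_add_distrib, dot_act_flux, elemInt_sum (q := 1) continuousOn_const,
    ← Finset.sum_add_distrib]
  have h1 : ∀ i, facetInt ((K : Finset (Space (n + 1))).erase (v + (patchFrame K).e i)) δ.toFun
      (dot (act (c.flux K ((patchFrame K).nu i)) (on w K)) (on z K))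
      = ∑ j, (patchFrame K).nu i j
        * facetInt ((K : Finset (Space (n + 1))).erase (v + (patchFrame K).e i)) δ.toFun
          (dot (act (c.L j K) (on w K)) (on z K)) := fun i => by
    rw [dot_act_flux, facetInt_sum ((patchFrame K).card_erase K.2.1 i)
      (hcont.mono (convexHull_mono (by simp)))]
    simp only [facetInt_smul]
  simp only [h1]
  rw [Finset.sum_comm]
  refine Finset.sum_congr rfl fun j _ => ?_
  rw [← LagrangeP1.elemInt_pderiv (patchFrame K) K.2.1 (hδ K K.2), pderiv_dot_act,
    elemInt_add hcont, elemInt_smul]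

end Patch

section Operators

variable {n b p : ℕ} {T : Mesh (n + 1)} {v : Space (n + 1)} {c : Coefficients (n + 1) b}
  {g₀ Λ cw : ℝ} {δ : LagrangeP1 T}

/-! ### The smooth part of the iteration is nilpotent -/

/-- Multiples of `δ ^ i` by polynomials of degree at most `p - i`. -/
def IsPowMultiple (δ : LagrangeP1 T) (i : ℕ) (w : DG T v b p) : Prop :=
  ∀ (K : T.patch v) l, ∃ q ∈ polyLT (n + 1) (p + 1 - i), on w K l = δ.poly K v ^ i * q

lemma isPowMultiple_zero (w : DG T v b p) : IsPowMultiple δ 0 w := fun K l =>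
  ⟨on w K l, (w K l).2, by simp⟩

/-- At this power the cofactor would have negative degree. -/
lemma IsPowMultiple.eq_zero {w : DG T v b p} (h : IsPowMultiple δ (p + 1) w) : w = 0 := by
  refine on_injective fun K => funext fun l => ?_
  obtain ⟨q, hq, h⟩ := h K l
  rw [Nat.sub_self] at hq
  have h0 : q = 0 := hq
  rw [h, h0, mul_zero]
  rfl

lemma IsPowMultiple.actOp {i : ℕ} {w : DG T v b p} (h : IsPowMultiple δ i w)
    (B : Finset (Space (n + 1)) → Matrix (Fin b) (Fin b) ℝ) :
    IsPowMultiple δ i (TentSAT.actOp B w) := fun K l => by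
  choose q hq h using h K
  refine ⟨∑ k, B K l k • q k, Submodule.sum_mem _ fun k _ => Submodule.smul_mem _ _ (hq k), ?_⟩
  rw [on_actOp, act, Finset.mul_sum]
  exact Finset.sum_congr rfl fun k _ => by rw [h, mul_smul_comm]

lemma mul_pderiv_pow_mul {d : ℕ} {P : MvPolynomial (Fin d) ℝ} {j : Fin d} {r : ℝ}
    (hP : pderiv j P = C r) (i : ℕ) (q : MvPolynomial (Fin d) ℝ) :
    P * pderiv j (P ^ i * q) = ((i : ℝ) * r) • (P ^ i * q) + P ^ (i + 1) * pderiv j q := by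
  rw [Derivation.leibniz, Derivation.leibniz_pow, hP, smul_eq_C_mul, C_mul]
  cases i with
  | zero => simp
  | succ i =>
    simp only [smul_eq_mul, nsmul_eq_mul, Nat.add_sub_cancel, map_natCast]
    ring

/-- In δ∂_j(δ^i q) = i(∂_jδ)δ^i q + δ^(i+1)∂_j q the first term, contracted with L^(j), is what iM₁
produces. It cancels and leaves -δ^(i+1) div f(q). -/
lemma IsPowMultiple.step {i : ℕ} (hi : i ≤ p) {w : DG T v b p} (h : IsPowMultiple δ i w) :
    IsPowMultiple δ (i + 1) ((i : ℝ) • TentSAT.actOp (fun K => c.flux K (δ.grad K)) w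
      - weightedDiv c δ w) := fun K l => by
  choose q hq h using h K
  refine ⟨-∑ j, ∑ k, c.L j K l k • pderiv j (q k), Submodule.neg_mem _ <|
    Submodule.sum_mem _ fun j _ => Submodule.sum_mem _ fun k _ => Submodule.smul_mem _ _ ?_, ?_⟩
  · have : p + 1 - i = p + 1 - (i + 1) + 1 := by omega
    exact pderiv_mem_polyLT (this ▸ hq k) j
  · have hD : on (weightedDiv c δ w) K l
        = ∑ j, ∑ k, c.L j K l k • (δ.poly K v * pderiv j (on w K k)) := by
      rw [weightedDiv_apply]
      have h1 : on (∑ j, TentSAT.actOp (c.L j) (weightedDeriv δ j w)) K l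
          = ∑ j, on (TentSAT.actOp (c.L j) (weightedDeriv δ j w)) K l := by
        simp [on, Finset.sum_apply]
      rw [h1]
      refine Finset.sum_congr rfl fun j _ => ?_
      rw [on_actOp, on_weightedDeriv]
      rfl
    have hM : on (TentSAT.actOp (fun K => c.flux K (δ.grad K)) w) K l
        = ∑ j, ∑ k, c.L j K l k • (δ.grad K j • on w K k) := by
      rw [on_actOp, Coefficients.flux, sum_act, Finset.sum_apply]
      refine Finset.sum_congr rfl fun j _ => ?_
      rw [smul_act, ← act_smul]
      rfl
    have hs : on ((i : ℝ) • TentSAT.actOp (fun K => c.flux K (δ.grad K)) w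
        - weightedDiv c δ w) K l
        = (i : ℝ) • on (TentSAT.actOp (fun K => c.flux K (δ.grad K)) w) K l
          - on (weightedDiv c δ w) K l := rfl
    rw [hs, hD, hM, Finset.smul_sum, ← Finset.sum_sub_distrib, mul_neg, Finset.mul_sum,
      ← Finset.sum_neg_distrib]
    refine Finset.sum_congr rfl fun j _ => ?_
    rw [Finset.smul_sum, ← Finset.sum_sub_distrib, Finset.mul_sum, ← Finset.sum_neg_distrib]
    refine Finset.sum_congr rfl fun k _ => ?_
    rw [h, mul_pderiv_pow_mul (δ.pderiv_poly K v j), smul_comm (i : ℝ), ← smul_sub, smul_smul,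
      sub_add_cancel_left, smul_neg, mul_smul_comm]

/-! ### The jump form and the energy identity -/

/-- The dissipation form `(δ S⟦w⟧, ⟦z⟧)` over the interior facets of the patch. -/
def jumpForm (S : Matrix (Fin b) (Fin b) ℝ) (δ : LagrangeP1 T) :
    LinearMap.BilinForm ℝ (DG T v b p) :=
  -- With zero coefficients the numerical flux reduces to -S⟦w⟧, hence the sign.
  -facetForm ⟨0, 0⟩ S δ

lemma poly_ext {d : ℕ} {P Q : MvPolynomial (Fin d) ℝ}
    (h : ∀ x : Space d, eval x.ofLp P = eval x.ofLp Q) : P = Q :=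
  MvPolynomial.funext fun x => h (WithLp.toLp 2 x)

lemma jumpForm_eq (S : Matrix (Fin b) (Fin b) ℝ) (w z : DG T v b p) :
    jumpForm S δ w z
      = facetSum δ fun K K' => dot (act S (on w K' - on w K)) (on z K' - on z K) := by
  rw [jumpForm, LinearMap.neg_apply, LinearMap.neg_apply, facetForm_eq, ← neg_one_mul,
    ← facetSum_smul]
  refine facetSum_congr fun K K' _ => poly_ext fun x => ?_
  simp [numFlux, Coefficients.flux, eval_dot, evalVec_sub, evalVec_act]
  ring

lemma jumpForm_comm {S : Matrix (Fin b) (Fin b) ℝ} (hS : S.IsSymm) (w z : DG T v b p) :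
    jumpForm S δ w z = jumpForm S δ z w := by
  rw [jumpForm_eq, jumpForm_eq]
  exact facetSum_congr fun K K' _ => dot_act_comm hS _ _

variable {S : Matrix (Fin b) (Fin b) ℝ}

/-- The residual `A + M₁ + D` acts through jumps only. -/
lemma ip_residual (hc : c.Admissible T g₀ Λ cw) (hv : v ∈ interior T.domain)
    (hδ : ∀ K ∈ T.patch v, δ.VanishesOff K v) (w z : DG T v b p) :
    volForm c δ w z + facetForm c S δ w z + massForm (fun K => c.flux K (δ.grad K)) w z
      + ip (weightedDiv c δ w) z
      = -facetSum δ fun K K' : T.patch v =>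
        dot (act (c.flux K (normal (K : Finset (Space (n + 1))) K')) (on w K' - on w K))
          ((1 / 2 : ℝ) • (on z K + on z K'))
        + dot (act S (on w K' - on w K)) (on z K' - on z K) := by
  have h1 := ip_weightedDiv_add_volForm (c := c) hv hδ w z
  have h2 : volForm c δ w z + facetForm c S δ w z + massForm (fun K => c.flux K (δ.grad K)) w z
      + ip (weightedDiv c δ w) z = (ip (weightedDiv c δ w) z + volForm c δ w z
        + massForm (fun K => c.flux K (δ.grad K)) w z) + facetForm c S δ w z := by ring
  rw [h2, h1, two_mul, facetForm_eq]
  -- One of the two copies of the one-sided boundary term is moved to the neighbour. Their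
  -- difference is -𝒟⟦w⟧·{z} - 𝒟{w}·⟦z⟧, whose second part cancels the central flux.
  nth_rewrite 2 [← facetSum_swap]
  rw [← facetSum_add, ← facetSum_add, ← neg_one_mul, ← facetSum_smul]
  refine facetSum_congr fun K K' h => poly_ext fun x => ?_
  rw [flux_normal_swap hc hv K K' h]
  simp only [numFlux, map_add, smul_eval, eval_dot, evalVec_sub, evalVec_add, evalVec_act,
    evalVec_smul, Matrix.neg_mulVec, Matrix.mulVec_add, Matrix.mulVec_sub, Matrix.mulVec_smul,
    neg_dotProduct, add_dotProduct, sub_dotProduct, smul_dotProduct, dotProduct_add,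
    dotProduct_sub, dotProduct_smul, smul_eq_mul]
  ring

/-- Take z = w in the residual formula: D contributes the volume term a second time, and the
symmetry of 𝒟 makes 𝒟⟦w⟧·{w} cancel the central flux of the second copy of the facet term. Two
copies of the jump term remain. -/
lemma energy_identity (hc : c.Admissible T g₀ Λ cw) (hv : v ∈ interior T.domain)
    (hδ : ∀ K ∈ T.patch v, δ.VanishesOff K v) (w : DG T v b p) :
    2 * (volForm c δ w w + facetForm c S δ w w) + massForm (fun K => c.flux K (δ.grad K)) w w
      = -2 * jumpForm S δ w w := by
  have h1 := ip_residual (S := S) hc hv hδ w w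
  rw [ip_weightedDiv_self hc] at h1
  have h2 : 2 * (volForm c δ w w + facetForm c S δ w w)
      + massForm (fun K => c.flux K (δ.grad K)) w w = (volForm c δ w w + facetForm c S δ w w
        + massForm (fun K => c.flux K (δ.grad K)) w w + volForm c δ w w)
        + facetForm c S δ w w := by ring
  rw [h2, h1, facetForm_eq, jumpForm_eq, ← neg_one_mul, ← facetSum_smul, ← facetSum_smul,
    ← facetSum_add]
  refine facetSum_congr fun K K' _ => ?_
  rw [dot_act_comm (Coefficients.flux_isSymm hc K.2.1 _)]
  refine poly_ext fun x => ?_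
  simp only [numFlux, map_add, smul_eval, eval_dot, evalVec_sub, evalVec_act, sub_dotProduct]
  ring

/-! ### Trace and inverse inequalities on the patch -/

section Bounds

variable {β Cinv : ℝ}

lemma sum_facetInt_dot_self_le (hδ : ∀ K ∈ T.patch v, δ.VanishesOff K v)
    (h0 : 0 ≤ δ.toFun v)
    (hC : ∀ P : MvPolynomial (Fin (n + 1)) ℝ, P.totalDegree ≤ p → ∀ y ∈ refSimplex (n + 1),
      eval y.ofLp P ^ 2 ≤ Cinv * ∫ y in refSimplex (n + 1), eval y.ofLp P ^ 2)
    (hC0 : 0 ≤ Cinv) (hB : ∀ (K : T.patch v) i, |δ.toFun v| * ‖(patchFrame K).g i‖ ≤ β)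
    (hv : v ∈ interior T.domain) (z : DG T v b p) :
    facetSum δ (fun K _ => dot (on z K) (on z K))
      ≤ (n + 1) * (volume.real (refSimplex n) * β * Cinv) * ip z z := by
  classical
  have hip := ip_self_nonneg z
  rw [facetSum_eq_sum_faces hv]
  have hβ : ∀ K : T.patch v, 0 ≤ β := fun K =>
    (mul_nonneg (abs_nonneg _) (norm_nonneg _)).trans (hB K 0)
  have h1 : ∀ (K : T.patch v) i,
      facetInt ((K : Finset (Space (n + 1))).erase (v + (patchFrame K).e i)) δ.toFun
        (dot (on z K) (on z K)) ≤ volume.real (refSimplex n) * β * Cinv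
          * ∑ l, elemInt (K : Finset (Space (n + 1))) 1 (on z K l ^ 2) := fun K i => by
    have hcont : ContinuousOn δ.toFun (body (K : Finset (Space (n + 1)))) :=
      δ.continuousOn.mono (Set.subset_biUnion_of_mem (u := body) K.2.1)
    rw [dot, facetInt_sum ((patchFrame K).card_erase K.2.1 i)
      (hcont.mono (convexHull_mono (by simp))), Finset.mul_sum]
    refine Finset.sum_le_sum fun l _ => ?_
    rw [← sq]
    exact LagrangeP1.facetInt_sq_le (patchFrame K) K.2.1 (hδ K K.2) h0 hC (hB K)
      ((mem_restrictTotalDegree _ _ _).mp (z K l).2) hC0 i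
  have h2 : ∑ K : T.patch v, ∑ i,
      facetInt ((K : Finset (Space (n + 1))).erase (v + (patchFrame K).e i)) δ.toFun
        (dot (on z K) (on z K))
      ≤ (n + 1) * (volume.real (refSimplex n) * β * Cinv) * ip z z := by
    rw [ip_self, Finset.mul_sum]
    refine Finset.sum_le_sum fun K _ => ?_
    refine (Finset.sum_le_sum fun i _ => h1 K i).trans (le_of_eq ?_)
    rw [Finset.sum_const, Finset.card_univ, Fintype.card_fin, nsmul_eq_mul, ← mul_assoc]
    push_cast
    ring
  -- Nonnegativity allows the factor 1/2 of `facetSum` to be dropped; β has a sign only if the patch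
  -- has an element.
  have h3 : 0 ≤ (n + 1) * (volume.real (refSimplex n) * β * Cinv) * ip z z := by
    rcases isEmpty_or_nonempty (T.patch v) with h | ⟨⟨K⟩⟩
    · rw [ip_self]; simp
    · have := hβ K
      positivity
  linarith

lemma ip_weightedDeriv_self_le (hδ : ∀ K ∈ T.patch v, δ.VanishesOff K v)
    (hC : ∀ P : MvPolynomial (Fin (n + 1)) ℝ, P.totalDegree ≤ p → ∀ y ∈ refSimplex (n + 1),
      ∀ i, eval y.ofLp (pderiv i P) ^ 2
        ≤ Cinv * ∫ y in refSimplex (n + 1), eval y.ofLp P ^ 2)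
    (hB : ∀ (K : T.patch v) i, |δ.toFun v| * ‖(patchFrame K).g i‖ ≤ β) (j : Fin (n + 1))
    (w : DG T v b p) : ip (weightedDeriv δ j w) (weightedDeriv δ j w)
      ≤ volume.real (refSimplex (n + 1)) * (n + 1) ^ 2 * β ^ 2 * Cinv * ip w w := by
  rw [ip_self, ip_self, Finset.mul_sum]
  refine Finset.sum_le_sum fun K _ => ?_
  rw [Finset.mul_sum]
  refine Finset.sum_le_sum fun l _ => ?_
  exact LagrangeP1.elemInt_sq_poly_mul_pderiv_le (patchFrame K) K.2.1 (hδ K K.2) hC (hB K)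
    ((mem_restrictTotalDegree _ _ _).mp (w K l).2) j

lemma ip_sum_self_le {d m : ℕ} {T : Mesh d} {v : Space d} (x : Fin m → DG T v b p) :
    ip (∑ j, x j) (∑ j, x j) ≤ m * ∑ j, ip (x j) (x j) := by
  have h1 : 0 ≤ ∑ i, ∑ j, ip (x i - x j) (x i - x j) :=
    Finset.sum_nonneg fun i _ => Finset.sum_nonneg fun j _ => ip_self_nonneg _
  have h2 : ∑ i, ∑ j, ip (x i - x j) (x i - x j)
      = 2 * (m * ∑ j, ip (x j) (x j)) - 2 * ip (∑ j, x j) (∑ j, x j) := by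
    have h3 : ∀ i j, ip (x i - x j) (x i - x j)
        = ip (x i) (x i) + ip (x j) (x j) - 2 * ip (x i) (x j) := fun i j => by
      simp only [map_sub, LinearMap.sub_apply]
      rw [ip_comm (x j) (x i)]
      ring
    simp only [h3, Finset.sum_sub_distrib, Finset.sum_add_distrib, map_sum, LinearMap.sum_apply,
      Finset.sum_const, Finset.card_univ, Fintype.card_fin, nsmul_eq_mul, ← Finset.mul_sum]
    rw [Finset.sum_comm]
    ring
  linarith

lemma ip_weightedDiv_self_le (hc : c.Admissible T g₀ Λ cw)
    (hδ : ∀ K ∈ T.patch v, δ.VanishesOff K v)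
    (hC : ∀ P : MvPolynomial (Fin (n + 1)) ℝ, P.totalDegree ≤ p → ∀ y ∈ refSimplex (n + 1),
      ∀ i, eval y.ofLp (pderiv i P) ^ 2
        ≤ Cinv * ∫ y in refSimplex (n + 1), eval y.ofLp P ^ 2)
    (hB : ∀ (K : T.patch v) i, |δ.toFun v| * ‖(patchFrame K).g i‖ ≤ β) (w : DG T v b p) :
    ip (weightedDiv c δ w) (weightedDiv c δ w) ≤ (n + 1) ^ 2 * ((b * |Λ|) ^ 2
      * (volume.real (refSimplex (n + 1)) * (n + 1) ^ 2 * β ^ 2 * Cinv)) * ip w w := by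
  rw [weightedDiv_apply]
  refine (ip_sum_self_le _).trans ?_
  have h1 : ∀ j, ip (actOp (c.L j) (weightedDeriv δ j w)) (actOp (c.L j) (weightedDeriv δ j w))
      ≤ (b * |Λ|) ^ 2 * (volume.real (refSimplex (n + 1)) * (n + 1) ^ 2 * β ^ 2 * Cinv
        * ip w w) := fun j =>
    (ip_actOp_self_le (fun K hK i k => (hc.bound_L j K hK.1 i k).trans (le_abs_self Λ)) _).trans
      (mul_le_mul_of_nonneg_left (ip_weightedDeriv_self_le hδ hC hB j w) (sq_nonneg _))
  refine (mul_le_mul_of_nonneg_left (Finset.sum_le_sum fun j _ => h1 j)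
    (Nat.cast_nonneg _)).trans (le_of_eq ?_)
  rw [Finset.sum_const, Finset.card_univ, Fintype.card_fin, nsmul_eq_mul]
  push_cast
  ring

lemma facetSum_dot_self_add (z : DG T v b p) :
    facetSum δ (fun K K' => dot (on z K) (on z K) + dot (on z K') (on z K'))
      = 2 * facetSum δ (fun K _ => dot (on z K) (on z K)) := by
  rw [facetSum_add, facetSum_swap (fun K _ => dot (on z K) (on z K))]
  ring

lemma sq_sub_le (x y : Fin b → ℝ) :
    (x - y) ⬝ᵥ (x - y) ≤ 2 * (y ⬝ᵥ y + x ⬝ᵥ x) := by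
  have : 0 ≤ (x + y) ⬝ᵥ (x + y) := Finset.sum_nonneg fun i _ => mul_self_nonneg _
  simp only [sub_dotProduct, dotProduct_sub, add_dotProduct, dotProduct_add] at this ⊢
  linarith

lemma real_dotProduct_self_nonneg (x : Fin b → ℝ) : 0 ≤ x ⬝ᵥ x :=
  Finset.sum_nonneg fun _ _ => mul_self_nonneg _

variable {s e Cs : ℝ}

lemma jumpForm_self_le (hnn : ∀ K ∈ T.patch v, ∀ x ∈ body K, 0 ≤ δ.toFun x)
    (hs : ∀ i k, |S i k| ≤ s) (w : DG T v b p) :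
    jumpForm S δ w w
      ≤ 2 * (1 + (b * s) ^ 2) * facetSum δ (fun K _ => dot (on w K) (on w K)) := by
  rw [mul_comm 2, mul_assoc, ← facetSum_dot_self_add, ← facetSum_smul, jumpForm_eq]
  refine facetSum_mono hnn fun K K' _ x => ?_
  rw [smul_eval, map_add, eval_dot, eval_dot, eval_dot, evalVec_act, evalVec_sub]
  set y := evalVec x (on w K') - evalVec x (on w K) with hy
  have h1 := two_mul_abs_dotProduct_mulVec_le hs y y
  have h2 := sq_sub_le (evalVec x (on w K')) (evalVec x (on w K))
  rw [← hy] at h2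
  have h3 := le_abs_self (y ⬝ᵥ S.mulVec y)
  rw [dotProduct_comm (S.mulVec y)]
  nlinarith [mul_le_mul_of_nonneg_left h2 (add_nonneg zero_le_one (sq_nonneg (b * s)))]

/-- The residual is controlled by the dissipation. -/
lemma residual_le (hc : c.Admissible T g₀ Λ cw) (hv : v ∈ interior T.domain)
    (hδ : ∀ K ∈ T.patch v, δ.VanishesOff K v)
    (hnn : ∀ K ∈ T.patch v, ∀ x ∈ body K, 0 ≤ δ.toFun x)
    (hs : ∀ i k, |S i k| ≤ s) (hCs : ∀ y : Fin b → ℝ, y ⬝ᵥ y ≤ Cs * (y ⬝ᵥ S.mulVec y))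
    (he : (n + 1) * |Λ| ≤ e) (w z : DG T v b p) :
    volForm c δ w z + facetForm c S δ w z + massForm (fun K => c.flux K (δ.grad K)) w z
      + ip (weightedDiv c δ w) z
      ≤ ((b * e) ^ 2 + (b * s) ^ 2) * Cs * jumpForm S δ w w
        + 4 * facetSum δ (fun K _ => dot (on z K) (on z K)) := by
  have h4 : 4 * facetSum δ (fun K _ => dot (on z K) (on z K))
      = 2 * facetSum δ (fun K K' => dot (on z K) (on z K) + dot (on z K') (on z K')) := by
    rw [facetSum_dot_self_add]; ring
  rw [ip_residual hc hv hδ, h4, jumpForm_eq, ← neg_one_mul, ← facetSum_smul, ← facetSum_smul,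
    ← facetSum_smul, ← facetSum_add]
  refine facetSum_mono hnn fun K K' _ x => ?_
  have hN : ∀ i k, |c.flux K (normal (K : Finset (Space (n + 1))) K') i k| ≤ e := fun i k => by
    refine (Coefficients.abs_flux_le hc K.2.1 _ i k).trans (le_trans ?_ he)
    have := norm_normal_le (K : Finset (Space (n + 1))) K'
    push_cast
    gcongr
    exact mul_le_of_le_one_left (abs_nonneg _) this
  simp only [smul_eval, map_add, eval_dot, evalVec_act, evalVec_sub, evalVec_smul, evalVec_add]
  set y := evalVec x (on w K') - evalVec x (on w K)
  set z₀ := evalVec x (on z K)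
  set z₁ := evalVec x (on z K')
  have h1 := two_mul_abs_dotProduct_mulVec_le hN ((1 / 2 : ℝ) • (z₀ + z₁)) y
  have h2 := two_mul_abs_dotProduct_mulVec_le hs (z₁ - z₀) y
  have h3 := sq_sub_le z₁ z₀
  have h5 : ((1 / 2 : ℝ) • (z₀ + z₁)) ⬝ᵥ ((1 / 2 : ℝ) • (z₀ + z₁))
      ≤ z₀ ⬝ᵥ z₀ + z₁ ⬝ᵥ z₁ := by
    have := real_dotProduct_self_nonneg (z₁ - z₀)
    simp only [sub_dotProduct, dotProduct_sub, add_dotProduct, dotProduct_add, smul_dotProduct,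
      dotProduct_smul, smul_eq_mul] at this ⊢
    have h6 := real_dotProduct_self_nonneg z₀
    have h7 := real_dotProduct_self_nonneg z₁
    linarith
  have h6 := mul_le_mul_of_nonneg_left (hCs y)
    (add_nonneg (sq_nonneg ((b : ℝ) * e)) (sq_nonneg ((b : ℝ) * s)))
  have h7 := neg_abs_le (((1 / 2 : ℝ) • (z₀ + z₁)) ⬝ᵥ
    (c.flux K (normal (K : Finset (Space (n + 1))) K')).mulVec y)
  have h8 := neg_abs_le ((z₁ - z₀) ⬝ᵥ S.mulVec y)
  have h9 := real_dotProduct_self_nonneg y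
  have h10 : 0 ≤ ((b * e) ^ 2 + (b * s) ^ 2) * (y ⬝ᵥ y) := by positivity
  rw [dotProduct_comm (Matrix.mulVec _ y), dotProduct_comm (Matrix.mulVec _ y),
    dotProduct_comm (Matrix.mulVec _ y)]
  have h11 := real_dotProduct_self_nonneg z₀
  have h12 := real_dotProduct_self_nonneg z₁
  nlinarith

/-- An operator whose form is bounded by `σ + (z, z)` is bounded by `σ`. -/
lemma ip_self_le_of_forall_le {r : DG T v b p} {C σ : ℝ} (hC : 0 < C)
    (h : ∀ z, ip r z ≤ C * σ + C * ip z z) : ip r r ≤ 4 * C ^ 2 * σ := by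
  -- Among the multiples t r, this t maximizes t - Ct², the factor of (r, r) left after absorbing
  -- the quadratic term.
  have h1 := h ((1 / (2 * C)) • r)
  simp only [map_smul, LinearMap.smul_apply, smul_eq_mul] at h1
  have h2 : 1 / (2 * C) * ip r r - C * (1 / (2 * C) * (1 / (2 * C) * ip r r))
      = 1 / (4 * C) * ip r r := by field_simp; ring
  have h3 : 1 / (4 * C) * ip r r ≤ C * σ := by linarith
  rw [one_div, inv_mul_le_iff₀ (by positivity)] at h3
  linarith

end Bounds

end Operators

/-! ### The dissipative structure of the tent operators -/

section InnerProduct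

variable {d b p : ℕ} {T : Mesh d} {v : Space d}

/-- The `L²` inner product space structure of `V_h`. -/
abbrev ipCore : InnerProductSpace.Core ℝ (DG T v b p) where
  inner w z := ip w z
  conj_inner_symm w z := by simpa using ip_comm z w
  re_inner_nonneg w := by simpa using ip_self_nonneg w
  add_left w w' z := by simp
  smul_left w z r := by simp
  definite w h := by
    by_contra hw
    exact (ip_self_pos hw).ne' h

/-- The `L²` norm of `V_h`. -/
abbrev normedAddCommGroupDG : NormedAddCommGroup (DG T v b p) := ipCore.toNormedAddCommGroup

attribute [local instance] normedAddCommGroupDG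

/-- The `L²` inner product of `V_h`. -/
abbrev innerProductSpaceDG : InnerProductSpace ℝ (DG T v b p) :=
  InnerProductSpace.ofCore ipCore.toCore

attribute [local instance] innerProductSpaceDG

lemma inner_eq_ip (w z : DG T v b p) : inner ℝ w z = ip w z := rfl

lemma sq_norm_eq_ip (w : DG T v b p) : ‖w‖ ^ 2 = ip w w := (real_inner_self_eq_norm_sq w).symm

lemma norm_le_of_ip_le {w z : DG T v b p} {r : ℝ} (hr : 0 ≤ r) (h : ip w w ≤ r ^ 2 * ip z z) :
    ‖w‖ ≤ r * ‖z‖ := by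
  refine (abs_le_of_sq_le_sq' ?_ (by positivity)).2
  rw [mul_pow, sq_norm_eq_ip, sq_norm_eq_ip]
  exact h

/-- Lets all estimates be proved for the bilinear form `ip`, before V_h is given the L² norm. -/
lemma dissipativePair_of_ip {M0 N0 M1 A D : Module.End ℝ (DG T v b p)}
    {σ : LinearMap.BilinForm ℝ (DG T v b p)} {m a : ℝ} (pos_m : 0 < m) (one_le_a : 1 ≤ a)
    (mul_left : N0 * M0 = 1) (mul_right : M0 * N0 = 1)
    (coercive : ∀ w, m * ip w w ≤ ip (M0 w) w)
    (symm_M0 : ∀ w z, ip (M0 w) z = ip w (M0 z)) (symm_M1 : ∀ w z, ip (M1 w) z = ip w (M1 z))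
    (bound_M0 : ∀ w, ip (M0 w) (M0 w) ≤ a ^ 2 * ip w w)
    (bound_M1 : ∀ w, ip (M1 w) (M1 w) ≤ a ^ 2 * ip w w)
    (bound_D : ∀ w, ip (D w) (D w) ≤ a ^ 2 * ip w w)
    (symm_σ : ∀ w z, σ w z = σ z w) (nonneg_σ : ∀ w, 0 ≤ σ w w)
    (bound_σ : ∀ w, σ w w ≤ a ^ 2 * ip w w)
    (bound_res : ∀ w, ip (A w + M1 w + D w) (A w + M1 w + D w) ≤ a ^ 2 * σ w w)
    (energy : ∀ w, 2 * ip (A w) w + ip (M1 w) w = -2 * σ w w) :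
    DissipativePair M0 N0 M1 A D σ m a where
  pos_m := pos_m
  one_le_a := one_le_a
  mul_left := mul_left
  mul_right := mul_right
  coercive w := by rw [sq_norm_eq_ip]; exact coercive w
  symm_M0 := symm_M0
  symm_M1 := symm_M1
  bound_M0 w := norm_le_of_ip_le (zero_le_one.trans one_le_a) (bound_M0 w)
  bound_M1 w := norm_le_of_ip_le (zero_le_one.trans one_le_a) (bound_M1 w)
  bound_D w := norm_le_of_ip_le (zero_le_one.trans one_le_a) (bound_D w)
  symm_σ := symm_σ
  nonneg_σ := nonneg_σ
  bound_σ w := by rw [sq_norm_eq_ip]; exact bound_σ w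
  bound_res w := by rw [sq_norm_eq_ip]; exact bound_res w
  energy := energy

end InnerProduct

/-! ### The tent operators as elementwise matrices -/

section TentOperators

variable {d b p : ℕ} {T : Mesh d} {v : Space d} {c : Coefficients d b} {t : Tent T v}

lemma opM0_eq : opM0 p c t = actOp fun K => c.G K - c.flux K (t.bot.grad K) := opOf_massForm _

lemma opM1_eq : opM1 p c t = actOp fun K => c.flux K (t.delta.grad K) := opOf_massForm _

/-- M(τ) is the mass operator of the intermediate front φ_bot + τδ, so causality of that front
yields its coercivity. -/
lemma opM_eq (τ : ℝ) :
    opM p c t τ = actOp fun K => c.G K - c.flux K (t.bot.grad K + τ • t.delta.grad K) := by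
  rw [opM, opM0_eq, opM1_eq]
  refine LinearMap.ext fun w => on_injective fun K => ?_
  have h : on ((actOp (fun K => c.G K - c.flux K (t.bot.grad K))
      - τ • actOp fun K => c.flux K (t.delta.grad K) : Module.End ℝ (DG T v b p)) w) K
      = on (actOp (fun K => c.G K - c.flux K (t.bot.grad K)) w) K
        - τ • on (actOp (fun K => c.flux K (t.delta.grad K)) w) K := rfl
  rw [h, on_actOp, on_actOp, on_actOp, ← smul_act, sub_eq_iff_eq_add]
  have h2 : ∀ B B' : Matrix (Fin b) (Fin b) ℝ, act B (on w K) + act B' (on w K)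
      = act (B + B') (on w K) := fun B B' => by
    have := sum_act Finset.univ ![B, B'] (on w K)
    simpa [Fin.sum_univ_two] using this.symm
  rw [h2, Coefficients.flux_add, Coefficients.flux_smul]
  congr 1
  abel

lemma opX_eq (S : Matrix (Fin b) (Fin b) ℝ) (τ : ℝ) (i : ℕ) :
    opX p c S t τ i
      = taylorTerm (Ring.inverse (opM0 p c t)) (opA p c S t) (opM1 p c t) τ i := by
  induction i with
  | zero => rfl
  | succ i ih => rw [opX, taylorTerm, ih]

lemma ip_opA (S : Matrix (Fin b) (Fin b) ℝ) (w z : DG T v b p) :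
    ip (opA p c S t w) z = volForm c t.delta w z + facetForm c S t.delta w z := by
  rw [opA, ip_opOf, LinearMap.add_apply, LinearMap.add_apply]

lemma ip_opM1 (w z : DG T v b p) :
    ip (opM1 p c t w) z = massForm (fun K => c.flux K (t.delta.grad K)) w z := by
  rw [opM1, ip_opOf]

end TentOperators

/-! ### Uniform constants for tents -/

section Main

variable {n b p : ℕ} {T : Mesh (n + 1)} {v : Space (n + 1)} {c : Coefficients (n + 1) b}
  {t : Tent T v} {S : Matrix (Fin b) (Fin b) ℝ} {κ g₀ Λ cw cmax : ℝ}

lemma Tent.vanishesOff (t : Tent T v) : ∀ K ∈ T.patch v, t.delta.VanishesOff K v :=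
  fun K hK a ha hav => by
    have hf : {a} ∈ T.faces :=
      T.down_closed hK.1.1 (Finset.singleton_subset_iff.mpr ha) (Finset.singleton_nonempty a)
    change t.top.toFun a - t.bot.toFun a = 0
    rw [t.eq_of_ne a hf hav, sub_self]

lemma Tent.delta_nonneg (t : Tent T v) : 0 ≤ t.delta.toFun v := sub_nonneg.mpr t.pole

lemma Tent.grad_delta (t : Tent T v) {K : Finset (Space (n + 1))} (hK : K ∈ T.patch v) :
    t.delta.grad K = t.top.grad K - t.bot.grad K :=
  LagrangeP1.grad_sub (fun _ => rfl) (patchFrame ⟨K, hK⟩) hK.1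

lemma Tent.norm_grad_delta_le (hbot : t.bot.Causal cmax) (htop : t.top.Causal cmax)
    {K : Finset (Space (n + 1))} (hK : K ∈ T.patch v) : ‖t.delta.grad K‖ ≤ 2 / cmax := by
  rw [t.grad_delta hK]
  have h1 := (hbot K hK.1).le
  have h2 := (htop K hK.1).le
  refine (norm_sub_le _ _).trans ?_
  rw [show 2 / cmax = 1 / cmax + 1 / cmax by ring]
  exact add_le_add h2 h1

/-- For 0 ≤ τ ≤ 1 the gradient is a convex combination of those of the two fronts. -/
lemma Tent.norm_grad_front_le (hbot : t.bot.Causal cmax) (htop : t.top.Causal cmax) {τ : ℝ}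
    (h0 : 0 ≤ τ) (h1 : τ ≤ 1) {K : Finset (Space (n + 1))} (hK : K ∈ T.patch v) :
    ‖t.bot.grad K + τ • t.delta.grad K‖ ≤ 1 / cmax := by
  rw [t.grad_delta hK,
    show t.bot.grad K + τ • (t.top.grad K - t.bot.grad K)
      = (1 - τ) • t.bot.grad K + τ • t.top.grad K by module]
  refine (norm_add_le _ _).trans ?_
  rw [norm_smul, norm_smul, Real.norm_of_nonneg h0, Real.norm_of_nonneg (sub_nonneg.mpr h1)]
  have h2 := (hbot K hK.1).le
  have h3 := (htop K hK.1).le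
  nlinarith [mul_le_mul_of_nonneg_left h2 (sub_nonneg.mpr h1), mul_le_mul_of_nonneg_left h3 h0]

/-- The coercivity constant of the mass operators on the intermediate fronts. -/
def coercivityConst (g₀ cw cmax : ℝ) : ℝ := (1 - max cw 0 / cmax) * g₀

lemma coercivityConst_pos (hg₀ : 0 < g₀) (hcmax : 0 < cmax) (hcw : cw < cmax) :
    0 < coercivityConst g₀ cw cmax := by
  refine mul_pos ?_ hg₀
  rw [sub_pos, div_lt_one hcmax]
  exact max_lt hcw hcmax

lemma coercive_front (hc : c.Admissible T g₀ Λ cw) (hg₀ : 0 < g₀) (hcmax : 0 < cmax)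
    (hcw : cw < cmax) (hbot : t.bot.Causal cmax) (htop : t.top.Causal cmax) {τ : ℝ}
    (h0 : 0 ≤ τ) (h1 : τ ≤ 1) : ∀ K ∈ T.patch v, ∀ y : Fin b → ℝ,
      coercivityConst g₀ cw cmax * (y ⬝ᵥ y) ≤
        y ⬝ᵥ (c.G K - c.flux K (t.bot.grad K + τ • t.delta.grad K)).mulVec y :=
  fun _ hK y => Coefficients.coercive_of_norm_le hc hg₀ hK.1 hcmax hcw
    (Tent.norm_grad_front_le hbot htop h0 h1 hK) y

lemma coercive_bot (hc : c.Admissible T g₀ Λ cw) (hg₀ : 0 < g₀) (hcmax : 0 < cmax)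
    (hcw : cw < cmax) (hbot : t.bot.Causal cmax) : ∀ K ∈ T.patch v, ∀ y : Fin b → ℝ,
      coercivityConst g₀ cw cmax * (y ⬝ᵥ y) ≤
        y ⬝ᵥ (c.G K - c.flux K (t.bot.grad K)).mulVec y :=
  fun K hK y => Coefficients.coercive_of_norm_le hc hg₀ hK.1 hcmax hcw (hbot K hK.1).le y

lemma isSymm_sub_flux (hc : c.Admissible T g₀ Λ cw)
    (ξ : Finset (Space (n + 1)) → Space (n + 1)) :
    ∀ K ∈ T.patch v, (c.G K - c.flux K (ξ K)).IsSymm :=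
  fun _ hK => (hc.symm_G _ hK.1).sub (Coefficients.flux_isSymm hc hK.1 _)

lemma positiveDefinite_actOp {B : Finset (Space (n + 1)) → Matrix (Fin b) (Fin b) ℝ} {m : ℝ}
    (hm : 0 < m) (hs : ∀ K ∈ T.patch v, (B K).IsSymm)
    (hB : ∀ K ∈ T.patch v, ∀ y : Fin b → ℝ, m * (y ⬝ᵥ y) ≤ y ⬝ᵥ (B K).mulVec y) :
    PositiveDefinite (actOp B : Module.End ℝ (DG T v b p)) :=
  ⟨ip_actOp_comm hs, fun w hw => (mul_pos hm (ip_self_pos hw)).trans_le (le_ip_actOp_self hB w)⟩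

/-- Each step adds a power of δ at the expense of the degree, and M₀⁻¹, a constant matrix on each
element, preserves such multiples. -/
lemma smoothTerm_eq_zero (hc : c.Admissible T g₀ Λ cw) (hg₀ : 0 < g₀) (hcmax : 0 < cmax)
    (hcw : cw < cmax) (hbot : t.bot.Causal cmax) :
    smoothTerm (Ring.inverse (opM0 p c t)) (weightedDiv c t.delta) (opM1 p c t) (p + 1) = 0 := by
  have key : ∀ i ≤ p + 1, ∀ w : DG T v b p, IsPowMultiple t.delta i
      (smoothTerm (Ring.inverse (opM0 p c t)) (weightedDiv c t.delta) (opM1 p c t) i w) := by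
    intro i
    induction i with
    | zero => exact fun _ w => isPowMultiple_zero _
    | succ i ih =>
      intro hi w
      set u := smoothTerm (Ring.inverse (opM0 p c t)) (weightedDiv c t.delta) (opM1 p c t) i w
        with hu
      change IsPowMultiple _ _ (Ring.inverse (opM0 p c t)
        ((i : ℝ) • opM1 p c t u - weightedDiv c t.delta u))
      rw [opM0_eq, opM1_eq, inverse_actOp (coercivityConst_pos hg₀ hcmax hcw)
        (coercive_bot hc hg₀ hcmax hcw hbot)]
      exact ((ih (by omega) w).step (by omega)).actOp _
  exact LinearMap.ext fun w => (key (p + 1) le_rfl w).eq_zero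

attribute [local instance] normedAddCommGroupDG innerProductSpaceDG

/-- The constants are variables fixed by equations that do not mention the mesh, the coefficients or
the tent; this keeps the bounds visibly uniform. -/
lemma dissipativePair_opA {T : Mesh (n + 1)} (hT : T.ShapeRegular κ)
    {c : Coefficients (n + 1) b} (hc : c.Admissible T g₀ Λ cw) {v : Space (n + 1)}
    (hv : v ∈ interior T.domain) {t : Tent T v} (hbot : t.bot.Causal cmax)
    (htop : t.top.Causal cmax) (hκ : 0 < κ) (hg₀ : 0 < g₀) (hcmax : 0 < cmax) (hcw : cw < cmax)
    (hSs : S.IsSymm) {s Cs Cinv Ct e₀ e₁ CD Cσ Cr a : ℝ} (hSe : ∀ i k, |S i k| ≤ s)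
    (hCs0 : 0 < Cs) (hCs : ∀ y : Fin b → ℝ, y ⬝ᵥ y ≤ Cs * (y ⬝ᵥ S.mulVec y)) (hCinv : 0 < Cinv)
    (hinv : ∀ P : MvPolynomial (Fin (n + 1)) ℝ, P.totalDegree ≤ p → ∀ y ∈ refSimplex (n + 1),
      eval y.ofLp P ^ 2 ≤ Cinv * ∫ y in refSimplex (n + 1), eval y.ofLp P ^ 2 ∧
      ∀ i, eval y.ofLp (pderiv i P) ^ 2
        ≤ Cinv * ∫ y in refSimplex (n + 1), eval y.ofLp P ^ 2)
    (hCt : (n + 1) * (volume.real (refSimplex n) * (2 / cmax * κ) * Cinv) = Ct)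
    (he₀ : |Λ| + (n + 1) * (1 / cmax * |Λ|) = e₀) (he₁ : (n + 1) * (2 / cmax * |Λ|) = e₁)
    (hCD : (n + 1) ^ 2 * ((b * |Λ|) ^ 2 * (volume.real (refSimplex (n + 1)) * (n + 1) ^ 2
      * (2 / cmax * κ) ^ 2 * Cinv)) = CD)
    (hCσ : 2 * (1 + (b * s) ^ 2) * Ct = Cσ)
    (hCr : ((b * ((n + 1) * |Λ|)) ^ 2 + (b * s) ^ 2) * Cs ≤ Cr) (hCr' : 4 * Ct ≤ Cr)
    (hCr0 : 0 < Cr) (ha1 : 1 ≤ a) (ha₀ : b * e₀ ≤ a) (ha₁ : b * e₁ ≤ a) (haD : CD ≤ a)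
    (haσ : Cσ ≤ a) (har : 2 * Cr ≤ a) :
    DissipativePair (opM0 p c t) (Ring.inverse (opM0 p c t)) (opM1 p c t) (opA p c S t)
      (weightedDiv c t.delta) (jumpForm S t.delta) (coercivityConst g₀ cw cmax) a := by
  have hm := coercivityConst_pos hg₀ hcmax hcw
  have hcoer := coercive_bot (t := t) hc hg₀ hcmax hcw hbot
  -- `CD` and `Cσ` already bound squares and are compared with a² through a ≥ 1.
  have hsq : ∀ {x : ℝ}, x ≤ a → x ≤ a ^ 2 := fun hx => by nlinarith
  have hδ := t.vanishesOff
  have hδ0 := t.delta_nonneg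
  have hB : ∀ (K : T.patch v) i, |t.delta.toFun v| * ‖(patchFrame K).g i‖ ≤ 2 / cmax * κ := fun K i =>
    LagrangeP1.abs_mul_norm_g_le (patchFrame K) K.2.1 (hδ K K.2) hκ (hT K K.2.1)
      (Tent.norm_grad_delta_le hbot htop K.2) i
  have hnn : ∀ K ∈ T.patch v, ∀ x ∈ body K, 0 ≤ t.delta.toFun x := fun K hK x hx =>
    LagrangeP1.nonneg_of_mem_body (patchFrame ⟨K, hK⟩) hK.1 (hδ K hK) hδ0 hx
  have htrace : ∀ z : DG T v b p,
      facetSum t.delta (fun K _ => dot (on z K) (on z K)) ≤ Ct * ip z z := fun z =>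
    hCt ▸ sum_facetInt_dot_self_le hδ hδ0 (fun P hP y hy => (hinv P hP y hy).1) hCinv.le hB hv z
  have hσnn : ∀ w : DG T v b p, 0 ≤ jumpForm S t.delta w w := fun w => by
    have h1 : facetSum t.delta (fun _ _ : T.patch v => 0) = 0 := by
      have := facetSum_smul (δ := t.delta) 0 (fun _ _ : T.patch v => 0)
      simpa using this
    rw [jumpForm_eq, ← h1]
    refine facetSum_mono hnn fun K K' _ x => ?_
    rw [map_zero, eval_dot, evalVec_act, dotProduct_comm]
    have h2 := real_dotProduct_self_nonneg (evalVec x (on w K' - on w K))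
    exact nonneg_of_mul_nonneg_right (h2.trans (hCs _)) hCs0
  have hsq' : ∀ {x : ℝ}, 0 ≤ x → x ≤ a → ∀ w : DG T v b p, x ^ 2 * ip w w ≤ a ^ 2 * ip w w :=
    fun hx hxa w => mul_le_mul_of_nonneg_right (pow_le_pow_left₀ hx hxa 2) (ip_self_nonneg w)
  refine dissipativePair_of_ip hm ha1 ?_ ?_ ?_ ?_ ?_ ?_ ?_ ?_ (jumpForm_comm hSs) hσnn ?_ ?_ ?_
  · rw [opM0_eq, inverse_actOp hm hcoer, actOp_inv_mul hm hcoer]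
  · rw [opM0_eq, inverse_actOp hm hcoer, actOp_mul_inv hm hcoer]
  · rw [opM0_eq]
    exact le_ip_actOp_self hcoer
  · rw [opM0_eq]
    exact ip_actOp_comm (isSymm_sub_flux hc _)
  · rw [opM1_eq]
    exact ip_actOp_comm (fun K hK => Coefficients.flux_isSymm hc hK.1 _)
  · intro w
    rw [opM0_eq]
    refine (ip_actOp_self_le (e := e₀) (fun K hK i k => ?_) w).trans
      (hsq' (mul_nonneg (Nat.cast_nonneg b) (by rw [← he₀]; positivity)) ha₀ w)
    rw [Matrix.sub_apply, ← he₀]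
    refine (abs_sub _ _).trans (add_le_add ((hc.bound_G K hK.1 i k).trans (le_abs_self Λ)) ?_)
    refine (Coefficients.abs_flux_le hc hK.1 _ i k).trans ?_
    have := (hbot K hK.1).le
    push_cast
    gcongr
  · intro w
    rw [opM1_eq]
    refine (ip_actOp_self_le (e := e₁) (fun K hK i k => ?_) w).trans
      (hsq' (mul_nonneg (Nat.cast_nonneg b) (by rw [← he₁]; positivity)) ha₁ w)
    refine (Coefficients.abs_flux_le hc hK.1 _ i k).trans ?_
    rw [← he₁]
    have := Tent.norm_grad_delta_le hbot htop hK
    push_cast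
    gcongr
  · intro w
    refine (ip_weightedDiv_self_le hc hδ (fun P hP y hy => (hinv P hP y hy).2) hB w).trans ?_
    rw [hCD]
    exact mul_le_mul_of_nonneg_right (hsq haD) (ip_self_nonneg w)
  · intro w
    refine (jumpForm_self_le hnn hSe w).trans ?_
    refine (mul_le_mul_of_nonneg_left (htrace w) (by positivity)).trans ?_
    rw [← mul_assoc, hCσ]
    exact mul_le_mul_of_nonneg_right (hsq haσ) (ip_self_nonneg w)
  · intro w
    refine (ip_self_le_of_forall_le (σ := jumpForm S t.delta w w) hCr0 fun z => ?_).trans ?_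
    · rw [map_add, map_add, LinearMap.add_apply, LinearMap.add_apply, ip_opA, ip_opM1]
      refine (residual_le hc hv hδ hnn hSe hCs le_rfl w z).trans (add_le_add ?_ ?_)
      · exact mul_le_mul_of_nonneg_right hCr (hσnn w)
      · have h1 := htrace z
        have h2 := mul_le_mul_of_nonneg_right hCr' (ip_self_nonneg z)
        linarith
    · refine mul_le_mul_of_nonneg_right ?_ (hσnn w)
      rw [show 4 * Cr ^ 2 = (2 * Cr) ^ 2 by ring]
      exact pow_le_pow_left₀ (by positivity) har 2
  · intro w
    rw [ip_opA, ip_opM1]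
    exact energy_identity hc hv hδ w

/-- Here a is chosen before the mesh, the coefficients, the vertex and the tent, which is where the
independence of the mesh size is settled. -/
theorem exists_dissipativePair (n b p : ℕ) {S : Matrix (Fin b) (Fin b) ℝ} (hS : S.PosDef)
    {κ g₀ cw cmax : ℝ} (Λ : ℝ) (hκ : 0 < κ) (hg₀ : 0 < g₀) (hcmax : 0 < cmax)
    (hcw : cw < cmax) : ∃ a : ℝ, 1 ≤ a ∧ ∀ (T : Mesh (n + 1)), T.ShapeRegular κ →
      ∀ c : Coefficients (n + 1) b, c.Admissible T g₀ Λ cw → ∀ v ∈ interior T.domain,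
      ∀ t : Tent T v, t.bot.Causal cmax → t.top.Causal cmax →
      DissipativePair (opM0 p c t) (Ring.inverse (opM0 p c t)) (opM1 p c t) (opA p c S t)
        (weightedDiv c t.delta) (jumpForm S t.delta) (coercivityConst g₀ cw cmax) a := by
  have hSs : S.IsSymm := by
    have := hS.1
    rwa [Matrix.IsHermitian, Matrix.conjTranspose_eq_transpose_of_trivial] at this
  -- Positive definiteness of S makes the dissipation control the full jump.
  obtain ⟨Cs, hCs0, hCs⟩ : ∃ Cs : ℝ, 0 < Cs ∧ ∀ y : Fin b → ℝ,
      y ⬝ᵥ y ≤ Cs * (y ⬝ᵥ S.mulVec y) := by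
    obtain ⟨C, hC, h⟩ := exists_sq_norm_le_of_posDef (Matrix.toBilin' S)
      (fun x y => by
        rw [Matrix.toBilin'_apply', Matrix.toBilin'_apply', Matrix.dotProduct_mulVec,
          ← Matrix.mulVec_transpose, hSs, dotProduct_comm])
      (fun x hx => by
        rw [Matrix.toBilin'_apply']
        simpa using hS.dotProduct_mulVec_pos hx)
      (WithLp.linearEquiv 2 ℝ (Fin b → ℝ)).symm.toLinearMap
    refine ⟨C, hC, fun y => ?_⟩
    have h1 := h y
    rw [Matrix.toBilin'_apply'] at h1
    refine le_trans (le_of_eq ?_) h1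
    rw [EuclideanSpace.norm_sq_eq]
    exact Finset.sum_congr rfl fun i _ => by simp [sq]
  obtain ⟨Cinv, hCinv, hinv⟩ := exists_inverse_const (n + 1) p
  have hSe : ∀ i k, |S i k| ≤ ∑ i, ∑ k, |S i k| := fun i k =>
    (Finset.single_le_sum (f := fun k => |S i k|) (fun _ _ => abs_nonneg _)
      (Finset.mem_univ k)).trans (Finset.single_le_sum (f := fun i => ∑ k, |S i k|)
        (fun _ _ => Finset.sum_nonneg fun _ _ => abs_nonneg _) (Finset.mem_univ i))
  obtain ⟨s, hs⟩ : ∃ s, ∑ i, ∑ k, |S i k| = s := ⟨_, rfl⟩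
  obtain ⟨Ct, hCt⟩ : ∃ Ct,
    (n + 1) * (volume.real (refSimplex n) * (2 / cmax * κ) * Cinv) = Ct := ⟨_, rfl⟩
  obtain ⟨e₀, he₀⟩ : ∃ e₀, |Λ| + (n + 1) * (1 / cmax * |Λ|) = e₀ := ⟨_, rfl⟩
  obtain ⟨e₁, he₁⟩ : ∃ e₁, (n + 1) * (2 / cmax * |Λ|) = e₁ := ⟨_, rfl⟩
  obtain ⟨CD, hCD⟩ : ∃ CD, (n + 1) ^ 2 * ((b * |Λ|) ^ 2 * (volume.real (refSimplex (n + 1))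
    * (n + 1) ^ 2 * (2 / cmax * κ) ^ 2 * Cinv)) = CD := ⟨_, rfl⟩
  obtain ⟨Cσ, hCσ⟩ : ∃ Cσ, 2 * (1 + (b * s) ^ 2) * Ct = Cσ := ⟨_, rfl⟩
  obtain ⟨Cj, hCj⟩ : ∃ Cj, ((b * ((n + 1) * |Λ|)) ^ 2 + (b * s) ^ 2) * Cs = Cj := ⟨_, rfl⟩
  have hCt0 : 0 ≤ Ct := by rw [← hCt]; positivity
  have he₀0 : 0 ≤ b * e₀ := by rw [← he₀]; positivity
  have he₁0 : 0 ≤ b * e₁ := by rw [← he₁]; positivity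
  have hCD0 : 0 ≤ CD := by rw [← hCD]; positivity
  have hCσ0 : 0 ≤ Cσ := by rw [← hCσ]; positivity
  have hCj0 : 0 ≤ Cj := by rw [← hCj]; positivity
  -- The sum dominates every bound that is needed; the 1 in the last bracket makes `Cr` positive.
  refine ⟨1 + b * e₀ + b * e₁ + CD + Cσ + 2 * (1 + Cj + 4 * Ct), by linarith,
    fun T hT c hc v hv t hbot htop => ?_⟩
  exact dissipativePair_opA hT hc hv hbot htop hκ hg₀ hcmax hcw hSs (hs ▸ hSe) hCs0 hCs hCinv
    hinv hCt he₀ he₁ hCD hCσ (Cr := 1 + Cj + 4 * Ct) (by linarith) (by linarith) (by linarith)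
    (by linarith) (by linarith) (by linarith) (by linarith) (by linarith) (by linarith)

/-- Passes from squared norms to norms by √(1 + r) ≤ 1 + r. -/
lemma sqrt_le_one_add_mul_sqrt {x y r : ℝ} (hr : 0 ≤ r) (h : x ≤ (1 + r) * y) :
    Real.sqrt x ≤ (1 + r) * Real.sqrt y := by
  refine (Real.sqrt_le_sqrt h).trans ?_
  rw [Real.sqrt_mul (by linarith)]
  refine mul_le_mul_of_nonneg_right ?_ (Real.sqrt_nonneg _)
  rw [Real.sqrt_le_left (by linarith)]
  nlinarith

end Main

end TentSAT

end

/-! ### The stability theorem -/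

theorem mainTheorem7 (d b s p : ℕ) (hd : 1 ≤ d) (hp : 0 < p) (hps : (p : ℝ) ≤ ((s : ℝ) - 1) / 2)
    (S : Matrix (Fin b) (Fin b) ℝ) (hS : S.PosDef)
    (κ g₀ Λ cw cmax : ℝ) (hκ : 0 < κ) (hg₀ : 0 < g₀) (hcmax : 0 < cmax) (hcw : cw < cmax) :
    ∃ τ₀ : ℝ, 0 < τ₀ ∧ ∃ C : ℝ, 0 < C ∧
      ∀ (T : TentSAT.Mesh d), T.ShapeRegular κ →
      ∀ (c : TentSAT.Coefficients d b), c.Admissible T g₀ Λ cw →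
      ∀ (v : TentSAT.Space d), {v} ∈ T.faces → v ∈ interior T.domain →
      ∀ (t : TentSAT.Tent T v), t.bot.Causal cmax → t.top.Causal cmax →
      ∀ τ : ℝ, 0 < τ → τ ≤ τ₀ →
        TentSAT.PositiveDefinite (TentSAT.opM0 p c t) ∧
        TentSAT.PositiveDefinite (TentSAT.opM p c t τ) ∧
        ∀ w : TentSAT.DG T v b p,
          TentSAT.normOf (TentSAT.opM p c t τ) (TentSAT.opR p c S t s τ w) ≤
            (1 + C * τ ^ (2 * s - 2 * p + 1)) * TentSAT.normOf (TentSAT.opM0 p c t) w := by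
  obtain ⟨n, rfl⟩ : ∃ n, d = n + 1 := ⟨d - 1, by omega⟩
  have hps' : p + 1 ≤ s := by
    have : ((2 * p + 1 : ℕ) : ℝ) ≤ s := by push_cast; linarith
    have : 2 * p + 1 ≤ s := by exact_mod_cast this
    omega
  obtain ⟨a, ha, hpair⟩ := TentSAT.exists_dissipativePair n b p hS Λ hκ hg₀ hcmax hcw
  have hm := TentSAT.coercivityConst_pos hg₀ hcmax hcw
  obtain ⟨τ₀, hτ₀, hτ₀1, C, hC, hstab⟩ :=
    TentSAT.exists_stability_of_smoothTerm_eq_zero s p hps' _ a hm ha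
  refine ⟨τ₀, hτ₀, C, hC, fun T hT c hc v _ hv t hbot htop τ hτ hττ₀ => ?_⟩
  -- This needs τ₀ ≤ 1: beyond the top front causality could fail.
  have hM := TentSAT.coercive_front hc hg₀ hcmax hcw hbot htop hτ.le (hττ₀.trans hτ₀1)
  refine ⟨?_, ?_, fun w => TentSAT.sqrt_le_one_add_mul_sqrt (by positivity) ?_⟩
  · rw [TentSAT.opM0_eq]
    exact TentSAT.positiveDefinite_actOp hm (TentSAT.isSymm_sub_flux hc _)
      (TentSAT.coercive_bot hc hg₀ hcmax hcw hbot)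
  · rw [TentSAT.opM_eq]
    exact TentSAT.positiveDefinite_actOp hm (TentSAT.isSymm_sub_flux hc _) hM
  -- The subtractions are in ℕ and not truncated, since p < s.
  · rw [show 2 * s - 2 * p + 1 = 2 * (s - p) + 1 by omega]
    let _ := TentSAT.normedAddCommGroupDG (T := T) (v := v) (b := b) (p := p)
    let _ := TentSAT.innerProductSpaceDG (T := T) (v := v) (b := b) (p := p)
    refine hstab (hpair T hT c hc v hv t hbot htop)
      (TentSAT.smoothTerm_eq_zero hc hg₀ hcmax hcw hbot) τ hτ hττ₀
      (Ring.inverse (TentSAT.opM p c t τ)) ?_ (fun w => ?_) w _ ?_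
    · change TentSAT.opM p c t τ * _ = 1
      rw [TentSAT.opM_eq, TentSAT.inverse_actOp hm hM, TentSAT.actOp_mul_inv hm hM]
    · change _ * ‖w‖ ^ 2 ≤ inner ℝ (TentSAT.opM p c t τ w) w
      rw [TentSAT.opM_eq, TentSAT.sq_norm_eq_ip, TentSAT.inner_eq_ip]
      exact TentSAT.le_ip_actOp_self hM w
    · simp only [TentSAT.opR, TentSAT.opX_eq]
      simp [LinearMap.sum_apply]
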